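/- Let $S$ be a scheme and let $\mathrm{Aff}_{/S}$ be the category of affine schemes over $S$. A prestack over $S$ is a category fibred in groupoids $p : \mathcal{X} \to \mathrm{Aff}_{/S}$; $1$-morphisms of prestacks are functors over $\mathrm{Aff}_{/S}$, and $2$-morphisms are natural transformations over $\mathrm{Aff}_{/S}$. Every prestack $\mathcal{X}$ carries the étale topology inherited from $\mathrm{Aff}_{/S}$ and the structure sheaf $\mathcal{O}_{\mathcal{X}}(x) = \Gamma(p(x), \mathcal{O}_{p(x)})$. Let $\mathrm{Vect}(\mathcal{X})$ be the category of finite locally free sheaves of $\mathcal{O}_{\mathcal{X}}$-modules on $\mathcal{X}$; modules are pulled back along a $1$-morphism by composition. We write $[E,F]$ for the internal Hom, $[E,F](x) = \mathrm{Hom}(E|_x, F|_x)$ with $E|_x$ the restriction of $E$ to $\mathcal{X}_{/x}$, and $E^\vee = [E, \mathcal{O}]$. For a commutative $\mathcal{O}_{\mathcal{X}}$-algebra $A$, the objects of the relative spectrum $\underline{\mathrm{Spec}}_{\mathcal{X}}(A)$ are the pairs of an object $x$ of $\mathcal{X}$ and a morphism of $\mathcal{O}|_x$-algebras $A|_x \to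 \mathcal{O}|_x$, and $\mathbb{V}M := \underline{\mathrm{Spec}}_{\mathcal{X}}(\mathrm{Sym}(M^\vee)) \to \mathcal{X}$. For prestacks $\mathcal{Y}, \mathcal{Z}$ over $S$, the objects of the mapping prestack $\mathrm{Map}_S(\mathcal{Y},\mathcal{Z})$ over $U$ are the $1$-morphisms $U \times_S \mathcal{Y} \to \mathcal{Z}$, and its morphisms $(U,f) \to (U',f')$ are the pairs of a morphism $g : U \to U'$ and a (necessarily invertible) $2$-morphism $f \Rightarrow f' \circ (g \times \mathrm{id})$. Let $\mathcal{M} = \coprod_{n \ge 0} B\mathrm{GL}_{n,S}$ be the stack of vector bundles over $S$ (the disjoint union is taken in stacks, so that $\mathcal{M}(U) = \mathrm{Vect}(U)^{\simeq}$ for $U \in \mathrm{Aff}_{/S}$). For a prestack $\mathcal{X}$ over $S$, let $\mathcal{M}(\mathcal{X}) = \mathrm{Map}_S(\mathcal{X}, \mathcal{M})$ and $\mathcal{B}(\mathcal{X}) = \mathcal{M}(\mathcal{X}) \times_S \mathcal{X}$, let $\mathcal{E}(\mathcal{X})$ be the universal vector bundle on $\mathcal{B}(\mathcal{X})$, i.e.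 the pullback of the universal vector bundle on $\mathcal{M}$ along the evaluation $\mathcal{M}(\mathcal{X}) \times_S \mathcal{X} \to \mathcal{M}$, and let $$\pi : \mathcal{V}(\mathcal{X}) := \mathbb{V}\,[\mathrm{pr}_1^*\mathcal{E}(\mathcal{X}), \mathrm{pr}_2^*\mathcal{E}(\mathcal{X})] \to \mathcal{B}(\mathcal{X}) \times_S \mathcal{B}(\mathcal{X}).$$ Define $\mathcal{M}_1'(\mathcal{X})$ as the ($2$-categorical) fibre product of $$\mathrm{Map}_S(\mathcal{X}, \mathcal{V}(\mathcal{X})) \xrightarrow{\ \pi \circ -\ } \mathrm{Map}_S(\mathcal{X}, \mathcal{B}(\mathcal{X}) \times_S \mathcal{B}(\mathcal{X})) \longleftarrow \mathcal{M}(\mathcal{X}) \times_S \mathcal{M}(\mathcal{X}),$$ where the arrow on the right sends a pair $(v,w)$ of points over $U$ to the morphism $(v \times \mathrm{id}_{\mathcal{X}}, w \times \mathrm{id}_{\mathcal{X}}) : U \times_S \mathcal{X} \to \mathcal{B}(\mathcal{X}) \times_S \mathcal{B}(\mathcal{X})$. Define $\mathcal{M}_1(\mathcal{X})$ as the category over $\mathrm{Aff}_{/S}$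 whose objects over $U$ are the triples $(E, F, s)$ with $E, F \in \mathrm{Vect}(U \times_S \mathcal{X})$ and $s : E \to F$ a morphism of $\mathcal{O}_{U \times_S \mathcal{X}}$-modules, and whose morphisms $(U,E,F,s) \to (U',E',F',s')$ are the triples $(f,a,b)$ of a morphism $f : U \to U'$ over $S$ and isomorphisms $a : (f \times \mathrm{id}_{\mathcal{X}})^*E' \cong E$ and $b : (f \times \mathrm{id}_{\mathcal{X}})^*F' \cong F$ with $s \circ a = b \circ (f \times \mathrm{id}_{\mathcal{X}})^* s'$. **Theorem.** For every prestack $\mathcal{X}$ over $S$, both $\mathcal{M}_1'(\mathcal{X})$ and $\mathcal{M}_1(\mathcal{X})$ are prestacks over $S$, and they are equivalent as prestacks over $S$: there are $1$-morphisms $\Psi : \mathcal{M}_1'(\mathcal{X}) \to \mathcal{M}_1(\mathcal{X})$ and $\Phi : \mathcal{M}_1(\mathcal{X}) \to \mathcal{M}_1'(\mathcal{X})$ of prestacks over $S$ such that $\Phi \circ \Psi$ and $\Psi \circ \Phi$ are isomorphic, by invertible $2$-morphisms, to the identities. -/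

import Mathlib

open CategoryTheory Opposite AlgebraicGeometry
open scoped CategoryTheory.BasedFunctor

universe t t₁ t₂ t₃ v w u v₁ w₁ v₂ w₂ v₃ w₃

noncomputable section

namespace ArrowBundle

/-! ### Affine schemes over `S`, prestacks over `S` -/

/-- The category `Aff_{/S}` of affine schemes over the scheme `S`. -/
abbrev AffOver (S : Scheme.{u}) : Type (u + 1) :=
  ObjectProperty.FullSubcategory fun U : Over S => IsAffine U.left

/-- The underlying scheme of an affine scheme over `S`. -/
abbrev AffOver.toScheme (S : Scheme.{u}) : AffOver S ⥤ Scheme.{u} :=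
  ObjectProperty.ι _ ⋙ Over.forget S

/-- Global functions on affine schemes over `S`. -/
abbrev AffOver.Γ (S : Scheme.{u}) : (AffOver S)ᵒᵖ ⥤ CommRingCat.{u} :=
  (AffOver.toScheme S).op ⋙ Scheme.Γ

variable {S : Scheme.{u}}

/-- A prestack over `S` is a category fibred in groupoids over `Aff_{/S}`.  Its `1`-morphisms are
the based functors and its `2`-morphisms are the based natural transformations. -/
structure IsPrestack (X : BasedCategory.{v, w} (AffOver S)) : Prop where
  isFibered : X.p.IsFibered
  isGroupoid (U : AffOver S) : IsGroupoid (X.p.Fiber U)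

/-- The prestack `S` itself, the terminal object among prestacks over `S`. -/
abbrev terminal (S : Scheme.{u}) : BasedCategory.{u, u + 1} (AffOver S) :=
  { obj := AffOver S, p := 𝟭 (AffOver S) }

/-- A functor covering the identity of `Aff_{/S}` up to equality, as a based functor. -/
def basedOfLift {X : BasedCategory.{v₁, w₁} (AffOver S)} {Y : BasedCategory.{v₂, w₂} (AffOver S)}
    (F : X.obj ⥤ Y.obj) (h : ∀ {x y : X.obj} (f : x ⟶ y), Y.p.IsHomLift (X.p.map f) (F.map f)) :
    BasedFunctor X Y where
  toFunctor := F
  w := by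
    have ho (x : X.obj) : Y.p.obj (F.obj x) = X.p.obj x :=
      have := h (𝟙 x)
      IsHomLift.domain_eq Y.p (X.p.map (𝟙 x)) (F.map (𝟙 x))
    refine CategoryTheory.Functor.ext ho fun x y f => ?_
    have := h f
    exact IsHomLift.fac' Y.p (X.p.map f) (F.map f)

/-- An object of `Y ×_S Z`: a pair of objects of `Y` and `Z` over the same affine scheme. -/
@[ext]
structure ProdObj (Y : BasedCategory.{v₁, w₁} (AffOver S))
    (Z : BasedCategory.{v₂, w₂} (AffOver S)) where
  base : AffOver S
  fst : Y.obj
  snd : Z.obj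
  fst_base : Y.p.obj fst = base
  snd_base : Z.p.obj snd = base

/-- A morphism of `Y ×_S Z`: a pair of morphisms of `Y` and `Z` over the same morphism. -/
@[ext]
structure ProdHom {Y : BasedCategory.{v₁, w₁} (AffOver S)}
    {Z : BasedCategory.{v₂, w₂} (AffOver S)} (a b : ProdObj Y Z) where
  base : a.base ⟶ b.base
  fst : a.fst ⟶ b.fst
  snd : a.snd ⟶ b.snd
  fst_lift : Y.p.IsHomLift base fst
  snd_lift : Z.p.IsHomLift base snd

attribute [instance] ProdHom.fst_lift ProdHom.snd_lift

instance {Y : BasedCategory.{v₁, w₁} (AffOver S)} {Z : BasedCategory.{v₂, w₂} (AffOver S)} :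
    Category (ProdObj Y Z) where
  Hom := ProdHom
  id a := ⟨𝟙 _, 𝟙 _, 𝟙 _, IsHomLift.id a.fst_base, IsHomLift.id a.snd_base⟩
  comp φ ψ := ⟨φ.base ≫ ψ.base, φ.fst ≫ ψ.fst, φ.snd ≫ ψ.snd, inferInstance, inferInstance⟩
  id_comp φ := by ext1 <;> exact Category.id_comp _
  comp_id φ := by ext1 <;> exact Category.comp_id _
  assoc φ ψ χ := by ext1 <;> exact Category.assoc _ _ _

/-- The fibre product `Y ×_S Z` of prestacks over `S`: pairs of an object of `Y` and an object of
`Z` over the same affine scheme, and pairs of morphisms over the same morphism. -/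
abbrev prod (Y : BasedCategory.{v₁, w₁} (AffOver S)) (Z : BasedCategory.{v₂, w₂} (AffOver S)) :
    BasedCategory.{max u v₁ v₂, max (u + 1) w₁ w₂} (AffOver S) where
  obj := ProdObj Y Z
  p := { obj := fun a => a.base, map := fun φ => ProdHom.base φ }

/-- The first projection `Y ×_S Z → Y`. -/
def prod.pr₁ (Y : BasedCategory.{v₁, w₁} (AffOver S)) (Z : BasedCategory.{v₂, w₂} (AffOver S)) :
    BasedFunctor (prod Y Z) Y :=
  basedOfLift { obj := fun a => ProdObj.fst a, map := fun φ => ProdHom.fst φ }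
    fun f => ProdHom.fst_lift f

/-- The second projection `Y ×_S Z → Z`. -/
def prod.pr₂ (Y : BasedCategory.{v₁, w₁} (AffOver S)) (Z : BasedCategory.{v₂, w₂} (AffOver S)) :
    BasedFunctor (prod Y Z) Z :=
  basedOfLift { obj := fun a => ProdObj.snd a, map := fun φ => ProdHom.snd φ }
    fun f => ProdHom.snd_lift f

/-- The morphism `(F, G) : W → Y ×_S Z`. -/
def prod.lift {W : BasedCategory.{v₃, w₃} (AffOver S)} {Y : BasedCategory.{v₁, w₁} (AffOver S)}
    {Z : BasedCategory.{v₂, w₂} (AffOver S)} (F : BasedFunctor W Y) (G : BasedFunctor W Z) :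
    BasedFunctor W (prod Y Z) where
  obj x := ⟨W.p.obj x, F.obj x, G.obj x, F.w_obj x, G.w_obj x⟩
  map f := ⟨W.p.map f, F.map f, G.map f, inferInstance, inferInstance⟩
  map_id x := ProdHom.ext (W.p.map_id x) (F.map_id x) (G.map_id x)
  map_comp f g := ProdHom.ext (W.p.map_comp f g) (F.map_comp f g) (G.map_comp f g)
  w := rfl

/-- An object of the `2`-categorical fibre product `Y ×_W Z` along `G` and `H`. -/
structure FibProdObj {Y : BasedCategory.{v₁, w₁} (AffOver S)}
    {Z : BasedCategory.{v₂, w₂} (AffOver S)} {W : BasedCategory.{v₃, w₃} (AffOver S)}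
    (G : BasedFunctor Y W) (H : BasedFunctor Z W) where
  base : AffOver S
  fst : Y.obj
  snd : Z.obj
  fst_base : Y.p.obj fst = base
  snd_base : Z.p.obj snd = base
  iso : G.obj fst ≅ H.obj snd
  iso_lift : W.p.IsHomLift (𝟙 base) iso.hom

/-- A morphism of the `2`-categorical fibre product `Y ×_W Z`. -/
@[ext]
structure FibProdHom {Y : BasedCategory.{v₁, w₁} (AffOver S)}
    {Z : BasedCategory.{v₂, w₂} (AffOver S)} {W : BasedCategory.{v₃, w₃} (AffOver S)}
    {G : BasedFunctor Y W} {H : BasedFunctor Z W} (a b : FibProdObj G H) where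
  base : a.base ⟶ b.base
  fst : a.fst ⟶ b.fst
  snd : a.snd ⟶ b.snd
  fst_lift : Y.p.IsHomLift base fst
  snd_lift : Z.p.IsHomLift base snd
  comm : G.map fst ≫ b.iso.hom = a.iso.hom ≫ H.map snd

attribute [instance] FibProdHom.fst_lift FibProdHom.snd_lift

instance {Y : BasedCategory.{v₁, w₁} (AffOver S)}
    {Z : BasedCategory.{v₂, w₂} (AffOver S)} {W : BasedCategory.{v₃, w₃} (AffOver S)}
    {G : BasedFunctor Y W} {H : BasedFunctor Z W} : Category (FibProdObj G H) where
  Hom := FibProdHom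
  id a := ⟨𝟙 _, 𝟙 _, 𝟙 _, IsHomLift.id a.fst_base, IsHomLift.id a.snd_base, by simp⟩
  comp φ ψ := ⟨φ.base ≫ ψ.base, φ.fst ≫ ψ.fst, φ.snd ≫ ψ.snd, inferInstance, inferInstance, by
    rw [G.map_comp, H.map_comp, Category.assoc, ψ.comm, ← Category.assoc, φ.comm, Category.assoc]⟩
  id_comp φ := by ext1 <;> exact Category.id_comp _
  comp_id φ := by ext1 <;> exact Category.comp_id _
  assoc φ ψ χ := by ext1 <;> exact Category.assoc _ _ _

/-- The (`2`-categorical) fibre product `Y ×_W Z` of prestacks over `S` along `G` and `H`: triples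
of objects `y`, `z` over the same affine scheme `U` and an isomorphism `G y ≅ H z` over `𝟙 U`. -/
abbrev fibProd {Y : BasedCategory.{v₁, w₁} (AffOver S)}
    {Z : BasedCategory.{v₂, w₂} (AffOver S)} {W : BasedCategory.{v₃, w₃} (AffOver S)}
    (G : BasedFunctor Y W) (H : BasedFunctor Z W) :
    BasedCategory.{max u v₁ v₂, max (u + 1) w₁ w₂ v₃} (AffOver S) where
  obj := FibProdObj G H
  p := { obj := fun a => a.base, map := fun φ => FibProdHom.base φ }

/-! ### The product of an affine scheme with a prestack, mapping prestacks -/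

/-- An object of `U ×_S Y`: a morphism `V ⟶ U` and an object of `Y` over `V` amount to an object `y`
of `Y` together with a morphism `p y ⟶ U`. -/
structure AffProdObj (U : AffOver S) (Y : BasedCategory.{v, w} (AffOver S)) where
  pt : Y.obj
  str : Y.p.obj pt ⟶ U

/-- A morphism of `U ×_S Y`: a morphism of `Y` compatible with the structure morphisms to `U`. -/
@[ext]
structure AffProdHom {U : AffOver S} {Y : BasedCategory.{v, w} (AffOver S)}
    (a b : AffProdObj U Y) where
  hom : a.pt ⟶ b.pt
  w : Y.p.map hom ≫ b.str = a.str := by cat_disch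

attribute [simp] AffProdHom.w

@[simp]
lemma AffProdHom.w_assoc {U : AffOver S} {Y : BasedCategory.{v, w} (AffOver S)}
    {a b : AffProdObj U Y} (φ : AffProdHom a b) {V : AffOver S} (h : U ⟶ V) :
    Y.p.map φ.hom ≫ b.str ≫ h = a.str ≫ h := by
  rw [← Category.assoc, φ.w]

@[simps]
instance {U : AffOver S} {Y : BasedCategory.{v, w} (AffOver S)} : Category (AffProdObj U Y) where
  Hom := AffProdHom
  id a := { hom := 𝟙 a.pt }
  comp φ ψ := { hom := φ.hom ≫ ψ.hom }

@[ext]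
lemma AffProdObj.hom_ext {U : AffOver S} {Y : BasedCategory.{v, w} (AffOver S)}
    {a b : AffProdObj U Y} {φ ψ : a ⟶ b} (h : φ.hom = ψ.hom) : φ = ψ := AffProdHom.ext h

/-- The prestack `U ×_S Y`, for an affine scheme `U` over `S`. -/
abbrev affProd (U : AffOver S) (Y : BasedCategory.{v, w} (AffOver S)) :
    BasedCategory.{v, max u w} (AffOver S) where
  obj := AffProdObj U Y
  p := { obj := fun a => Y.p.obj a.pt, map := fun φ => Y.p.map (AffProdHom.hom φ) }

/-- The morphism `f × id : U ×_S Y → V ×_S Y`. -/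
abbrev affProdMap {U V : AffOver S} (f : U ⟶ V) (Y : BasedCategory.{v, w} (AffOver S)) :
    BasedFunctor (affProd U Y) (affProd V Y) where
  obj y := ⟨y.pt, y.str ≫ f⟩
  map φ := { hom := φ.hom }
  w := rfl

/-- The morphism of `U ×_S Y` given by `𝟙 y` and an equality of structure morphisms. -/
abbrev affProdEq {U : AffOver S} {Y : BasedCategory.{v, w} (AffOver S)} {y : Y.obj}
    {f g : Y.p.obj y ⟶ U} (h : f = g) : (⟨y, f⟩ : AffProdObj U Y) ⟶ ⟨y, g⟩ :=
  { hom := 𝟙 y }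

/-- The isomorphism of `U ×_S Y` given by `𝟙 y` and an equality of structure morphisms. -/
abbrev affProdEqIso {U : AffOver S} {Y : BasedCategory.{v, w} (AffOver S)} {y : Y.obj}
    {f g : Y.p.obj y ⟶ U} (h : f = g) : (⟨y, f⟩ : AffProdObj U Y) ≅ ⟨y, g⟩ where
  hom := affProdEq h
  inv := affProdEq h.symm
  hom_inv_id := by ext; exact Category.comp_id _
  inv_hom_id := by ext; exact Category.comp_id _

lemma affProdEq_lift {U : AffOver S} {Y : BasedCategory.{v, w} (AffOver S)} {y : Y.obj}
    {f g : Y.p.obj y ⟶ U} (h : f = g) :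
    (affProd U Y).p.IsHomLift (𝟙 (Y.p.obj y)) (affProdEq h) := by
  have := IsHomLift.map (affProd U Y).p (affProdEq h)
  rwa [show (affProd U Y).p.map (affProdEq h) = 𝟙 (Y.p.obj y) from Y.p.map_id y] at this

lemma affProd_map_comp {U : AffOver S} {Y : BasedCategory.{v, w} (AffOver S)} {C : Type*}
    [Category C] (F : AffProdObj U Y ⥤ C) {x y z : AffProdObj U Y} (f : x ⟶ y) (g : y ⟶ z)
    (h : x ⟶ z) (e : f.hom ≫ g.hom = h.hom) : F.map f ≫ F.map g = F.map h := by
  rw [← F.map_comp]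
  exact congrArg _ (AffProdObj.hom_ext e)

/-- `𝟙 × id` is the identity of `U ×_S Y`. -/
def affProdMapId (U : AffOver S) (Y : BasedCategory.{v, w} (AffOver S)) :
    affProdMap (𝟙 U) Y ≅ BasedFunctor.id (affProd U Y) :=
  BasedNatIso.mkNatIso
    (NatIso.ofComponents (F := (affProdMap (𝟙 U) Y).toFunctor)
      (G := (BasedFunctor.id (affProd U Y)).toFunctor)
      (fun y => affProdEqIso (Category.comp_id y.str))
      (fun _ => AffProdObj.hom_ext ((Category.comp_id _).trans (Category.id_comp _).symm)))
    fun y => affProdEq_lift (Category.comp_id y.str)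

/-- `k × id` is the composition of `f × id` and `g × id` if `k = f ≫ g`. -/
def affProdMapComp {U V W : AffOver S} {f : U ⟶ V} {g : V ⟶ W} {k : U ⟶ W} (h : f ≫ g = k)
    (Y : BasedCategory.{v, w} (AffOver S)) :
    affProdMap k Y ≅ BasedFunctor.comp (affProdMap f Y) (affProdMap g Y) :=
  BasedNatIso.mkNatIso
    (NatIso.ofComponents (F := (affProdMap k Y).toFunctor)
      (G := (BasedFunctor.comp (affProdMap f Y) (affProdMap g Y)).toFunctor)
      (fun y => affProdEqIso (by rw [Category.assoc, h]))
      (fun _ => AffProdObj.hom_ext ((Category.comp_id _).trans (Category.id_comp _).symm)))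
    fun y => affProdEq_lift (by rw [Category.assoc, h])

/-- An object of `Map_S(Y, Z)` over `U`: a morphism `U ×_S Y → Z` of prestacks. -/
structure MapObj (Y : BasedCategory.{v₁, w₁} (AffOver S))
    (Z : BasedCategory.{v₂, w₂} (AffOver S)) where
  base : AffOver S
  mor : BasedFunctor (affProd base Y) Z

/-- A morphism `(U, F) ⟶ (V, G)` of `Map_S(Y, Z)`: a morphism `f : U ⟶ V` and a `2`-morphism
`F ⟶ G ∘ (f × id)`.  As `Z` is fibred in groupoids, such `2`-morphisms are invertible, so one could
equally take their inverses `G ∘ (f × id) ⟶ F`. -/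
structure MapHom {Y : BasedCategory.{v₁, w₁} (AffOver S)}
    {Z : BasedCategory.{v₂, w₂} (AffOver S)} (a b : MapObj Y Z) where
  base : a.base ⟶ b.base
  cell : a.mor ⟶ BasedFunctor.comp (affProdMap base Y) b.mor

section

variable {Y : BasedCategory.{v₁, w₁} (AffOver S)} {Z : BasedCategory.{v₂, w₂} (AffOver S)}

/-- The underlying functor of an object of the mapping prestack. -/
abbrev MapObj.toFun (a : MapObj Y Z) : AffProdObj a.base Y ⥤ Z.obj := a.mor.toFunctor

/-- The component of a morphism of the mapping prestack. -/
def MapHom.app {a b : MapObj Y Z} (φ : MapHom a b) (y : AffProdObj a.base Y) :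
    a.toFun.obj y ⟶ b.toFun.obj ⟨y.pt, y.str ≫ φ.base⟩ :=
  φ.cell.app y

lemma MapHom.ext' {a b : MapObj Y Z} {φ ψ : MapHom a b} (h : φ.base = ψ.base)
    (h' : ∀ y, φ.app y ≫ b.toFun.map (affProdEq (by rw [h])) = ψ.app y) : φ = ψ := by
  obtain ⟨f, c⟩ := φ
  obtain ⟨g, d⟩ := ψ
  obtain rfl : f = g := h
  congr 1
  ext y
  exact ((Category.comp_id _).symm.trans (congrArg _ (b.mor.map_id _).symm)).trans (h' y)

/-- The identity morphism of an object of `Map_S(Y, Z)`. -/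
abbrev MapHom.id (a : MapObj Y Z) : MapHom a a where
  base := 𝟙 _
  cell := BasedCategory.whiskerRight (affProdMapId a.base Y).inv a.mor

/-- The composition of morphisms of `Map_S(Y, Z)`, by pasting `2`-morphisms. -/
abbrev MapHom.comp {a b c : MapObj Y Z} (φ : MapHom a b) (ψ : MapHom b c) : MapHom a c where
  base := φ.base ≫ ψ.base
  cell := φ.cell ≫ BasedCategory.whiskerLeft (affProdMap φ.base Y) ψ.cell ≫
    BasedCategory.whiskerRight (affProdMapComp rfl Y).inv c.mor

lemma MapHom.id_app (a : MapObj Y Z) (y : AffProdObj a.base Y) :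
    (MapHom.id a).app y = a.toFun.map (affProdEq (by simp)) := rfl

lemma MapHom.comp_app {a b c : MapObj Y Z} (φ : MapHom a b) (ψ : MapHom b c)
    (y : AffProdObj a.base Y) :
    (φ.comp ψ).app y = φ.app y ≫ ψ.app ⟨y.pt, y.str ≫ φ.base⟩ ≫
      c.toFun.map (affProdEq (by simp)) := rfl

lemma MapHom.naturality {a b : MapObj Y Z} (φ : MapHom a b) {y z : AffProdObj a.base Y}
    (f : y ⟶ z) : a.toFun.map f ≫ φ.app z =
      φ.app y ≫ b.toFun.map { hom := f.hom, w := AffProdHom.w_assoc f _ } :=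
  φ.cell.naturality f

lemma MapHom.naturality_assoc {a b : MapObj Y Z} (φ : MapHom a b) {y z : AffProdObj a.base Y}
    (f : y ⟶ z) {t : Z.obj} (h : b.toFun.obj ⟨z.pt, z.str ≫ φ.base⟩ ⟶ t) :
    a.toFun.map f ≫ φ.app z ≫ h =
      φ.app y ≫ b.toFun.map { hom := f.hom, w := AffProdHom.w_assoc f _ } ≫ h := by
  rw [← Category.assoc, MapHom.naturality, Category.assoc]

lemma map_eq_id {C D : Type*} [Category C] [Category D] (F : C ⥤ D) {x : C} {f : x ⟶ x}
    (h : f = 𝟙 x) : F.map f = 𝟙 _ := by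
  rw [h, F.map_id]

instance : Category (MapObj Y Z) where
  Hom := MapHom
  id := MapHom.id
  comp := MapHom.comp
  id_comp {a b} φ := by
    refine MapHom.ext' (Category.id_comp _) fun y => ?_
    rw [MapHom.comp_app, MapHom.id_app, Category.assoc, Category.assoc,
      ← Functor.map_comp, MapHom.naturality_assoc, ← Functor.map_comp]
    exact (congrArg _ (map_eq_id _ (AffProdObj.hom_ext (by simp)))).trans
      (Category.comp_id _)
  comp_id {a b} φ := by
    refine MapHom.ext' (Category.comp_id _) fun y => ?_
    rw [MapHom.comp_app, MapHom.id_app, Category.assoc, Category.assoc, ← Functor.map_comp, ← Functor.map_comp]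
    exact (congrArg _ (map_eq_id _ (AffProdObj.hom_ext (by simp)))).trans
      (Category.comp_id _)
  assoc φ ψ χ := by
    refine MapHom.ext' (Category.assoc _ _ _) fun y => ?_
    rw [MapHom.comp_app, MapHom.comp_app, MapHom.comp_app, MapHom.comp_app]
    simp only [Category.assoc]
    rw [MapHom.naturality_assoc, ← Functor.map_comp, ← Functor.map_comp, ← Functor.map_comp]
    congr 4
    apply AffProdObj.hom_ext
    simp

/-- The mapping prestack `Map_S(Y, Z)`. -/
abbrev Map (Y : BasedCategory.{v₁, w₁} (AffOver S)) (Z : BasedCategory.{v₂, w₂} (AffOver S)) :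
    BasedCategory (AffOver S) where
  obj := MapObj Y Z
  p := { obj := fun a => a.base, map := fun φ => MapHom.base φ }

lemma MapHom.ext_mk {a b : MapObj Y Z} {f : a.base ⟶ b.base}
    {c d : a.mor ⟶ BasedFunctor.comp (affProdMap f Y) b.mor}
    (h : ∀ y, c.toNatTrans.app y = d.toNatTrans.app y) : MapHom.mk f c = MapHom.mk f d := by
  congr 1
  ext y
  exact h y

lemma MapHom.app_lift {a b : MapObj Y Z} (φ : MapHom a b) (y : AffProdObj a.base Y) :
    Z.p.IsHomLift (𝟙 (Y.p.obj y.pt)) (φ.app y) :=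
  φ.cell.isHomLift' y

/-- The morphism `F ∘ - : Map_S(Y, Z) → Map_S(Y, W)`. -/
def Map.postcomp (Y : BasedCategory.{v₁, w₁} (AffOver S)) {Z : BasedCategory.{v₂, w₂} (AffOver S)}
    {W : BasedCategory.{v₃, w₃} (AffOver S)} (F : BasedFunctor Z W) :
    BasedFunctor (Map Y Z) (Map Y W) where
  obj a := ⟨a.base, BasedFunctor.comp a.mor F⟩
  map φ := ⟨φ.base, BasedCategory.whiskerRight φ.cell F⟩
  map_id _ := rfl
  map_comp _ _ := MapHom.ext_mk fun _ =>
    (F.map_comp _ _).trans (congrArg _ (F.map_comp _ _))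
  w := rfl

lemma Map.lift_comm {a b : (prod (Map Y Z) Y).obj} (φ : a ⟶ b) :
    Y.p.map (ProdHom.snd φ) ≫ eqToHom (b.snd_base.trans b.fst_base.symm) =
      eqToHom (a.snd_base.trans a.fst_base.symm) ≫ (ProdHom.fst φ).base := by
  have h₁ := @IsHomLift.fac' _ _ _ _ (Map Y Z).p _ _ _ _ (ProdHom.base φ) (ProdHom.fst φ) φ.fst_lift
  have h₂ := IsHomLift.fac' Y.p (ProdHom.base φ) (ProdHom.snd φ)
  change (ProdHom.fst φ).base = _ at h₁
  rw [h₁, h₂]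
  simp

/-- The point of `U ×_S Y` defined by an object of `Map_S(Y, Z) ×_S Y`. -/
abbrev Map.evalPt (a : ProdObj (Map Y Z) Y) : AffProdObj a.fst.base Y :=
  ⟨a.snd, eqToHom (a.snd_base.trans a.fst_base.symm)⟩

/-- The morphism of `U ×_S Y` defined by a morphism of `Map_S(Y, Z) ×_S Y`. -/
abbrev Map.evalHom {a b : ProdObj (Map Y Z) Y} (φ : a ⟶ b) :
    (⟨a.snd, eqToHom (a.snd_base.trans a.fst_base.symm) ≫ (ProdHom.fst φ).base⟩ :
      AffProdObj b.fst.base Y) ⟶ Map.evalPt b :=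
  { hom := ProdHom.snd φ, w := Map.lift_comm φ }

lemma Map.evalHom_lift {a b : ProdObj (Map Y Z) Y} (φ : a ⟶ b) :
    (affProd b.fst.base Y).p.IsHomLift (Y.p.map (ProdHom.snd φ)) (Map.evalHom φ) :=
  IsHomLift.map (affProd b.fst.base Y).p (Map.evalHom φ)

/-- The evaluation morphism `Map_S(Y, Z) ×_S Y → Z`. -/
def Map.eval (Y : BasedCategory.{v₁, w₁} (AffOver S)) (Z : BasedCategory.{v₂, w₂} (AffOver S)) :
    BasedFunctor (prod (Map Y Z) Y) Z :=
  basedOfLift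
    { obj := fun a => (ProdObj.fst a).toFun.obj (Map.evalPt a)
      map := fun {a b} φ => MapHom.app (ProdHom.fst φ) (Map.evalPt a) ≫
        (ProdObj.fst b).toFun.map (Map.evalHom φ)
      map_id := fun a => by
        change MapHom.app (MapHom.id _) _ ≫ _ = _
        rw [MapHom.id_app, ← Functor.map_comp]
        exact map_eq_id _ (AffProdObj.hom_ext (Category.id_comp _))
      map_comp := fun {a b c} φ ψ => by
        change MapHom.app (MapHom.comp _ _) _ ≫ _ = _
        rw [MapHom.comp_app]
        simp only [Category.assoc]
        rw [MapHom.naturality_assoc, ← Functor.map_comp, ← Functor.map_comp]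
        congr 3
        exact AffProdObj.hom_ext (Category.id_comp _) }
    fun {a b} φ => by
      have h₁ := MapHom.app_lift (ProdHom.fst φ) (Map.evalPt a)
      have h₂ := Map.evalHom_lift φ
      have h₃ := b.fst.mor.preserves_isHomLift (Y.p.map (ProdHom.snd φ)) (Map.evalHom φ)
      have h₄ := IsHomLift.comp (p := Z.p) (𝟙 _) (Y.p.map (ProdHom.snd φ))
        (MapHom.app (ProdHom.fst φ) (Map.evalPt a)) (b.fst.mor.map (Map.evalHom φ))
      rw [Category.id_comp] at h₄
      obtain ⟨_, a₁, a₂, ha, rfl⟩ := a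
      obtain ⟨_, b₁, b₂, hb, rfl⟩ := b
      have h₅ := IsHomLift.fac' Y.p (ProdHom.base φ) (ProdHom.snd φ)
      rw [eqToHom_refl, eqToHom_refl, Category.id_comp, Category.comp_id] at h₅
      rw [h₅] at h₄
      exact h₄

/-- The pullback of an object of `Map_S(Y, Z)` over `U` along `g : V ⟶ U`. -/
abbrev MapObj.pull (v : MapObj Y Z) {V : AffOver S} (g : V ⟶ v.base) : MapObj Y Z :=
  ⟨V, BasedFunctor.comp (affProdMap g Y) v.mor⟩

/-- The morphism between pullbacks induced by a morphism of `Map_S(Y, Z)`. -/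
abbrev MapHom.pull {a b : MapObj Y Z} (φ : MapHom a b) {U V : AffOver S} (g : U ⟶ a.base)
    (h : V ⟶ b.base) (k : U ⟶ V) (w : k ≫ h = g ≫ φ.base) : MapHom (a.pull g) (b.pull h) where
  base := k
  cell := BasedCategory.whiskerLeft (affProdMap g Y) φ.cell ≫
    BasedCategory.whiskerRight ((affProdMapComp rfl Y).inv ≫ (affProdMapComp w Y).hom) b.mor

lemma MapHom.pull_app {a b : MapObj Y Z} (φ : MapHom a b) {U V : AffOver S} (g : U ⟶ a.base)
    (h : V ⟶ b.base) (k : U ⟶ V) (w : k ≫ h = g ≫ φ.base) (y : AffProdObj U Y) :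
    (φ.pull g h k w).app y = φ.app ⟨y.pt, y.str ≫ g⟩ ≫
      b.toFun.map (affProdEq (by rw [Category.assoc, Category.assoc, w])) := by
  refine congrArg (φ.app ⟨y.pt, y.str ≫ g⟩ ≫ ·) ?_
  exact congrArg b.toFun.map (AffProdObj.hom_ext (Category.id_comp _))

lemma MapHom.pull_id (a : MapObj Y Z) {U : AffOver S} (g : U ⟶ a.base) (k : U ⟶ U)
    (hk : k = 𝟙 U) (w : k ≫ g = g ≫ 𝟙 _) :
    (MapHom.id a).pull g g k w = MapHom.id (a.pull g) := by
  have e (y : AffProdObj U Y) : y.str ≫ g = (y.str ≫ k) ≫ g := by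
    rw [Category.assoc, hk, Category.id_comp]
  refine MapHom.ext' hk fun y => ?_
  rw [MapHom.pull_app, MapHom.id_app, MapHom.id_app]
  exact (congrArg (· ≫ _) (affProd_map_comp a.toFun _ _
    (affProdEq (e y)) (Category.comp_id _))).trans
    (affProd_map_comp a.toFun _ _ _ (Category.comp_id _))

lemma MapHom.pull_comp_aux {b c : MapObj Y Z} (ψ : MapHom b c) {t : Z.obj}
    {y y' : AffProdObj b.base Y} (p : t ⟶ b.toFun.obj y) (e : y ⟶ y')
    {z z₁ z₂ z₃ : AffProdObj c.base Y} (e₁ : (⟨y.pt, y.str ≫ ψ.base⟩ : AffProdObj c.base Y) ⟶ z₁)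
    (e₂ : z₁ ⟶ z₂) (e₃ : z₂ ⟶ z)
    (d₁ : (⟨y'.pt, y'.str ≫ ψ.base⟩ : AffProdObj c.base Y) ⟶ z₃) (d₂ : z₃ ⟶ z)
    (H : e₁.hom ≫ e₂.hom ≫ e₃.hom = e.hom ≫ d₁.hom ≫ d₂.hom) :
    ((p ≫ ψ.app y ≫ c.toFun.map e₁) ≫ c.toFun.map e₂) ≫ c.toFun.map e₃ =
      (p ≫ b.toFun.map e) ≫ (ψ.app y' ≫ c.toFun.map d₁) ≫ c.toFun.map d₂ := by
  simp only [Category.assoc, ← Functor.map_comp]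
  rw [MapHom.naturality_assoc, ← Functor.map_comp]
  exact congrArg (p ≫ ψ.app y ≫ c.toFun.map ·) (AffProdObj.hom_ext H)

lemma MapHom.pull_comp {a b c : MapObj Y Z} (φ : MapHom a b) (ψ : MapHom b c) {U V W : AffOver S}
    (g : U ⟶ a.base) (h : V ⟶ b.base) (i : W ⟶ c.base) (k : U ⟶ V) (l : V ⟶ W)
    (w : k ≫ h = g ≫ φ.base) (w' : l ≫ i = h ≫ ψ.base) (χ : MapHom a c) (hχ : φ.comp ψ = χ)
    (m : U ⟶ W) (hm : k ≫ l = m) (w'' : m ≫ i = g ≫ χ.base) :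
    χ.pull g i m w'' = (φ.pull g h k w).comp (ψ.pull h i l w') := by
  subst hχ hm
  refine MapHom.ext' rfl fun y => ?_
  rw [MapHom.pull_app, MapHom.comp_app, MapHom.comp_app, MapHom.pull_app, MapHom.pull_app]
  exact MapHom.pull_comp_aux ψ (φ.app _) _ _ _ _ _ _ (by simp)

lemma Map.prodId_comm {v : MapObj Y Z} {U : AffOver S} (h : v.base = U) {y z : AffProdObj U Y}
    (φ : y ⟶ z) : Y.p.map φ.hom ≫ z.str ≫ eqToHom h.symm = (y.str ≫ eqToHom h.symm) ≫ 𝟙 v.base := by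
  rw [Category.comp_id, AffProdHom.w_assoc]

/-- The morphism `v × id : U ×_S Y → Map_S(Y, Z) ×_S Y`, for a point `v` of `Map_S(Y, Z)` over
`U`. -/
def Map.prodId (v : MapObj Y Z) {U : AffOver S} (h : v.base = U) :
    BasedFunctor (affProd U Y) (prod (Map Y Z) Y) where
  obj y := ⟨Y.p.obj y.pt, v.pull (y.str ≫ eqToHom h.symm), y.pt, rfl, rfl⟩
  map {y z} φ :=
   { base := Y.p.map φ.hom
     fst := MapHom.pull (MapHom.id v) (y.str ≫ eqToHom h.symm) (z.str ≫ eqToHom h.symm)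
        (Y.p.map φ.hom) (Map.prodId_comm h φ)
     snd := φ.hom
     fst_lift := IsHomLift.map (Map Y Z).p (MapHom.pull (MapHom.id v) _ _ _ _)
     snd_lift := inferInstance }
  map_id _ := ProdHom.ext (Y.p.map_id _) (MapHom.pull_id _ _ _ (Y.p.map_id _) _) rfl
  map_comp _ _ := ProdHom.ext (Y.p.map_comp _ _) (MapHom.pull_comp _ _ _ _ _ _ _ _ _ _
    (Category.id_comp (obj := MapObj Y Z) (X := v) (Y := v) _) _ (Y.p.map_comp _ _).symm _) rfl
  w := rfl

lemma MapHom.pull_congr {a b : MapObj Y Z} (φ : MapHom a b) {U V : AffOver S} {g : U ⟶ a.base}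
    {h : V ⟶ b.base} {k k' : U ⟶ V} (hk : k = k') (w : k ≫ h = g ≫ φ.base)
    (w' : k' ≫ h = g ≫ φ.base) : φ.pull g h k w = φ.pull g h k' w' := by
  subst hk
  rfl

lemma eq_id_comp_id_comp {C : Type*} [Category C] {x : C} {k : x ⟶ x} (hk : k = 𝟙 x) :
    𝟙 x = 𝟙 x ≫ 𝟙 x ≫ k := by
  rw [hk, Category.id_comp, Category.id_comp]

lemma MapHom.pull_comp₃ {a b c : MapObj Y Z} (φ : MapHom a b) (ψ : MapHom b c) {U : AffOver S}
    (g : U ⟶ a.base) (h : U ⟶ b.base) (i j : U ⟶ c.base) (k : U ⟶ U) (hk : k = 𝟙 U)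
    (w₁ : 𝟙 U ≫ j = g ≫ (φ.comp ψ).base) (w₂ : 𝟙 U ≫ h = g ≫ φ.base)
    (w₃ : 𝟙 U ≫ i = h ≫ ψ.base) (w₄ : k ≫ j = i ≫ 𝟙 c.base) :
    (φ.comp ψ).pull g j (𝟙 U) w₁ =
      (φ.pull g h (𝟙 U) w₂).comp ((ψ.pull h i (𝟙 U) w₃).comp ((MapHom.id c).pull i j k w₄)) := by
  have w₅ : k ≫ j = h ≫ ψ.base := by
    rw [w₄, Category.comp_id, ← w₃, Category.id_comp]
  rw [← MapHom.pull_comp ψ (MapHom.id c) h i j (𝟙 U) k w₃ w₄ ψ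
    (Category.comp_id (obj := MapObj Y Z) ψ) k (Category.id_comp k) w₅]
  exact MapHom.pull_comp φ ψ g h j (𝟙 U) k w₂ w₅ _ rfl _ ((Category.id_comp k).trans hk) w₁

lemma Map.prodIdCell_comm {v w : MapObj Y Z} {φ : v.base ⟶ w.base} {U U' : AffOver S}
    (hv : v.base = U) (hw : w.base = U') (f : U ⟶ U')
    (hf : eqToHom hv.symm ≫ φ = f ≫ eqToHom hw.symm) (y : AffProdObj U Y) :
    𝟙 (Y.p.obj y.pt) ≫ (y.str ≫ f) ≫ eqToHom hw.symm = (y.str ≫ eqToHom hv.symm) ≫ φ := by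
  rw [Category.id_comp, Category.assoc, Category.assoc, hf]

/-- The components of the `2`-morphism `v × id ⟶ (w × id) ∘ (f × id)` induced by a morphism
`v ⟶ w` of `Map_S(Y, Z)` over `f`. -/
abbrev Map.prodIdCellApp {v w : MapObj Y Z} (φ : MapHom v w) {U U' : AffOver S} (hv : v.base = U)
    (hw : w.base = U') (f : U ⟶ U') (hf : eqToHom hv.symm ≫ φ.base = f ≫ eqToHom hw.symm)
    (y : AffProdObj U Y) :
    (Map.prodId v hv).obj y ⟶ (Map.prodId w hw).obj ((affProdMap f Y).obj y) :=
  { base := 𝟙 (Y.p.obj y.pt)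
    fst := φ.pull (y.str ≫ eqToHom hv.symm) ((y.str ≫ f) ≫ eqToHom hw.symm) (𝟙 _)
      (Map.prodIdCell_comm hv hw f hf y)
    snd := 𝟙 y.pt
    fst_lift := IsHomLift.map (Map Y Z).p (φ.pull _ _ _ _)
    snd_lift := IsHomLift.id rfl }

lemma Map.prodIdCellApp_comp {v₀ v₁ v₂ : MapObj Y Z} (φ : MapHom v₀ v₁) (ψ : MapHom v₁ v₂)
    {U₀ U₁ U₂ : AffOver S} (h₀ : v₀.base = U₀) (h₁ : v₁.base = U₁) (h₂ : v₂.base = U₂)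
    (f : U₀ ⟶ U₁) (g : U₁ ⟶ U₂) (hf : eqToHom h₀.symm ≫ φ.base = f ≫ eqToHom h₁.symm)
    (hg : eqToHom h₁.symm ≫ ψ.base = g ≫ eqToHom h₂.symm)
    (hfg : eqToHom h₀.symm ≫ (φ.comp ψ).base = (f ≫ g) ≫ eqToHom h₂.symm) (y : AffProdObj U₀ Y) :
    Map.prodIdCellApp (φ.comp ψ) h₀ h₂ (f ≫ g) hfg y =
      Map.prodIdCellApp φ h₀ h₁ f hf y ≫
        Map.prodIdCellApp ψ h₁ h₂ g hg ((affProdMap f Y).obj y) ≫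
        (Map.prodId v₂ h₂).map (affProdEq (Category.assoc y.str f g)) := by
  subst h₀ h₁ h₂
  exact ProdHom.ext (eq_id_comp_id_comp (Y.p.map_id _))
      (MapHom.pull_comp₃ φ ψ _ _ _ _ _ (Y.p.map_id y.pt) _ _ _ _)
      (eq_id_comp_id_comp rfl)

/-- The `2`-morphism `v × id ⟶ (w × id) ∘ (f × id)` induced by a morphism `v ⟶ w` of
`Map_S(Y, Z)` over `f`. -/
def Map.prodIdCell {v w : MapObj Y Z} (φ : MapHom v w) {U U' : AffOver S} (hv : v.base = U)
    (hw : w.base = U') (f : U ⟶ U') (hf : eqToHom hv.symm ≫ φ.base = f ≫ eqToHom hw.symm) :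
    Map.prodId v hv ⟶ BasedFunctor.comp (affProdMap f Y) (Map.prodId w hw) where
  app := Map.prodIdCellApp φ hv hw f hf
  naturality y z χ := by
    refine ProdHom.ext ((Category.comp_id _).trans (Category.id_comp _).symm) ?_
      ((Category.comp_id _).trans (Category.id_comp _).symm)
    exact (MapHom.pull_comp _ _ _ _ _ _ _ _ _ φ (Category.id_comp (obj := MapObj Y Z) φ)
      (Y.p.map χ.hom) (Category.comp_id _) (by
        rw [Category.assoc, Category.assoc, hf, AffProdHom.w_assoc])).symm.trans
      (MapHom.pull_comp _ _ _ _ _ _ _ _ _ φ (Category.comp_id (obj := MapObj Y Z) φ) _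
      (Category.id_comp _) _)
  isHomLift' y := IsHomLift.map (prod (Map Y Z) Y).p (Map.prodIdCellApp φ hv hw f hf y)

/-- The `2`-morphism `(F, G) ⟶ (F', G')` induced by `2`-morphisms `F ⟶ F'` and `G ⟶ G'`. -/
def prod.liftMap {W : BasedCategory.{v₃, w₃} (AffOver S)} {F F' : BasedFunctor W Y}
    {G G' : BasedFunctor W Z} (α : F ⟶ F') (β : G ⟶ G') : prod.lift F G ⟶ prod.lift F' G' where
  app x :=
    { base := 𝟙 (W.p.obj x)
      fst := α.app x
      snd := β.app x
      fst_lift := α.isHomLift' x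
      snd_lift := β.isHomLift' x }
  naturality _ _ f := ProdHom.ext ((Category.comp_id _).trans (Category.id_comp _).symm)
    (α.naturality f) (β.naturality f)
  isHomLift' x := IsHomLift.map (prod Y Z).p (a := (prod.lift F G).obj x)
    (b := (prod.lift F' G').obj x) (ProdHom.mk _ _ _ _ _)

lemma Map.base_comm {v w : MapObj Y Z} {U U' : AffOver S} (hv : v.base = U) (hw : w.base = U')
    (f : U ⟶ U') (φ : v ⟶ w) (h : (Map Y Z).p.IsHomLift f φ) :
    eqToHom hv.symm ≫ MapHom.base φ = f ≫ eqToHom hw.symm := by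
  have h₁ := IsHomLift.fac' (Map Y Z).p f φ
  change MapHom.base φ = _ at h₁
  rw [h₁]
  simp

/-- The morphism `Map_S(Y, Z) ×_S Map_S(Y, Z) → Map_S(Y, B ×_S B)`, where `B` is
`Map_S(Y, Z) ×_S Y`, which maps a point `(v, w)` over `U` to the morphism
`(v × id, w × id) : U ×_S Y → B ×_S B`. -/
def Map.prodIdPair (Y : BasedCategory.{v₁, w₁} (AffOver S))
    (Z : BasedCategory.{v₂, w₂} (AffOver S)) :
    BasedFunctor (prod (Map Y Z) (Map Y Z))
      (Map Y (prod (prod (Map Y Z) Y) (prod (Map Y Z) Y))) where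
  obj a := ⟨a.base, prod.lift (Map.prodId a.fst a.fst_base) (Map.prodId a.snd a.snd_base)⟩
  map {a b} φ :=
    { base := ProdHom.base φ
      cell := prod.liftMap
        (Map.prodIdCell (ProdHom.fst φ) a.fst_base b.fst_base (ProdHom.base φ)
          (Map.base_comm a.fst_base b.fst_base _ _ φ.fst_lift))
        (Map.prodIdCell (ProdHom.snd φ) a.snd_base b.snd_base (ProdHom.base φ)
          (Map.base_comm a.snd_base b.snd_base _ _ φ.snd_lift)) }
  map_id _ := MapHom.ext_mk fun _ => ProdHom.ext (Y.p.map_id _).symm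
    (ProdHom.ext (Y.p.map_id _).symm (MapHom.pull_congr _ (Y.p.map_id _).symm _ _) rfl)
    (ProdHom.ext (Y.p.map_id _).symm (MapHom.pull_congr _ (Y.p.map_id _).symm _ _) rfl)
  map_comp {a b c} φ ψ := MapHom.ext_mk fun y => ProdHom.ext (eq_id_comp_id_comp (Y.p.map_id _))
    (Map.prodIdCellApp_comp (ProdHom.fst φ) (ProdHom.fst ψ) a.fst_base b.fst_base c.fst_base
      (ProdHom.base φ) (ProdHom.base ψ) (Map.base_comm a.fst_base b.fst_base _ _ φ.fst_lift)
      (Map.base_comm b.fst_base c.fst_base _ _ ψ.fst_lift)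
      (Map.base_comm a.fst_base c.fst_base _ _ (φ ≫ ψ).fst_lift) y)
    (Map.prodIdCellApp_comp (ProdHom.snd φ) (ProdHom.snd ψ) a.snd_base b.snd_base c.snd_base
      (ProdHom.base φ) (ProdHom.base ψ) (Map.base_comm a.snd_base b.snd_base _ _ φ.snd_lift)
      (Map.base_comm b.snd_base c.snd_base _ _ ψ.snd_lift)
      (Map.base_comm a.snd_base c.snd_base _ _ (φ ≫ ψ).snd_lift) y)
  w := rfl
end

/-! ### Modules over the structure sheaf -/

section

/-- The ring of global functions on an affine scheme over `S`. -/
def Fn (U : AffOver S) : Type u := (AffOver.Γ S).obj (op U)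

instance (U : AffOver S) : CommRing (Fn U) :=
  inferInstanceAs (CommRing ((AffOver.Γ S).obj (op U)))

/-- The pullback of functions along a morphism of affine schemes over `S`. -/
def Fn.map {U V : AffOver S} (f : U ⟶ V) : Fn V →+* Fn U :=
  ((AffOver.Γ S).map f.op).hom

lemma Fn.map_id (U : AffOver S) (r : Fn U) : Fn.map (𝟙 U) r = r := by
  unfold Fn.map
  rw [op_id, CategoryTheory.Functor.map_id]
  rfl

lemma Fn.map_comp {U V W : AffOver S} (f : U ⟶ V) (g : V ⟶ W) (r : Fn W) :
    Fn.map (f ≫ g) r = Fn.map f (Fn.map g r) := by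
  unfold Fn.map
  rw [op_comp, CategoryTheory.Functor.map_comp]
  rfl

/-- The structure sheaf of `X`: the ring `O(x)` is the ring of functions on the affine scheme
`p x`. -/
def O (X : BasedCategory.{v, w} (AffOver S)) (x : X.obj) : Type u := Fn (X.p.obj x)

variable {X : BasedCategory.{v, w} (AffOver S)} {Y : BasedCategory.{v₁, w₁} (AffOver S)}
  {Z : BasedCategory.{v₂, w₂} (AffOver S)}

instance (x : X.obj) : CommRing (O X x) := inferInstanceAs (CommRing (Fn (X.p.obj x)))

/-- The restriction maps of the structure sheaf. -/
def O.res {x y : X.obj} (f : x ⟶ y) : O X y →+* O X x := Fn.map (X.p.map f)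

lemma O.res_id (x : X.obj) (r : O X x) : O.res (𝟙 x) r = r :=
  (congrArg (fun k => Fn.map k r) (X.p.map_id x)).trans (Fn.map_id _ r)

lemma O.res_comp {x y z : X.obj} (f : x ⟶ y) (g : y ⟶ z) (r : O X z) :
    O.res (f ≫ g) r = O.res f (O.res g r) :=
  (congrArg (fun k => Fn.map k r) (X.p.map_comp f g)).trans (Fn.map_comp _ _ r)

/-- The identification of the ring of functions of `X` at `x` with that of `Y` at `F x`. -/
def O.comparison (F : BasedFunctor X Y) (x : X.obj) : O X x →+* O Y (F.obj x) :=
  Fn.map (eqToHom (F.w_obj x))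

lemma O.res_comparison (F : BasedFunctor X Y) {x y : X.obj} (f : x ⟶ y) (r : O X y) :
    O.res (F.map f) (O.comparison F y r) = O.comparison F x (O.res f r) := by
  have h := IsHomLift.fac' Y.p (X.p.map f) (F.map f)
  refine (Fn.map_comp _ _ r).symm.trans ((congrArg (fun k => Fn.map k r) ?_).trans
    (Fn.map_comp _ _ r))
  rw [h, Category.assoc, Category.assoc, eqToHom_trans, eqToHom_refl, Category.comp_id]

lemma O.res_comparison_nat {F G : BasedFunctor X Y} (α : F ⟶ G) (x : X.obj) (r : O X x) :
    O.res (α.app x) (O.comparison G x r) = O.comparison F x r := by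
  have h := IsHomLift.fac' Y.p (𝟙 (X.p.obj x)) (α.app x)
  refine (Fn.map_comp _ _ r).symm.trans (congrArg (fun k => Fn.map k r) ?_)
  rw [h, Category.id_comp, Category.assoc, eqToHom_trans, eqToHom_trans]

lemma O.comparison_comp (F : BasedFunctor X Y) (G : BasedFunctor Y Z) (x : X.obj) (r : O X x) :
    O.comparison (BasedFunctor.comp F G) x r =
      O.comparison G (F.obj x) (O.comparison F x r) :=
  (congrArg (fun k => Fn.map k r) (eqToHom_trans _ _).symm).trans (Fn.map_comp _ _ r)

lemma O.comparison_id (x : X.obj) (r : O X x) : O.comparison (BasedFunctor.id X) x r = r :=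
  Fn.map_id _ r

/-- Coverings of an object `x` of `X` for the étale topology, which `X` inherits from `Aff_{/S}`. -/
def IsCovering {x : X.obj} (R : Sieve x) : Prop :=
  R.functorPushforward (X.p ⋙ AffOver.toScheme S) ∈ Scheme.etaleTopology.{u} _

/-- An `O_X`-module (a presheaf of modules on the category `X`). -/
structure OMod (X : BasedCategory.{v, w} (AffOver S)) where
  obj : X.obj → Type t
  addCommGroup (x : X.obj) : AddCommGroup (obj x)
  module (x : X.obj) : Module (O X x) (obj x)
  res {x y : X.obj} (f : x ⟶ y) : obj y →ₛₗ[O.res f] obj x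
  res_id (x : X.obj) (m : obj x) : res (𝟙 x) m = m
  res_comp {x y z : X.obj} (f : x ⟶ y) (g : y ⟶ z) (m : obj z) : res (f ≫ g) m = res f (res g m)

attribute [instance] OMod.addCommGroup OMod.module

/-- A morphism of `O_X`-modules. -/
@[ext]
structure OMod.Hom (E : OMod.{t₁} X) (F : OMod.{t₂} X) where
  app (x : X.obj) : E.obj x →ₗ[O X x] F.obj x
  naturality {x y : X.obj} (f : x ⟶ y) (m : E.obj y) : app x (E.res f m) = F.res f (app y m)

namespace OMod

lemma Hom.ext' {E : OMod.{t₁} X} {F : OMod.{t₂} X} {φ ψ : Hom E F}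
    (h : ∀ x m, φ.app x m = ψ.app x m) : φ = ψ :=
  Hom.ext (funext fun x => LinearMap.ext (h x))

/-- The identity morphism. -/
def Hom.id (E : OMod.{t₁} X) : Hom E E where
  app _ := LinearMap.id
  naturality _ _ := rfl

/-- The composition of morphisms of `O_X`-modules. -/
def Hom.comp {E : OMod.{t₁} X} {F : OMod.{t₂} X} {G : OMod.{t₃} X} (φ : Hom E F) (ψ : Hom F G) :
    Hom E G where
  app x := (ψ.app x).comp (φ.app x)
  naturality f m := by
    rw [LinearMap.comp_apply, φ.naturality, ψ.naturality, LinearMap.comp_apply]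

instance : Category (OMod.{t} X) where
  Hom := Hom
  id := Hom.id
  comp := Hom.comp

/-- The structure sheaf as a module over itself. -/
def unit (X : BasedCategory.{v, w} (AffOver S)) : OMod.{u} X where
  obj x := O X x
  addCommGroup _ := inferInstance
  module _ := inferInstance
  res f := { toFun := O.res f, map_add' := map_add _, map_smul' := map_mul _ }
  res_id := O.res_id
  res_comp := O.res_comp

/-- The pullback of an `O_Y`-module along a morphism `F : X → Y` of prestacks over `S`. -/
def pullback (F : BasedFunctor X Y) (E : OMod.{t} Y) : OMod.{t} X where
  obj x := E.obj (F.obj x)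
  addCommGroup x := E.addCommGroup (F.obj x)
  module x := Module.compHom (E.obj (F.obj x)) (O.comparison F x)
  res {x y} f :=
    letI := Module.compHom (E.obj (F.obj x)) (O.comparison F x)
    letI := Module.compHom (E.obj (F.obj y)) (O.comparison F y)
    { toFun := E.res (F.map f)
      map_add' := map_add _
      map_smul' := fun r m => ((E.res (F.map f)).map_smulₛₗ (O.comparison F y r) m).trans
        (congrArg (fun s : O Y (F.obj x) => s • E.res (F.map f) m) (O.res_comparison F f r)) }
  res_id x m := (congrArg (fun k => E.res k m) (F.map_id x)).trans (E.res_id _ m)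
  res_comp f g m := (congrArg (fun k => E.res k m) (F.map_comp f g)).trans (E.res_comp _ _ m)

/-- The pullback of a morphism of modules. -/
def pullbackMap (F : BasedFunctor X Y) {E : OMod.{t₁} Y} {E' : OMod.{t₂} Y} (φ : Hom E E') :
    Hom (pullback F E) (pullback F E') where
  app x :=
    { toFun := φ.app (F.obj x)
      map_add' := map_add _
      map_smul' := fun r m => (φ.app (F.obj x)).map_smul (O.comparison F x r) m }
  naturality f m := φ.naturality (F.map f) m

/-- The morphism `G^* E ⟶ F^* E` induced by a `2`-morphism `F ⟶ G`. -/
def pullbackNat {F G : BasedFunctor X Y} (α : F ⟶ G) (E : OMod.{t} Y) :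
    Hom (pullback G E) (pullback F E) where
  app x :=
    { toFun := E.res (α.app x)
      map_add' := map_add _
      map_smul' := fun r m => ((E.res (α.app x)).map_smulₛₗ (O.comparison G x r) m).trans
        (congrArg (fun s : O Y (F.obj x) => s • E.res (α.app x) m) (O.res_comparison_nat α x r)) }
  naturality {x y} f m := (E.res_comp (α.app x) (G.map f) m).symm.trans
    ((congrArg (fun k => E.res k m) (α.naturality f).symm).trans
      (E.res_comp (F.map f) (α.app y) m))

/-- The isomorphism `G^* E ≅ F^* E` induced by an invertible `2`-morphism `F ≅ G`. -/
def pullbackNatIso {F G : BasedFunctor X Y} (α : F ≅ G) (E : OMod.{t} Y) :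
    pullback G E ≅ pullback F E where
  hom := pullbackNat α.hom E
  inv := pullbackNat α.inv E
  hom_inv_id := Hom.ext' fun x m => (E.res_comp (α.inv.app x) (α.hom.app x) m).symm.trans
    ((congrArg (fun k => E.res k m) (congrArg (fun β => β.toNatTrans.app x) α.inv_hom_id)).trans
      (E.res_id _ m))
  inv_hom_id := Hom.ext' fun x m => (E.res_comp (α.hom.app x) (α.inv.app x) m).symm.trans
    ((congrArg (fun k => E.res k m) (congrArg (fun β => β.toNatTrans.app x) α.hom_inv_id)).trans
      (E.res_id _ m))

/-- The isomorphism `(F ≫ G)^* E ≅ F^* (G^* E)`. -/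
def pullbackComp (F : BasedFunctor X Y) (G : BasedFunctor Y Z) (E : OMod.{t} Z) :
    pullback (BasedFunctor.comp F G) E ≅ pullback F (pullback G E) where
  hom :=
    { app := fun x =>
        { toFun := fun m => m
          map_add' := fun _ _ => rfl
          map_smul' := fun r m => congrArg (fun s : O Z (G.obj (F.obj x)) =>
            s • (show E.obj (G.obj (F.obj x)) from m)) (O.comparison_comp F G x r) }
      naturality := fun _ _ => rfl }
  inv :=
    { app := fun x =>
        { toFun := fun m => m
          map_add' := fun _ _ => rfl
          map_smul' := fun r m => congrArg (fun s : O Z (G.obj (F.obj x)) =>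
            s • (show E.obj (G.obj (F.obj x)) from m)) (O.comparison_comp F G x r).symm }
      naturality := fun _ _ => rfl }
  hom_inv_id := rfl
  inv_hom_id := rfl

/-- The isomorphism `id^* E ≅ E`. -/
def pullbackId (E : OMod.{t} X) : pullback (BasedFunctor.id X) E ≅ E where
  hom :=
    { app := fun x =>
        { toFun := fun m => m
          map_add' := fun _ _ => rfl
          map_smul' := fun r m => congrArg (fun s : O X x => s • (show E.obj x from m))
            (O.comparison_id x r) }
      naturality := fun _ _ => rfl }
  inv :=
    { app := fun x =>
        { toFun := fun m => m
          map_add' := fun _ _ => rfl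
          map_smul' := fun r m => congrArg (fun s : O X x => s • (show E.obj x from m))
            (O.comparison_id x r).symm }
      naturality := fun _ _ => rfl }
  hom_inv_id := rfl
  inv_hom_id := rfl

/-- The pullback of an isomorphism of modules. -/
def pullbackIso (F : BasedFunctor X Y) {E E' : OMod.{t} Y} (a : E ≅ E') :
    pullback F E ≅ pullback F E' where
  hom := pullbackMap F a.hom
  inv := pullbackMap F a.inv
  hom_inv_id := Hom.ext' fun x m =>
    congrArg (fun φ : Hom E E => φ.app (F.obj x) m) a.hom_inv_id
  inv_hom_id := Hom.ext' fun x m =>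
    congrArg (fun φ : Hom E' E' => φ.app (F.obj x) m) a.inv_hom_id

/-! ### Vector bundles -/

/-- Vector bundles on `X`: the finite locally free sheaves of modules.  The sections `e i` in
`locallyFree` amount to an isomorphism of the restrictions to `y` of `O ^ n` and `E`. -/
structure IsVect (E : OMod.{t} X) : Prop where
  isSheaf {x : X.obj} (R : Sieve x) (hR : IsCovering R)
    (s : ∀ ⦃y : X.obj⦄ (f : y ⟶ x), R f → E.obj y)
    (hs : ∀ ⦃y z : X.obj⦄ (f : y ⟶ x) (hf : R f) (g : z ⟶ y),
      E.res g (s f hf) = s (g ≫ f) (R.downward_closed hf g)) :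
    ∃! m : E.obj x, ∀ ⦃y : X.obj⦄ (f : y ⟶ x) (hf : R f), E.res f m = s f hf
  locallyFree (x : X.obj) : ∃ R : Sieve x, IsCovering R ∧ ∀ ⦃y : X.obj⦄ (f : y ⟶ x), R f →
    ∃ (n : ℕ) (e : Fin n → E.obj y), ∀ ⦃z : X.obj⦄ (g : z ⟶ y),
      LinearIndependent (O X z) (fun i => E.res g (e i)) ∧
        Submodule.span (O X z) (Set.range fun i => E.res g (e i)) = ⊤

/-! ### The internal Hom -/

instance (E : OMod.{t₁} X) (F : OMod.{t₂} X) : Zero (Hom E F) where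
  zero := { app := fun _ => 0, naturality := fun f _ => ((F.res f).map_zero).symm }

instance (E : OMod.{t₁} X) (F : OMod.{t₂} X) : Add (Hom E F) where
  add φ ψ :=
    { app := fun x => φ.app x + ψ.app x
      naturality := fun f m => by
        rw [LinearMap.add_apply, LinearMap.add_apply, φ.naturality, ψ.naturality, map_add] }

instance (E : OMod.{t₁} X) (F : OMod.{t₂} X) : Neg (Hom E F) where
  neg φ :=
    { app := fun x => -φ.app x
      naturality := fun f m => by
        rw [LinearMap.neg_apply, LinearMap.neg_apply, φ.naturality, map_neg] }

instance (E : OMod.{t₁} X) (F : OMod.{t₂} X) : AddCommGroup (Hom E F) where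
  add_assoc _ _ _ := Hom.ext' fun _ _ => add_assoc _ _ _
  zero_add _ := Hom.ext' fun _ _ => zero_add _
  add_zero _ := Hom.ext' fun _ _ => add_zero _
  add_comm _ _ := Hom.ext' fun _ _ => add_comm _ _
  neg_add_cancel _ := Hom.ext' fun _ _ => neg_add_cancel _
  nsmul := nsmulRec
  zsmul := zsmulRec

end OMod

/-- The prestack `X_{/x}`. -/
abbrev slice (X : BasedCategory.{v, w} (AffOver S)) (x : X.obj) :
    BasedCategory.{v, max v w} (AffOver S) where
  obj := Over x
  p := Over.forget x ⋙ X.p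

/-- The projection `X_{/x} → X`. -/
abbrev slice.forget (X : BasedCategory.{v, w} (AffOver S)) (x : X.obj) :
    BasedFunctor (slice X x) X where
  toFunctor := Over.forget x

/-- The restriction of functions from `x` to `X_{/x}`. -/
def O.toSlice {x : X.obj} (y : Over x) : O X x →+* O (slice X x) y :=
  O.res y.hom

lemma O.res_toSlice {x : X.obj} {y z : Over x} (f : y ⟶ z) (r : O X x) :
    O.res (X := slice X x) f (O.toSlice z r) = O.toSlice y r :=
  (O.res_comp f.left z.hom r).symm.trans (congrArg (fun k => O.res k r) (Over.w f))

namespace OMod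

/-- The restriction `E|_x` of `E` to `X_{/x}`. -/
abbrev restrict (E : OMod.{t} X) (x : X.obj) : OMod.{t} (slice X x) :=
  pullback (slice.forget X x) E

/-- A function on `x` acts on `Hom(E|_x, F|_x)` through its restrictions. -/
instance (x : X.obj) (E : OMod.{t₁} (slice X x)) (F : OMod.{t₂} (slice X x)) :
    SMul (O X x) (Hom E F) where
  smul r φ :=
    { app := fun y => O.toSlice y r • φ.app y
      naturality := fun {y z} f m => by
        rw [LinearMap.smul_apply, LinearMap.smul_apply, φ.naturality, LinearMap.map_smulₛₗ,
          O.res_toSlice] }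

lemma smul_app {x : X.obj} {E : OMod.{t₁} (slice X x)} {F : OMod.{t₂} (slice X x)} (r : O X x)
    (φ : Hom E F) (y : Over x) (m : E.obj y) : (r • φ).app y m = O.toSlice y r • φ.app y m := rfl

instance (x : X.obj) (E : OMod.{t₁} (slice X x)) (F : OMod.{t₂} (slice X x)) :
    Module (O X x) (Hom E F) where
  one_smul φ := Hom.ext' fun y m => by rw [smul_app, map_one, one_smul]
  mul_smul r s φ := Hom.ext' fun y m => by
    rw [smul_app, map_mul, mul_smul, smul_app, smul_app]
  smul_zero r := Hom.ext' fun y m => smul_zero (O.toSlice y r)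
  smul_add r φ ψ := Hom.ext' fun y m => smul_add (O.toSlice y r) _ _
  add_smul r s φ := Hom.ext' fun y m => by
    rw [smul_app, map_add, add_smul]
    rfl
  zero_smul φ := Hom.ext' fun y m => by
    rw [smul_app, map_zero, zero_smul]
    rfl

/-- The restriction of morphisms from `X_{/x'}` to `X_{/x}` along `f : x ⟶ x'`. -/
def Hom.restrict {E : OMod.{t₁} X} {F : OMod.{t₂} X} {x x' : X.obj} (f : x ⟶ x')
    (φ : Hom (E.restrict x') (F.restrict x')) : Hom (E.restrict x) (F.restrict x) where
  app y := φ.app ((Over.map f).obj y)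
  naturality g m := φ.naturality ((Over.map f).map g) m

lemma Hom.app_congr {E : OMod.{t₁} X} {F : OMod.{t₂} X} {x : X.obj}
    (φ : Hom (E.restrict x) (F.restrict x)) {y : X.obj} {f g : y ⟶ x} (h : f = g) (m : E.obj y) :
    (show F.obj y from φ.app (Over.mk f) m) = φ.app (Over.mk g) m := by
  subst h
  rfl

/-- The internal Hom: `[E, F](x)` is the module of morphisms `E|_x ⟶ F|_x`. -/
def ihom (E : OMod.{t₁} X) (F : OMod.{t₂} X) : OMod.{max v w t₁ t₂} X where
  obj x := Hom (E.restrict x) (F.restrict x)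
  addCommGroup _ := inferInstance
  module _ := inferInstance
  res {_ x'} f :=
    { toFun := Hom.restrict f
      map_add' := fun _ _ => rfl
      map_smul' := fun r φ => Hom.ext' fun y m => congrArg
        (fun s : O (slice X x') ((Over.map f).obj y) => s • φ.app ((Over.map f).obj y) m)
        (O.res_comp y.hom f r) }
  res_id _ φ := Hom.ext' fun y m => φ.app_congr (Category.comp_id y.hom) m
  res_comp f g φ := Hom.ext' fun y m => φ.app_congr (Category.assoc y.hom f g).symm m

/-- The dual module `[E, O]`. -/
def dual (E : OMod.{t} X) : OMod.{max u v w t} X := ihom E (unit X)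

end OMod
end

/-! ### Algebras over the structure sheaf, relative spectra -/

section

variable {X : BasedCategory.{v, w} (AffOver S)} {Y : BasedCategory.{v₁, w₁} (AffOver S)}

/-- A (presheaf of) commutative `O_X`-algebra(s). -/
structure OAlg (X : BasedCategory.{v, w} (AffOver S)) where
  obj : X.obj → Type t
  commRing (x : X.obj) : CommRing (obj x)
  algebra (x : X.obj) : Algebra (O X x) (obj x)
  res {x y : X.obj} (f : x ⟶ y) : obj y →+* obj x
  res_algebraMap {x y : X.obj} (f : x ⟶ y) (r : O X y) :
    res f (algebraMap (O X y) (obj y) r) = algebraMap (O X x) (obj x) (O.res f r)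
  res_id (x : X.obj) (a : obj x) : res (𝟙 x) a = a
  res_comp {x y z : X.obj} (f : x ⟶ y) (g : y ⟶ z) (a : obj z) : res (f ≫ g) a = res f (res g a)

attribute [instance] OAlg.commRing OAlg.algebra

/-- The ring homomorphism of symmetric algebras induced by a semilinear map. -/
def symMap {R : Type t} {R' : Type t₁} [CommRing R] [CommRing R'] {φ : R →+* R'} {M : Type t₂}
    {N : Type t₃} [AddCommGroup M] [AddCommGroup N] [Module R M] [Module R' N] (g : M →ₛₗ[φ] N) :
    SymmetricAlgebra R M →+* SymmetricAlgebra R' N :=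
  letI : Algebra R (SymmetricAlgebra R' N) :=
    ((algebraMap R' (SymmetricAlgebra R' N)).comp φ).toAlgebra
  (SymmetricAlgebra.lift (A := SymmetricAlgebra R' N)
    { toFun := fun m => SymmetricAlgebra.ι R' N (g m)
      map_add' := fun m m' => by rw [map_add, map_add]
      map_smul' := fun r m => by
        rw [LinearMap.map_smulₛₗ, map_smul, RingHom.id_apply, Algebra.smul_def, Algebra.smul_def]
        rfl }).toRingHom

lemma symMap_algebraMap {R : Type t} {R' : Type t₁} [CommRing R] [CommRing R'] {φ : R →+* R'}
    {M : Type t₂} {N : Type t₃} [AddCommGroup M] [AddCommGroup N] [Module R M] [Module R' N]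
    (g : M →ₛₗ[φ] N) (r : R) :
    symMap g (algebraMap R (SymmetricAlgebra R M) r) =
      algebraMap R' (SymmetricAlgebra R' N) (φ r) := by
  let _ : Algebra R (SymmetricAlgebra R' N) :=
    ((algebraMap R' (SymmetricAlgebra R' N)).comp φ).toAlgebra
  exact AlgHom.commutes _ r

lemma symMap_ι {R : Type t} {R' : Type t₁} [CommRing R] [CommRing R'] {φ : R →+* R'}
    {M : Type t₂} {N : Type t₃} [AddCommGroup M] [AddCommGroup N] [Module R M] [Module R' N]
    (g : M →ₛₗ[φ] N) (m : M) :
    symMap g (SymmetricAlgebra.ι R M m) = SymmetricAlgebra.ι R' N (g m) := by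
  let _ : Algebra R (SymmetricAlgebra R' N) :=
    ((algebraMap R' (SymmetricAlgebra R' N)).comp φ).toAlgebra
  exact SymmetricAlgebra.lift_ι_apply _ m

lemma symRingHom_ext {R : Type t} {M : Type t₂} {A : Type t₃} [CommRing R] [AddCommGroup M]
    [Module R M] [CommRing A] {f g : SymmetricAlgebra R M →+* A}
    (h : ∀ r, f (algebraMap R _ r) = g (algebraMap R _ r))
    (h' : ∀ m, f (SymmetricAlgebra.ι R M m) = g (SymmetricAlgebra.ι R M m))
    (a : SymmetricAlgebra R M) : f a = g a := by
  induction a using SymmetricAlgebra.induction with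
  | algebraMap r => exact h r
  | ι m => exact h' m
  | mul _ _ ha hb => rw [map_mul, map_mul, ha, hb]
  | add _ _ ha hb => rw [map_add, map_add, ha, hb]

/-- The symmetric algebra of an `O_X`-module. -/
def Sym (M : OMod.{t} X) : OAlg.{max u t} X where
  obj x := SymmetricAlgebra (O X x) (M.obj x)
  commRing _ := inferInstance
  algebra _ := inferInstance
  res f := symMap (M.res f)
  res_algebraMap f r := symMap_algebraMap (M.res f) r
  res_id x a := symRingHom_ext (f := symMap (M.res (𝟙 x))) (g := RingHom.id _)
    (fun r => by rw [symMap_algebraMap, O.res_id, RingHom.id_apply])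
    (fun m => by rw [symMap_ι, M.res_id, RingHom.id_apply]) a
  res_comp f g a := symRingHom_ext (f := symMap (M.res (f ≫ g)))
    (g := (symMap (M.res f)).comp (symMap (M.res g)))
    (fun r => by
      rw [RingHom.comp_apply, symMap_algebraMap, symMap_algebraMap, symMap_algebraMap, O.res_comp])
    (fun m => by rw [RingHom.comp_apply, symMap_ι, symMap_ι, symMap_ι, M.res_comp]) a

/-- A point of the relative spectrum of `A`: an object `x` of `X` and a morphism of algebras
`A|_x ⟶ O|_x` over `X_{/x}`. -/
structure RelSpecObj (A : OAlg.{t} X) where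
  pt : X.obj
  sec (y : Over pt) : A.obj y.left →ₐ[O X y.left] O X y.left
  naturality {y z : Over pt} (f : y ⟶ z) (a : A.obj z.left) :
    sec y (A.res f.left a) = O.res f.left (sec z a)

/-- A morphism of points of the relative spectrum of `A`: a morphism `x ⟶ x'` along which the
morphism `A|_{x'} ⟶ O|_{x'}` restricts to the morphism `A|_x ⟶ O|_x`. -/
@[ext]
structure RelSpecHom {A : OAlg.{t} X} (a b : RelSpecObj A) where
  hom : a.pt ⟶ b.pt
  sec_map (y : Over a.pt) : b.sec ((Over.map hom).obj y) = a.sec y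

lemma RelSpecObj.sec_congr {A : OAlg.{t} X} (a : RelSpecObj A) {y : X.obj} {f g : y ⟶ a.pt}
    (h : f = g) : a.sec (Over.mk f) = a.sec (Over.mk g) := by
  rw [h]

instance (A : OAlg.{t} X) : Category (RelSpecObj A) where
  Hom := RelSpecHom
  id a := ⟨𝟙 a.pt, fun y => a.sec_congr (Category.comp_id y.hom)⟩
  comp {a b c} φ ψ := ⟨φ.hom ≫ ψ.hom, fun y =>
    (c.sec_congr (Category.assoc y.hom φ.hom ψ.hom).symm).trans
      ((ψ.sec_map ((Over.map φ.hom).obj y)).trans (φ.sec_map y))⟩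
  id_comp φ := RelSpecHom.ext (Category.id_comp φ.hom)
  comp_id φ := RelSpecHom.ext (Category.comp_id φ.hom)
  assoc φ ψ χ := RelSpecHom.ext (Category.assoc φ.hom ψ.hom χ.hom)

/-- The relative spectrum of a commutative `O_X`-algebra `A`, given by its points: the fibre over
an object `x` of `X` is the set of morphisms of algebras `A|_x ⟶ O|_x`. -/
abbrev relSpec (A : OAlg.{t} X) : BasedCategory.{v, max u v w t} (AffOver S) where
  obj := RelSpecObj A
  p :=
    { obj := fun a => X.p.obj (RelSpecObj.pt a)
      map := fun φ => X.p.map (RelSpecHom.hom φ)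
      map_id := fun a => X.p.map_id (RelSpecObj.pt a)
      map_comp := fun φ ψ => X.p.map_comp (RelSpecHom.hom φ) (RelSpecHom.hom ψ) }

/-- The structure morphism of the relative spectrum. -/
def relSpec.proj (A : OAlg.{t} X) : BasedFunctor (relSpec A) X where
  obj := fun a : RelSpecObj A => a.pt
  map := fun φ => RelSpecHom.hom φ
  map_id := fun _ => rfl
  map_comp := fun _ _ => rfl
  w := rfl

/-- The relative spectrum `𝕍 M = Spec (Sym (M^∨))` attached to an `O_X`-module `M`. -/
abbrev totalSpace (M : OMod.{t} X) : BasedCategory (AffOver S) := relSpec (Sym M.dual)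

end

/-! ### Stacks of vector bundles and of arrows of vector bundles -/

section

variable {X : BasedCategory.{v, w} (AffOver S)}

/-- The pullback `f^< E` of a module on `V ×_S X` along `f × id : U ×_S X → V ×_S X`. -/
abbrev basePullback {U V : AffOver S} (f : U ⟶ V) (E : OMod.{t} (affProd V X)) :
    OMod.{t} (affProd U X) :=
  OMod.pullback (affProdMap f X) E

/-- The isomorphism `id^< E ≅ E`. -/
def basePullbackId {U : AffOver S} (E : OMod.{t} (affProd U X)) : basePullback (𝟙 U) E ≅ E :=
  (OMod.pullbackNatIso (affProdMapId U X) E).symm ≪≫ OMod.pullbackId E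

/-- The isomorphism `(f ≫ g)^< E ≅ f^< (g^< E)`. -/
def basePullbackComp {U V W : AffOver S} (f : U ⟶ V) (g : V ⟶ W) (E : OMod.{t} (affProd W X)) :
    basePullback (f ≫ g) E ≅ basePullback f (basePullback g E) :=
  (OMod.pullbackNatIso (affProdMapComp (f := f) (g := g) rfl X) E).symm ≪≫
    OMod.pullbackComp (affProdMap f X) (affProdMap g X) E

/-- An isomorphism `f^< E' ≅ E`. -/
abbrev PullIso {U V : AffOver S} (f : U ⟶ V) (E' : OMod.{t} (affProd V X))
    (E : OMod.{t} (affProd U X)) :=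
  basePullback f E' ≅ E

namespace PullIso

/-- The map on sections. -/
def app {U V : AffOver S} {f : U ⟶ V} {E' : OMod.{t} (affProd V X)} {E : OMod.{t} (affProd U X)}
    (a : PullIso f E' E) (y : AffProdObj U X) (m : E'.obj ⟨y.pt, y.str ≫ f⟩) : E.obj y :=
  OMod.Hom.app a.hom y m

/-- The composition `(f ≫ g)^< E'' ≅ f^< (g^< E'') ≅ f^< E' ≅ E`. -/
def comp {U V W : AffOver S} {f : U ⟶ V} {g : V ⟶ W} {E : OMod.{t} (affProd U X)}
    {E' : OMod.{t} (affProd V X)} {E'' : OMod.{t} (affProd W X)} (a : PullIso f E' E)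
    (b : PullIso g E'' E') : PullIso (f ≫ g) E'' E :=
  basePullbackComp f g E'' ≪≫ OMod.pullbackIso (affProdMap f X) b ≪≫ a

lemma id_app {U : AffOver S} (E : OMod.{t} (affProd U X)) (y : AffProdObj U X)
    (m : E.obj ⟨y.pt, y.str ≫ 𝟙 U⟩) : app (basePullbackId E) y m =
      E.res (affProdEq (Category.comp_id y.str).symm) m := rfl

lemma comp_app {U V W : AffOver S} {f : U ⟶ V} {g : V ⟶ W} {E : OMod.{t} (affProd U X)}
    {E' : OMod.{t} (affProd V X)} {E'' : OMod.{t} (affProd W X)} (a : PullIso f E' E)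
    (b : PullIso g E'' E') (y : AffProdObj U X) (m : E''.obj ⟨y.pt, y.str ≫ f ≫ g⟩) :
    (a.comp b).app y m =
      a.app y (b.app ⟨y.pt, y.str ≫ f⟩ (E''.res (affProdEq (Category.assoc y.str f g)) m)) := rfl

lemma naturality {U V : AffOver S} {f : U ⟶ V} {E' : OMod.{t} (affProd V X)}
    {E : OMod.{t} (affProd U X)} (a : PullIso f E' E) {y z : AffProdObj U X} (k : y ⟶ z)
    (m : E'.obj ⟨z.pt, z.str ≫ f⟩) :
    a.app y (E'.res (x := ⟨y.pt, y.str ≫ f⟩) { hom := k.hom, w := AffProdHom.w_assoc k f } m) =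
      E.res k (a.app z m) :=
  OMod.Hom.naturality a.hom k m

lemma app_smul {U V : AffOver S} {f : U ⟶ V} {E' : OMod.{t} (affProd V X)}
    {E : OMod.{t} (affProd U X)} (a : PullIso f E' E) (y : AffProdObj U X)
    (r : O (affProd V X) ⟨y.pt, y.str ≫ f⟩) (m : E'.obj ⟨y.pt, y.str ≫ f⟩) :
    a.app y (r • m) = (show O (affProd U X) y from r) • a.app y m := by
  refine Eq.trans (congrArg (a.app y) ?_)
    ((OMod.Hom.app a.hom y).map_smul (show O (affProd U X) y from r) m)
  exact congrArg (fun s : O (affProd V X) ⟨y.pt, y.str ≫ f⟩ => s • m) (Fn.map_id _ r).symm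

lemma ext' {U V : AffOver S} {f : U ⟶ V} {E' : OMod.{t} (affProd V X)}
    {E : OMod.{t} (affProd U X)} {a b : PullIso f E' E} (h : ∀ y m, a.app y m = b.app y m) :
    a = b :=
  Iso.ext (OMod.Hom.ext' h)

lemma res_res {U : AffOver S} (E : OMod.{t} (affProd U X)) {x y z : AffProdObj U X} (f : x ⟶ y)
    (g : y ⟶ z) (k : x ⟶ z) (h : f.hom ≫ g.hom = k.hom) (m : E.obj z) :
    E.res f (E.res g m) = E.res k m :=
  (E.res_comp f g m).symm.trans (congrArg (fun l => E.res l m) (AffProdObj.hom_ext h))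

lemma res_self {U : AffOver S} (E : OMod.{t} (affProd U X)) {x : AffProdObj U X} (k : x ⟶ x)
    (h : k.hom = 𝟙 x.pt) (m : E.obj x) : E.res k m = m :=
  (congrArg (fun l => E.res l m) (AffProdObj.hom_ext h)).trans (E.res_id x m)

/-- Equality of isomorphisms `f^< E' ≅ E` and `g^< E' ≅ E` for equal `f` and `g`. -/
def Eqv {U V : AffOver S} {f g : U ⟶ V} {E' : OMod.{t} (affProd V X)} {E : OMod.{t} (affProd U X)}
    (a : PullIso f E' E) (b : PullIso g E' E) : Prop :=
  ∃ h : f = g, ∀ (y : AffProdObj U X) (m : E'.obj ⟨y.pt, y.str ≫ g⟩),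
    a.app y (E'.res (affProdEq (congrArg (y.str ≫ ·) h)) m) = b.app y m

lemma Eqv.heq {U V : AffOver S} {f g : U ⟶ V} {E' : OMod.{t} (affProd V X)}
    {E : OMod.{t} (affProd U X)} {a : PullIso f E' E} {b : PullIso g E' E} (h : Eqv a b) :
    f = g ∧ HEq a b := by
  obtain ⟨rfl, h⟩ := h
  refine ⟨rfl, heq_of_eq (ext' fun y m => ?_)⟩
  rw [← h, res_self _ _ rfl]

lemma id_comp {U V : AffOver S} {f : U ⟶ V} {E' : OMod.{t} (affProd V X)}
    {E : OMod.{t} (affProd U X)} (a : PullIso f E' E) :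
    Eqv (comp (basePullbackId E) a) a := by
  refine ⟨Category.id_comp f, fun y m => ?_⟩
  rw [comp_app, id_app, ← naturality]
  refine congrArg (a.app y) ?_
  rw [res_res _ _ _ (affProdEq (by simp)) (Category.comp_id _)]
  exact (res_res _ _ _ (𝟙 _) (Category.comp_id _) m).trans (res_self _ _ rfl m)

lemma comp_id {U V : AffOver S} {f : U ⟶ V} {E' : OMod.{t} (affProd V X)}
    {E : OMod.{t} (affProd U X)} (a : PullIso f E' E) :
    Eqv (comp a (basePullbackId E')) a := by
  refine ⟨Category.comp_id f, fun y m => ?_⟩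
  rw [comp_app, id_app]
  refine congrArg (a.app y) ?_
  rw [res_res _ _ _ (affProdEq (by simp)) (Category.comp_id _)]
  exact (res_res _ _ _ (𝟙 _) (Category.comp_id _) m).trans (res_self _ _ rfl m)

lemma assoc {U V W T : AffOver S} {f : U ⟶ V} {g : V ⟶ W} {k : W ⟶ T} {E : OMod.{t} (affProd U X)}
    {E' : OMod.{t} (affProd V X)} {E'' : OMod.{t} (affProd W X)} {E''' : OMod.{t} (affProd T X)}
    (a : PullIso f E' E) (b : PullIso g E'' E') (c : PullIso k E''' E'') :
    Eqv ((a.comp b).comp c) (a.comp (b.comp c)) := by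
  refine ⟨Category.assoc f g k, fun y m => ?_⟩
  rw [comp_app, comp_app, comp_app, comp_app, ← naturality]
  refine congrArg (fun l => a.app y (b.app _ (c.app _ l))) ?_
  rw [res_res _ _ _ (affProdEq (by simp)) (Category.comp_id _),
    res_res _ _ _ (affProdEq (by simp)) (Category.comp_id _)]
  exact (res_res _ _ _ _ (Category.comp_id _) m).symm

end PullIso

/-- A vector bundle on `U ×_S X`, for an affine scheme `U` over `S`. -/
structure BunObj (X : BasedCategory.{v, w} (AffOver S)) where
  base : AffOver S
  E : OMod.{u} (affProd base X)
  isVect : E.IsVect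

/-- A morphism `(U, E) ⟶ (U', E')`: a morphism `f : U ⟶ U'` and an isomorphism `f^< E' ≅ E`. -/
structure BunHom (a b : BunObj X) where
  base : a.base ⟶ b.base
  iso : PullIso base b.E a.E

lemma BunHom.ext' {a b : BunObj X} {φ ψ : BunHom a b} (h : φ.iso.Eqv ψ.iso) : φ = ψ := by
  obtain ⟨f, φ⟩ := φ
  obtain ⟨g, ψ⟩ := ψ
  obtain ⟨h₁, h₂⟩ := h.heq
  obtain rfl : f = g := h₁
  exact congrArg (BunHom.mk f) (eq_of_heq h₂)

instance : Category (BunObj X) where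
  Hom := BunHom
  id a := ⟨𝟙 _, basePullbackId a.E⟩
  comp φ ψ := ⟨φ.base ≫ ψ.base, φ.iso.comp ψ.iso⟩
  id_comp φ := BunHom.ext' (PullIso.id_comp φ.iso)
  comp_id φ := BunHom.ext' (PullIso.comp_id φ.iso)
  assoc φ ψ χ := BunHom.ext' (PullIso.assoc φ.iso ψ.iso χ.iso)

/-- The prestack over `S` whose fibre over `U` is the groupoid of vector bundles on `U ×_S X`. -/
abbrev Bun (X : BasedCategory.{v, w} (AffOver S)) :
    BasedCategory.{max u w, max (u + 1) v w} (AffOver S) where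
  obj := BunObj X
  p := { obj := fun a => BunObj.base a, map := fun φ => BunHom.base φ }

/-- The stack of vector bundles over `S`, with fibre `Vect(U ×_S S) = Vect(U)` over `U`: the
disjoint union over all `n` (as a stack) of the classifying stacks of `GL_n`, the component for `n`
consisting of the vector bundles of rank `n`. -/
abbrev BGL (S : Scheme.{u}) : BasedCategory.{u + 1, u + 1} (AffOver S) := Bun (terminal S)

/-- The morphism `(U, f) ⟶ (V, 𝟙)` of `V ×_S S` defined by `f : U ⟶ V`. -/
abbrev univHom {U V : AffOver S} (f : U ⟶ V) :
    (⟨U, 𝟙 U ≫ f⟩ : AffProdObj V (terminal S)) ⟶ ⟨V, 𝟙 V⟩ :=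
  { hom := f, w := (Category.comp_id f).trans (Category.id_comp f).symm }

/-- The restriction maps of the universal vector bundle. -/
def univRes {a b : BunObj (terminal S)} (φ : a ⟶ b) (m : b.E.obj ⟨b.base, 𝟙 b.base⟩) :
    a.E.obj ⟨a.base, 𝟙 a.base⟩ :=
  PullIso.app (BunHom.iso φ) ⟨a.base, 𝟙 a.base⟩ (b.E.res (univHom (BunHom.base φ)) m)

lemma univRes_add {a b : BunObj (terminal S)} (φ : a ⟶ b) (m m' : b.E.obj ⟨b.base, 𝟙 b.base⟩) :
    univRes φ (m + m') = univRes φ m + univRes φ m' := by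
  unfold univRes
  rw [map_add]
  exact map_add (OMod.Hom.app (BunHom.iso φ).hom ⟨a.base, 𝟙 a.base⟩) _ _

lemma univRes_smul {a b : BunObj (terminal S)} (φ : a ⟶ b)
    (r : O (affProd b.base (terminal S)) ⟨b.base, 𝟙 b.base⟩) (m : b.E.obj ⟨b.base, 𝟙 b.base⟩) :
    univRes φ (r • m) =
      (show O (affProd a.base (terminal S)) ⟨a.base, 𝟙 a.base⟩ from Fn.map (BunHom.base φ) r) •
        univRes φ m := by
  unfold univRes
  rw [LinearMap.map_smulₛₗ]
  exact PullIso.app_smul _ _ _ _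

lemma univRes_comp_aux {U V W : AffOver S} (f : U ⟶ V) (g : V ⟶ W)
    (E : OMod.{u} (affProd W (terminal S))) (m : E.obj ⟨W, 𝟙 W⟩) :
    E.res (affProdEq (Category.assoc (𝟙 U) f g)) (E.res (univHom (f ≫ g)) m) =
      E.res (x := ⟨U, (𝟙 U ≫ f) ≫ g⟩) (y := ⟨V, 𝟙 V ≫ g⟩)
        { hom := f, w := AffProdHom.w_assoc (univHom f) g } (E.res (univHom g) m) := by
  have h : f ≫ g ≫ 𝟙 W = (𝟙 U ≫ f) ≫ g := by simp
  let k : (⟨U, (𝟙 U ≫ f) ≫ g⟩ : AffProdObj W (terminal S)) ⟶ ⟨W, 𝟙 W⟩ :=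
    { hom := f ≫ g, w := (Category.assoc f g (𝟙 W)).trans h }
  exact (PullIso.res_res E _ _ k (Category.id_comp (f ≫ g)) m).trans
    (PullIso.res_res E _ _ k rfl m).symm

lemma univRes_comp {a b c : BunObj (terminal S)} (φ : a ⟶ b) (ψ : b ⟶ c)
    (m : c.E.obj ⟨c.base, 𝟙 c.base⟩) : univRes (φ ≫ ψ) m = univRes φ (univRes ψ m) :=
  (congrArg (fun l => PullIso.app (BunHom.iso φ) ⟨a.base, 𝟙 a.base⟩
    (PullIso.app (BunHom.iso ψ) ⟨a.base, 𝟙 a.base ≫ BunHom.base φ⟩ l))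
    (univRes_comp_aux (BunHom.base φ) (BunHom.base ψ) c.E m)).trans
  (congrArg (PullIso.app (BunHom.iso φ) ⟨a.base, 𝟙 a.base⟩)
    (PullIso.naturality (BunHom.iso ψ) (univHom (BunHom.base φ))
      (c.E.res (univHom (BunHom.base ψ)) m)))

/-- The sections over `(U, E)` of the universal vector bundle: the module `Γ(U, E)`. -/
def univObj (S : Scheme.{u}) (a : (BGL S).obj) : Type u :=
  (BunObj.E a).obj ⟨BunObj.base a, 𝟙 (BunObj.base a)⟩

instance (a : (BGL S).obj) : AddCommGroup (univObj S a) :=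
  (BunObj.E a).addCommGroup ⟨BunObj.base a, 𝟙 (BunObj.base a)⟩

instance (a : (BGL S).obj) : Module (O (BGL S) a) (univObj S a) :=
  (BunObj.E a).module ⟨BunObj.base a, 𝟙 (BunObj.base a)⟩

/-- The universal vector bundle on the stack of vector bundles: its module of sections over
`(U, E)` is `Γ(U, E)`. -/
def univBundle (S : Scheme.{u}) : OMod.{u} (BGL S) where
  obj := univObj S
  addCommGroup _ := inferInstance
  module _ := inferInstance
  res φ :=
    { toFun := univRes φ
      map_add' := univRes_add φ
      map_smul' := univRes_smul φ }
  res_id := fun (a : BunObj (terminal S)) m =>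
    (PullIso.res_res a.E (affProdEq (Category.comp_id (𝟙 a.base)).symm) (univHom (𝟙 a.base)) (𝟙 _)
      (Category.comp_id _) m).trans (PullIso.res_self a.E _ rfl m)
  res_comp φ ψ m := univRes_comp φ ψ m

/-- An object of the prestack of arrow bundles on `X`: a morphism `s : E ⟶ F` of vector bundles on
`U ×_S X`. -/
structure ArrObj (X : BasedCategory.{v, w} (AffOver S)) where
  base : AffOver S
  E : OMod.{u} (affProd base X)
  F : OMod.{u} (affProd base X)
  isVect_E : E.IsVect
  isVect_F : F.IsVect
  s : E ⟶ F

/-- A morphism of arrow bundles: a morphism `f : U ⟶ U'` and isomorphisms `a : f^< E' ≅ E` and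
`b : f^< F' ≅ F` such that `a ≫ s = f^< s' ≫ b`. -/
structure ArrHom (x y : ArrObj X) where
  base : x.base ⟶ y.base
  a : PullIso base y.E x.E
  b : PullIso base y.F x.F
  comm : OMod.pullbackMap (affProdMap base X) y.s ≫ b.hom = a.hom ≫ x.s

/-- The map on sections of `s`. -/
def ArrObj.app (x : ArrObj X) (y : AffProdObj x.base X) (m : x.E.obj y) : x.F.obj y :=
  OMod.Hom.app x.s y m

lemma ArrHom.comm_app {x y : ArrObj X} (φ : ArrHom x y) (z : AffProdObj x.base X)
    (m : y.E.obj ⟨z.pt, z.str ≫ φ.base⟩) :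
    φ.b.app z (y.app ⟨z.pt, z.str ≫ φ.base⟩ m) = x.app z (φ.a.app z m) :=
  congrArg (fun k : OMod.Hom _ _ => k.app z m) φ.comm

lemma ArrObj.app_res (x : ArrObj X) {y z : AffProdObj x.base X} (k : y ⟶ z) (m : x.E.obj z) :
    x.app y (x.E.res k m) = x.F.res k (x.app z m) :=
  OMod.Hom.naturality x.s k m

lemma ArrHom.ext' {x y : ArrObj X} {φ ψ : ArrHom x y} (ha : φ.a.Eqv ψ.a) (hb : φ.b.Eqv ψ.b) :
    φ = ψ := by
  obtain ⟨f, a, b, _⟩ := φ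
  obtain ⟨g, a', b', _⟩ := ψ
  obtain ⟨h₁, h₂⟩ := ha.heq
  obtain rfl : f = g := h₁
  obtain rfl : a = a' := eq_of_heq h₂
  obtain rfl : b = b' := eq_of_heq hb.heq.2
  rfl

lemma ArrHom.comp_comm {x y z : ArrObj X} (φ : ArrHom x y) (ψ : ArrHom y z)
    (q : AffProdObj x.base X) (m : z.E.obj ⟨q.pt, q.str ≫ φ.base ≫ ψ.base⟩) :
    (φ.b.comp ψ.b).app q (z.app ⟨q.pt, q.str ≫ φ.base ≫ ψ.base⟩ m) =
      x.app q ((φ.a.comp ψ.a).app q m) := by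
  rw [PullIso.comp_app, PullIso.comp_app, ← ArrHom.comm_app, ← ArrHom.comm_app,
    ← ArrObj.app_res]

instance : Category (ArrObj X) where
  Hom := ArrHom
  id x :=
    { base := 𝟙 _
      a := basePullbackId x.E
      b := basePullbackId x.F
      comm := OMod.Hom.ext' fun y m => (x.app_res (affProdEq (Category.comp_id y.str).symm) m).symm }
  comp φ ψ :=
    { base := φ.base ≫ ψ.base
      a := φ.a.comp ψ.a
      b := φ.b.comp ψ.b
      comm := OMod.Hom.ext' fun q m => ArrHom.comp_comm φ ψ q m }
  id_comp φ := ArrHom.ext' (PullIso.id_comp φ.a) (PullIso.id_comp φ.b)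
  comp_id φ := ArrHom.ext' (PullIso.comp_id φ.a) (PullIso.comp_id φ.b)
  assoc φ ψ χ := ArrHom.ext' (PullIso.assoc φ.a ψ.a χ.a) (PullIso.assoc φ.b ψ.b χ.b)

/-- The prestack of arrow bundles on `X`: its fibre over `U` is the groupoid of arrows of vector
bundles on `U ×_S X`. -/
abbrev ArrBun (X : BasedCategory.{v, w} (AffOver S)) :
    BasedCategory.{max u w, max (u + 1) v w} (AffOver S) where
  obj := ArrObj X
  p := { obj := fun a => ArrObj.base a, map := fun φ => ArrHom.base φ }

/-! ### Arrow bundles through mapping stacks -/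

/-- The mapping prestack `M(X) = Map_S(X, ∐ BGL_n)`. -/
abbrev MapBGL (X : BasedCategory.{v, w} (AffOver S)) := Map X (BGL S)

/-- The prestack `B(X) = M(X) ×_S X`. -/
abbrev BX (X : BasedCategory.{v, w} (AffOver S)) := prod (MapBGL X) X

/-- The universal vector bundle `E(X)` on `B(X) = M(X) ×_S X`: the pullback of the universal vector
bundle along the evaluation morphism. -/
def univE (X : BasedCategory.{v, w} (AffOver S)) : OMod.{u} (BX X) :=
  OMod.pullback (Map.eval X (BGL S)) (univBundle S)

/-- The module `[E(X), E(X)]_□ = [pr₁^* E(X), pr₂^* E(X)]` on `B(X) ×_S B(X)`. -/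
def homBox (X : BasedCategory.{v, w} (AffOver S)) : OMod (prod (BX X) (BX X)) :=
  OMod.ihom (OMod.pullback (prod.pr₁ (BX X) (BX X)) (univE X))
    (OMod.pullback (prod.pr₂ (BX X) (BX X)) (univE X))

/-- The prestack `V(X) = 𝕍 [E(X), E(X)]_□` over `B(X) ×_S B(X)`. -/
abbrev VX (X : BasedCategory.{v, w} (AffOver S)) : BasedCategory (AffOver S) :=
  totalSpace (homBox X)

/-- The structure morphism of `V(X)`. -/
abbrev VX.proj (X : BasedCategory.{v, w} (AffOver S)) :
    BasedFunctor (VX X) (prod (BX X) (BX X)) :=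
  relSpec.proj _

/-- The prestack `M_1'(X)`: the fibre product of `Map_S(X, V(X))` and `M(X) ×_S M(X)` over
`Map_S(X, B(X) ×_S B(X))`, along the composition with the structure morphism of `V(X)` and along
the morphism which maps `(v, w)` to `(v × id, w × id)`. -/
abbrev ArrBunMap (X : BasedCategory.{v, w} (AffOver S)) : BasedCategory (AffOver S) :=
  fibProd (Map.postcomp X (VX.proj X)) (Map.prodIdPair X (BGL S))

end

end ArrowBundle

end

noncomputable section

namespace ArrowBundle

/-! ### Categories fibred in groupoids over `Aff_{/S}` -/

section

variable {S : Scheme.{u}}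

/-! An object of `M_1'(X)` over `U` is a pair `(v, w)` of points of `M(X)` together with a morphism
from `U × X` to `V(X)` lying over `(v × id, w × id)`, up to a chosen isomorphism. Three
identifications turn this into an arrow of vector bundles on `U × X`.

The space `𝕍 P` represents sections of `P`. Let `P` be a sheaf of modules which locally has dual
bases (`OMod.IsLocallyProjective`); the internal Hom of two vector bundles is of this kind. Algebra
morphisms from `Sym(P^∨)|_x` to `O|_x` are functionals `φ` on `P^∨|_x`, and each of these is
evaluation at a unique element of `P(x)`: locally the element is `∑ φ(e'_i) e_i`, and these elements
glue (`OMod.IsLocallyProjective.exists_eval`, `OMod.IsLocallyProjective.eq_of_functional`). Hence a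
lift of `a : U × X → B` to `𝕍 P` is a compatible family of sections of `P` along `a`, and
`famCat.isBasedEquiv_ofFibProd` replaces the fibre product by pairs `(v, w)` with such a family.

A compatible family of sections of `[P, Q]` along `a` is a morphism `a^* P → a^* Q`. For a morphism
`G` of prestacks the functor from the slice over `x` to the slice over `G x` is full and essentially
surjective, so a local morphism over `G x` is determined by its values on the image and can be built
from them (`OMod.Hom.eq_of_families`, `OMod.Hom.exists_family`).

Pulling back the universal bundle identifies morphisms from a prestack `T` to the stack of vector
bundles with vector bundles on `T` (`univPullback_faithful`, `univPullback_full`,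
`exists_univPullback_iso`). The slice of `T` over `y` is equivalent to the affine scheme `p y`, so a
bundle on `T` has near `y` a model on `p y`. Isomorphisms of such models over a given morphism of
`T` and a given isomorphism of modules exist and are unique; naturality and cocycle conditions all
follow from the uniqueness. This is applied to `T = U × X`, where evaluation along `v × id` gives
back `v` up to an identification of structure morphisms.

The last two identifications make `toArrBun` an equivalence. The fibration property is handled as
`IsCart`, which is checked directly for arrow bundles and passes to `M_1'(X)` along the equivalence.
-/

/-- A category over `Aff_{/S}` with lifts of morphisms, all of whose morphisms are cartesian. -/
structure IsCart (X : BasedCategory.{v, w} (AffOver S)) : Prop where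
  lift {x : X.obj} {V : AffOver S} (f : V ⟶ X.p.obj x) :
    ∃ (y : X.obj) (φ : y ⟶ x) (e : X.p.obj y = V), X.p.map φ = eqToHom e ≫ f
  fill {x y z : X.obj} (φ : y ⟶ x) (ψ : z ⟶ x) (g : X.p.obj z ⟶ X.p.obj y)
    (h : g ≫ X.p.map φ = X.p.map ψ) : ∃ χ : z ⟶ y, X.p.map χ = g ∧ χ ≫ φ = ψ
  uniq {x y z : X.obj} (φ : y ⟶ x) {χ χ' : z ⟶ y} (h : X.p.map χ = X.p.map χ')
    (h' : χ ≫ φ = χ' ≫ φ) : χ = χ'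

variable {X : BasedCategory.{v, w} (AffOver S)} {Y : BasedCategory.{v₁, w₁} (AffOver S)}
  {Z : BasedCategory.{v₂, w₂} (AffOver S)}

lemma IsCart.isStronglyCartesian (h : IsCart X) {x y : X.obj} (φ : y ⟶ x) :
    X.p.IsStronglyCartesian (X.p.map φ) φ where
  universal_property' {z} g ψ hψ := by
    have := IsHomLift.fac' X.p (g ≫ X.p.map φ) ψ
    obtain ⟨χ, hχ, hχ'⟩ := h.fill φ ψ g (by simpa using this.symm)
    subst hχ
    refine ⟨χ, ⟨inferInstance, hχ'⟩, fun χ' ⟨h₁, h₂⟩ => h.uniq φ ?_ (h₂.trans hχ'.symm)⟩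
    simpa using IsHomLift.fac' X.p (X.p.map χ) χ'

/-- A morphism over an isomorphism is an isomorphism. -/
lemma IsCart.isIso (h : IsCart X) {x y : X.obj} (φ : y ⟶ x) [IsIso (X.p.map φ)] : IsIso φ := by
  obtain ⟨χ, hχ, hχ'⟩ := h.fill φ (𝟙 x) (inv (X.p.map φ)) (by simp)
  refine ⟨χ, h.uniq φ ?_ ?_, hχ'⟩
  · simp [hχ]
  · simp [hχ']

lemma IsCart.isIso_of_lift (h : IsCart X) {x y : X.obj} {U V : AffOver S} (f : U ⟶ V) [IsIso f]
    (φ : y ⟶ x) [X.p.IsHomLift f φ] : IsIso φ := by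
  have : IsIso (X.p.map φ) := by
    rw [IsHomLift.fac' X.p f φ]
    infer_instance
  exact h.isIso φ

/-- Lifts are strongly cartesian because all morphisms are. A morphism of a fibre lies over an
identity, so it is invertible. -/
lemma IsCart.isPrestack (h : IsCart X) : IsPrestack X where
  isFibered := Functor.IsFibered.of_exists_isStronglyCartesian fun x V f => by
    obtain ⟨y, φ, rfl, hφ⟩ := h.lift f
    rw [eqToHom_refl, Category.id_comp] at hφ
    exact ⟨y, φ, hφ ▸ h.isStronglyCartesian φ⟩
  isGroupoid U :=
    { all_isIso := fun {x y} φ => by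
        have := φ.2
        have : IsIso φ.1 := h.isIso_of_lift (𝟙 U) φ.1
        have e : IsIso ((Functor.Fiber.fiberInclusion (p := X.p) (S := U)).map φ) := this
        refine ⟨⟨inv φ.1, inferInstance⟩, ?_, ?_⟩
        · exact Functor.Fiber.hom_ext (IsIso.hom_inv_id φ.1)
        · exact Functor.Fiber.hom_ext (IsIso.inv_hom_id φ.1) }

/-- Compare `φ` with a cartesian lift `ψ` of the same morphism: the comparison lies in a fibre,
which is a groupoid, so `φ` is an isomorphism followed by `ψ`. In a fibred category cartesian
morphisms are strongly cartesian. -/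
lemma IsPrestack.isStronglyCartesian (h : IsPrestack X) {x y : X.obj} (φ : y ⟶ x) :
    X.p.IsStronglyCartesian (X.p.map φ) φ := by
  have := h.isFibered
  have := h.isGroupoid (X.p.obj y)
  obtain ⟨z, ψ, hψ⟩ := Functor.IsPreFibered.exists_isCartesian' (p := X.p) (X.p.map φ)
  let τ := Functor.IsCartesian.map X.p (X.p.map φ) ψ φ
  have hz : X.p.obj z = X.p.obj y := IsHomLift.domain_eq X.p (X.p.map φ) ψ
  let a : X.p.Fiber (X.p.obj y) := ⟨y, rfl⟩
  let b : X.p.Fiber (X.p.obj y) := ⟨z, hz⟩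
  let τ' : a ⟶ b := ⟨τ, inferInstanceAs (X.p.IsHomLift (𝟙 (X.p.obj y)) τ)⟩
  have : IsIso τ' := IsGroupoid.all_isIso τ'
  have hτ : IsIso τ :=
    inferInstanceAs (IsIso ((Functor.Fiber.fiberInclusion (p := X.p) (S := X.p.obj y)).map τ'))
  have : X.p.IsHomLift (𝟙 (X.p.obj y)) (asIso τ).hom :=
    inferInstanceAs (X.p.IsHomLift (𝟙 (X.p.obj y)) τ)
  have : X.p.IsCartesian (X.p.map φ) ((asIso τ).hom ≫ ψ) := inferInstance
  have e : (asIso τ).hom ≫ ψ = φ := Functor.IsCartesian.fac X.p (X.p.map φ) ψ φ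
  rw [e] at this
  infer_instance

lemma IsPrestack.isCart (h : IsPrestack X) : IsCart X where
  lift {x V} f := by
    have := h.isFibered
    obtain ⟨y, φ, hφ⟩ := Functor.IsPreFibered.exists_isCartesian' (p := X.p) f
    exact ⟨y, φ, IsHomLift.domain_eq X.p f φ, by simpa using IsHomLift.fac' X.p f φ⟩
  fill {x y z} φ ψ g hg := by
    have := h.isStronglyCartesian φ
    have : X.p.IsHomLift (g ≫ X.p.map φ) ψ := hg ▸ inferInstance
    obtain ⟨χ, ⟨h₁, h₂⟩, -⟩ :=
      Functor.IsStronglyCartesian.universal_property' (p := X.p) (f := X.p.map φ) (φ := φ) g ψ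
    exact ⟨χ, by simpa using IsHomLift.fac' X.p g χ, h₂⟩
  uniq {x y z} φ χ χ' e e' := by
    have := h.isStronglyCartesian φ
    have : X.p.IsHomLift (X.p.map χ) χ' := e ▸ inferInstance
    exact Functor.IsStronglyCartesian.ext X.p (X.p.map φ) φ (X.p.map χ) e'

/-! ### Based functors and based natural transformations -/

/-- Based functors commute with the projections by an equality of functors, so base morphisms are
only known up to `eqToHom`. This lemma and `based_app` are the means of computing them. -/
lemma based_map (F : BasedFunctor X Y) {x y : X.obj} (f : x ⟶ y) :
    Y.p.map (F.map f) = eqToHom (F.w_obj x) ≫ X.p.map f ≫ eqToHom (F.w_obj y).symm :=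
  IsHomLift.fac' Y.p (X.p.map f) (F.map f)

lemma based_app {F G : BasedFunctor X Y} (α : F ⟶ G) (x : X.obj) :
    Y.p.map (α.app x) = eqToHom ((F.w_obj x).trans (G.w_obj x).symm) := by
  simpa using IsHomLift.fac' Y.p (𝟙 (X.p.obj x)) (α.app x)

lemma isHomLift_id {x y : X.obj} {U : AffOver S} (φ : x ⟶ y) (hx : X.p.obj x = U)
    (hy : X.p.obj y = U) (h : X.p.map φ = eqToHom (hx.trans hy.symm)) :
    X.p.IsHomLift (𝟙 U) φ :=
  IsHomLift.of_fac' X.p _ _ hx hy (by simp [h])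

/-- A `2`-morphism of prestacks is invertible. -/
lemma IsCart.isIso_nat (h : IsCart Y) {F G : BasedFunctor X Y} (α : F ⟶ G) : IsIso α := by
  have (x : X.obj) : IsIso (α.toNatTrans.app x) := h.isIso_of_lift (𝟙 (X.p.obj x)) _
  have : IsIso (X := F.toFunctor) α.toNatTrans := NatIso.isIso_of_isIso_app _
  exact BasedNatIso.isIso_of_toNatTrans_isIso α

/-- Every object over `F x` comes, up to isomorphism, from an object over `x`. -/
lemma IsCart.exists_lift (hX : IsCart X) (hY : IsCart Y) (F : BasedFunctor X Y) {x : X.obj}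
    {z : Y.obj} (k : z ⟶ F.obj x) :
    ∃ (y : X.obj) (f : y ⟶ x) (i : z ≅ F.obj y), i.hom ≫ F.map f = k ∧
      ∃ e : Y.p.obj z = Y.p.obj (F.obj y), Y.p.map i.hom = eqToHom e := by
  obtain ⟨y, f, e, hf⟩ := hX.lift (Y.p.map k ≫ eqToHom (F.w_obj x))
  obtain ⟨i, hi, hi'⟩ := hY.fill (F.map f) k (eqToHom (e.symm.trans (F.w_obj y).symm))
    (by rw [based_map, hf]; simp)
  have : IsIso (Y.p.map i) := by rw [hi]; infer_instance
  have := hY.isIso i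
  exact ⟨y, f, asIso i, hi', _, hi⟩

/-- The morphism `k` is the filler in `X` over the base of `h`; its image is `h` because fillers
against `F.map f` are unique in `Y`. With `IsCart.exists_lift`, this compares the slices over `x`
and over `F x`. -/
lemma IsCart.exists_hom (hX : IsCart X) (hY : IsCart Y) (F : BasedFunctor X Y) {x y z : X.obj}
    (f : y ⟶ x) (g : z ⟶ x) (h : F.obj z ⟶ F.obj y) (e : h ≫ F.map f = F.map g) :
    ∃ k : z ⟶ y, k ≫ f = g ∧ F.map k = h := by
  have e' := congrArg Y.p.map e
  rw [Functor.map_comp, based_map, based_map] at e'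
  obtain ⟨k, hk, hk'⟩ := hX.fill f g
    (eqToHom (F.w_obj z).symm ≫ Y.p.map h ≫ eqToHom (F.w_obj y)) (by
      rw [← cancel_mono (eqToHom (F.w_obj x).symm)]
      simp only [Category.assoc]
      rw [e']
      simp)
  refine ⟨k, hk', hY.uniq (F.map f) ?_ ?_⟩
  · rw [based_map, hk]
    simp
  · rw [e, ← Functor.map_comp, hk']

/-! ### Examples of prestacks -/

lemma terminal.isCart (S : Scheme.{u}) : IsCart (terminal S) where
  lift {_ V} f := ⟨V, f, rfl, (Category.id_comp f).symm⟩
  fill _ _ g h := ⟨g, rfl, h⟩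
  uniq _ _ _ h _ := h

lemma IsCart.affProd (h : IsCart X) (U : AffOver S) : IsCart (affProd U X) where
  lift {x V} f := by
    obtain ⟨y, φ, e, hφ⟩ := h.lift f
    exact ⟨⟨y, X.p.map φ ≫ x.str⟩, { hom := φ }, e, hφ⟩
  fill {x y z} φ ψ g hg := by
    obtain ⟨χ, h₁, h₂⟩ := h.fill φ.hom ψ.hom g hg
    refine ⟨{ hom := χ, w := ?_ }, h₁, AffProdObj.hom_ext h₂⟩
    rw [← φ.w, ← ψ.w, ← h₂, Functor.map_comp, Category.assoc]
  uniq φ χ χ' e e' := AffProdObj.hom_ext (h.uniq φ.hom e (congrArg AffProdHom.hom e'))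

lemma IsCart.slice (h : IsCart X) (x : X.obj) : IsCart (slice X x) where
  lift {y V} f := by
    obtain ⟨z, φ, e, hφ⟩ := h.lift (x := y.left) f
    exact ⟨Over.mk (φ ≫ y.hom), Over.homMk φ, e, hφ⟩
  fill {y₁ y₂ y₃} φ ψ g hg := by
    obtain ⟨χ, h₁, h₂⟩ := h.fill φ.left ψ.left g hg
    refine ⟨Over.homMk χ ?_, h₁, Over.OverMorphism.ext h₂⟩
    rw [← Over.w φ, ← Category.assoc, h₂, Over.w]
  uniq φ χ χ' e e' := Over.OverMorphism.ext (h.uniq φ.left e (congrArg CommaMorphism.left e'))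

lemma ProdHom.map_fst {a b : ProdObj Y Z} (φ : ProdHom a b) :
    Y.p.map φ.fst = eqToHom a.fst_base ≫ φ.base ≫ eqToHom b.fst_base.symm :=
  IsHomLift.fac' Y.p φ.base φ.fst

lemma ProdHom.map_snd {a b : ProdObj Y Z} (φ : ProdHom a b) :
    Z.p.map φ.snd = eqToHom a.snd_base ≫ φ.base ≫ eqToHom b.snd_base.symm :=
  IsHomLift.fac' Z.p φ.base φ.snd

lemma IsCart.prod (hY : IsCart Y) (hZ : IsCart Z) : IsCart (prod Y Z) where
  lift {x V} f := by
    obtain ⟨_, x₁, x₂, rfl, hx⟩ := x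
    obtain ⟨y, φ, e, hφ⟩ := hY.lift f
    obtain ⟨z, ψ, e', hψ⟩ := hZ.lift (x := x₂) (f ≫ eqToHom hx.symm)
    refine ⟨⟨V, y, z, e, e'⟩, ⟨f, φ, ψ, ?_, ?_⟩, rfl, (Category.id_comp f).symm⟩
    · exact IsHomLift.of_fac' _ _ _ e rfl (by simp [hφ])
    · exact IsHomLift.of_fac' _ _ _ e' hx (by simp [hψ])
  fill {x y z} φ ψ g hg := by
    have hg' : g ≫ φ.base = ψ.base := hg
    obtain ⟨χ, a₁, a₂⟩ := hY.fill φ.fst ψ.fst (eqToHom z.fst_base ≫ g ≫ eqToHom y.fst_base.symm)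
      (by rw [φ.map_fst, ψ.map_fst, ← hg']; simp)
    obtain ⟨χ', b₁, b₂⟩ := hZ.fill φ.snd ψ.snd (eqToHom z.snd_base ≫ g ≫ eqToHom y.snd_base.symm)
      (by rw [φ.map_snd, ψ.map_snd, ← hg']; simp)
    exact ⟨⟨g, χ, χ', IsHomLift.of_fac' _ _ _ z.fst_base y.fst_base a₁,
      IsHomLift.of_fac' _ _ _ z.snd_base y.snd_base b₁⟩, rfl, ProdHom.ext hg' a₂ b₂⟩
  uniq {x y z} φ χ χ' e e' := by
    refine ProdHom.ext e (hY.uniq φ.fst ?_ (congrArg ProdHom.fst e'))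
      (hZ.uniq φ.snd ?_ (congrArg ProdHom.snd e'))
    · rw [χ.map_fst, χ'.map_fst, show χ.base = χ'.base from e]
    · rw [χ.map_snd, χ'.map_snd, show χ.base = χ'.base from e]

lemma whiskerRight_hom_inv {F G : BasedFunctor X Y} (e : F ≅ G) (H : BasedFunctor Y Z) :
    BasedCategory.whiskerRight e.hom H ≫ BasedCategory.whiskerRight e.inv H = 𝟙 _ := by
  ext x
  refine (H.map_comp _ _).symm.trans ((congrArg H.map ?_).trans (H.map_id _))
  exact congrArg (fun β => β.toNatTrans.app x) e.hom_inv_id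

lemma MapHom.cell_congr {a b : MapObj Y Z} {f : a.base ⟶ b.base}
    {c d : a.mor ⟶ BasedFunctor.comp (affProdMap f Y) b.mor}
    (h : MapHom.mk f c = MapHom.mk f d) : c = d := by
  cases h
  rfl

/-- Lifts are given by composition with `f × id`. Fillers exist and are unique because the `2`-cell
of `φ` consists of morphisms of `Z` over identities, so it can be inverted. Nothing is needed of
`Y`. -/
lemma IsCart.map (hZ : IsCart Z) : IsCart (Map Y Z) where
  lift {b V} f := ⟨MapObj.pull b f, ⟨f, 𝟙 _⟩, rfl, (Category.id_comp f).symm⟩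
  fill {a b c} φ ψ g hg := by
    obtain ⟨f, ψ⟩ := ψ
    obtain rfl : g ≫ MapHom.base φ = f := hg
    let k : BasedFunctor.comp (affProdMap g Y) b.mor ⟶ BasedFunctor.comp
        (BasedFunctor.comp (affProdMap g Y) (affProdMap (MapHom.base φ) Y)) a.mor :=
      BasedCategory.whiskerLeft (affProdMap g Y) (MapHom.cell φ)
    have : IsIso k := hZ.isIso_nat k
    refine ⟨⟨g, ψ ≫ BasedCategory.whiskerRight (affProdMapComp rfl Y).hom a.mor ≫ inv k⟩, rfl,
      congrArg (MapHom.mk _) ?_⟩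
    change (ψ ≫ _ ≫ inv k) ≫ k ≫ _ = ψ
    rw [Category.assoc, Category.assoc, IsIso.inv_hom_id_assoc, whiskerRight_hom_inv,
      Category.comp_id]
  uniq {a b c} φ χ χ' e e' := by
    obtain ⟨f, χ⟩ := χ
    obtain ⟨f', χ'⟩ := χ'
    obtain rfl : f = f' := e
    have h := MapHom.cell_congr e'
    let k : BasedFunctor.comp (affProdMap f Y) b.mor ⟶
        BasedFunctor.comp (affProdMap (f ≫ MapHom.base φ) Y) a.mor :=
      BasedCategory.whiskerLeft (affProdMap f Y) (MapHom.cell φ) ≫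
        BasedCategory.whiskerRight (affProdMapComp rfl Y).inv a.mor
    have : IsIso k := hZ.isIso_nat k
    exact congrArg (MapHom.mk _) ((cancel_mono k).1 h)

/-! ### Slices -/

/-- The morphism `X_{/x} → Y_{/F x}` induced by `F : X → Y`. -/
def sliceMap (F : BasedFunctor X Y) (x : X.obj) : BasedFunctor (slice X x) (slice Y (F.obj x)) where
  toFunctor := Over.post F.toFunctor
  w := by
    refine CategoryTheory.Functor.ext (fun y => F.w_obj y.left) fun y z f => ?_
    exact based_map F f.left

/-- A functor is full and essentially surjective. -/
structure IsFullEss (F : BasedFunctor X Y) : Prop where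
  ess (z : Y.obj) : ∃ y : X.obj, Nonempty (z ≅ F.obj y)
  full {y y' : X.obj} (h : F.obj y ⟶ F.obj y') : ∃ k : y ⟶ y', F.map k = h

/-- `IsCart.exists_lift` and `IsCart.exists_hom` read on slices. It allows local morphisms of
modules over `F x` to be built from data over `x`. -/
lemma IsCart.isFullEss_sliceMap (hX : IsCart X) (hY : IsCart Y) (F : BasedFunctor X Y)
    (x : X.obj) : IsFullEss (sliceMap F x) where
  ess z := by
    obtain ⟨y, f, i, hi, -⟩ := hX.exists_lift hY F z.hom
    exact ⟨Over.mk f, ⟨Over.isoMk i hi⟩⟩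
  full {y y'} h := by
    obtain ⟨k, hk, hk'⟩ := hX.exists_hom hY F y'.hom y.hom h.left (Over.w h)
    exact ⟨Over.homMk k hk, Over.OverMorphism.ext hk'⟩

end

section

variable {S : Scheme.{u}} {X : BasedCategory.{v, w} (AffOver S)}
  {Y : BasedCategory.{v₁, w₁} (AffOver S)} {Z : BasedCategory.{v₂, w₂} (AffOver S)}

/-! ### Coverings -/

/-- Stated with a variable `q` so that the equality of functors can be eliminated; what remains is
functoriality of the pushforward of sieves. -/
lemma isCovering_functorPushforward_aux {C : Type w} {D : Type w₁} [Category.{v} C]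
    [Category.{v₁} D] (q : C ⥤ AffOver S) (F : C ⥤ D) (p : D ⥤ AffOver S) (h : F ⋙ p = q) {x : C}
    (R : Sieve x) :
    R.functorPushforward (q ⋙ AffOver.toScheme S) ∈ Scheme.etaleTopology.{u} _ ↔
      (R.functorPushforward F).functorPushforward (p ⋙ AffOver.toScheme S) ∈
        Scheme.etaleTopology.{u} _ := by
  subst h
  rw [← Sieve.functorPushforward_comp]
  rfl

lemma isCovering_functorPushforward_iff (F : BasedFunctor X Y) {x : X.obj} {R : Sieve x} :
    IsCovering (R.functorPushforward F.toFunctor) ↔ IsCovering R :=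
  (isCovering_functorPushforward_aux X.p F.toFunctor Y.p F.w R).symm

/-- Pushing the pulled back sieve forward again loses nothing: every member of `R` is an isomorphism
followed by some `F.map k₀`, and `k₀` is then in the pullback. -/
lemma isCovering_functorPullback (hX : IsCart X) (hY : IsCart Y) (F : BasedFunctor X Y)
    {x : X.obj} {R : Sieve (F.obj x)} (hR : IsCovering R) :
    IsCovering (R.functorPullback F.toFunctor) := by
  rw [← isCovering_functorPushforward_iff F]
  refine GrothendieckTopology.superset_covering _ ?_ hR
  rintro T _ ⟨z, k, h, hk, rfl⟩
  obtain ⟨w, k₀, i, hi, -⟩ := hX.exists_lift hY F k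
  refine Sieve.downward_closed _ (Sieve.image_mem_functorPushforward _ _ (?_ : _)) h
  refine ⟨w, k₀, i.hom, ?_, hi.symm⟩
  change R (F.map k₀)
  rw [← Iso.eq_inv_comp] at hi
  rw [hi]
  exact R.downward_closed hk _

/-- The fibre product of affine schemes over `S`. -/
lemma AffOver.exists_pullback {U V W : AffOver S} (f : U ⟶ W) (g : V ⟶ W) :
    ∃ (P : AffOver S) (a : P ⟶ U) (b : P ⟶ V), a ≫ f = b ≫ g ∧
      ∀ {T : Scheme.{u}} (c : T ⟶ (AffOver.toScheme S).obj U) (d : T ⟶ (AffOver.toScheme S).obj V),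
        c ≫ (AffOver.toScheme S).map f = d ≫ (AffOver.toScheme S).map g →
          ∃ e : T ⟶ (AffOver.toScheme S).obj P, e ≫ (AffOver.toScheme S).map a = c := by
  have := U.property
  have := V.property
  have := W.property
  let f' : U.obj.left ⟶ W.obj.left := (AffOver.toScheme S).map f
  let g' : V.obj.left ⟶ W.obj.left := (AffOver.toScheme S).map g
  have wf : f' ≫ W.obj.hom = U.obj.hom := Over.w f.hom
  have wg : g' ≫ W.obj.hom = V.obj.hom := Over.w g.hom
  let P : AffOver S := ⟨Over.mk (Limits.pullback.fst f' g' ≫ U.obj.hom),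
    inferInstanceAs (IsAffine (Limits.pullback f' g'))⟩
  let a : P ⟶ U := ObjectProperty.homMk (Over.homMk (Limits.pullback.fst f' g') rfl)
  let b : P ⟶ V := ObjectProperty.homMk (Over.homMk (Limits.pullback.snd f' g') (by
    change Limits.pullback.snd f' g' ≫ V.obj.hom = Limits.pullback.fst f' g' ≫ U.obj.hom
    rw [← wf, ← wg, Limits.pullback.condition_assoc]))
  refine ⟨P, a, b, ?_, fun {T} c d h => ⟨Limits.pullback.lift c d h, Limits.pullback.lift_fst _ _ _⟩⟩
  refine ObjectProperty.hom_ext _ (Over.OverMorphism.ext ?_)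
  exact Limits.pullback.condition

/-- A scheme morphism in the base change of the covering factors through a fibre product of affine
schemes. Its projection lifts to `X`, and since `g ∈ R` is cartesian, the composite of the lift with
`f` factors through `g`. The test object of the fibre product is an arbitrary scheme because
coverings are sieves in schemes. -/
lemma isCovering_pullback (hX : IsCart X) {x y : X.obj} (f : y ⟶ x) {R : Sieve x}
    (hR : IsCovering R) : IsCovering (R.pullback f) := by
  refine GrothendieckTopology.superset_covering _ ?_
    (GrothendieckTopology.pullback_stable _ ((X.p ⋙ AffOver.toScheme S).map f) hR)
  rintro T k ⟨w, g, h, hg, hk⟩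
  obtain ⟨P, a, b, hab, hP⟩ := AffOver.exists_pullback (X.p.map f) (X.p.map g)
  obtain ⟨e, rfl⟩ := hP k h hk
  obtain ⟨z, φ, rfl, hφ⟩ := hX.lift a
  rw [eqToHom_refl, Category.id_comp] at hφ
  subst hφ
  obtain ⟨χ, -, hχ⟩ := hX.fill g (φ ≫ f) b (by rw [Functor.map_comp, hab])
  refine ⟨z, φ, e, ?_, rfl⟩
  change R (φ ≫ f)
  rw [← hχ]
  exact R.downward_closed hg _

/-! ### Bases -/

/-- Every element is a linear combination of the `v i` in a unique way. -/
def IsBasisFamily (R : Type*) {M : Type*} {n : ℕ} [CommRing R] [AddCommGroup M] [Module R M]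
    (v : Fin n → M) : Prop :=
  ∀ m : M, ∃! c : Fin n → R, ∑ i, c i • v i = m

/-- Unique coefficients are easier to carry along semilinear bijections than independence and span,
and the ring changes with every pullback. -/
lemma isBasisFamily_iff (R : Type*) {M : Type*} {n : ℕ} [CommRing R] [AddCommGroup M] [Module R M]
    (v : Fin n → M) :
    (LinearIndependent R v ∧ Submodule.span R (Set.range v) = ⊤) ↔ IsBasisFamily R v := by
  constructor
  · rintro ⟨h₁, h₂⟩ m
    have hm : m ∈ Submodule.span R (Set.range v) := h₂ ▸ Submodule.mem_top
    obtain ⟨c, hc⟩ := (Submodule.mem_span_range_iff_exists_fun R).1 hm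
    refine ⟨c, hc, fun d hd => ?_⟩
    rw [Fintype.linearIndependent_iff] at h₁
    funext i
    refine sub_eq_zero.1 (h₁ (fun i => d i - c i) ?_ i)
    simp only [sub_smul, Finset.sum_sub_distrib]
    rw [hd, hc, sub_self]
  · intro h
    constructor
    · rw [Fintype.linearIndependent_iff]
      intro c hc i
      exact congrFun ((h 0).unique hc (y₂ := 0) (by simp)) i
    · refine Submodule.eq_top_iff'.2 fun m => ?_
      obtain ⟨c, hc, -⟩ := h m
      exact (Submodule.mem_span_range_iff_exists_fun R).2 ⟨c, hc⟩

lemma IsBasisFamily.transport {R R' M M' : Type*} {n : ℕ} [CommRing R] [CommRing R']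
    [AddCommGroup M] [AddCommGroup M'] [Module R M] [Module R' M'] (σ : R →+* R')
    (hσ : Function.Bijective σ) (g : M →+ M') (hg : Function.Bijective g)
    (h : ∀ r m, g (r • m) = σ r • g m) {v : Fin n → M} (hv : IsBasisFamily R v) :
    IsBasisFamily R' (fun i => g (v i)) := by
  intro m'
  obtain ⟨m, rfl⟩ := hg.2 m'
  obtain ⟨c, hc, hc'⟩ := hv m
  refine ⟨fun i => σ (c i), ?_, fun d hd => ?_⟩
  · simp only [← h, ← map_sum]
    rw [hc]
  · choose d' hd' using fun i => hσ.2 (d i)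
    have : d' = c := by
      refine hc' d' (hg.1 ?_)
      rw [← hd, map_sum]
      exact Finset.sum_congr rfl fun i _ => by rw [h, hd']
    rw [← this]
    funext i
    exact (hd' i).symm

lemma IsBasisFamily.of_transport {R R' M M' : Type*} {n : ℕ} [CommRing R] [CommRing R']
    [AddCommGroup M] [AddCommGroup M'] [Module R M] [Module R' M'] (σ : R →+* R')
    (hσ : Function.Bijective σ) (g : M →+ M') (hg : Function.Bijective g)
    (h : ∀ r m, g (r • m) = σ r • g m) {v : Fin n → M}
    (hv : IsBasisFamily R' (fun i => g (v i))) : IsBasisFamily R v := by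
  intro m
  obtain ⟨c, hc, hc'⟩ := hv (g m)
  choose d hd using fun i => hσ.2 (c i)
  refine ⟨d, hg.1 ?_, fun d' hd' => ?_⟩
  · rw [← hc, map_sum]
    exact Finset.sum_congr rfl fun i _ => by rw [h, hd]
  · have := hc' (fun i => σ (d' i)) (by simp only [← h, ← map_sum, hd'])
    funext i
    refine hσ.1 ?_
    rw [hd]
    exact congrFun this i

lemma Fn.map_bijective {U V : AffOver S} (f : U ⟶ V) [IsIso f] :
    Function.Bijective (Fn.map f) := by
  refine Function.bijective_iff_has_inverse.2 ⟨Fn.map (inv f), fun r => ?_, fun r => ?_⟩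
  · rw [← Fn.map_comp, IsIso.inv_hom_id, Fn.map_id]
  · rw [← Fn.map_comp, IsIso.hom_inv_id, Fn.map_id]

lemma O.comparison_bijective (F : BasedFunctor X Y) (x : X.obj) :
    Function.Bijective (O.comparison F x) :=
  Fn.map_bijective _

lemma O.res_bijective {x y : X.obj} (f : x ⟶ y) [IsIso f] : Function.Bijective (O.res f) :=
  Fn.map_bijective _

lemma OMod.res_bijective (E : OMod.{t} X) {x y : X.obj} (f : x ⟶ y) [IsIso f] :
    Function.Bijective (E.res f) := by
  refine Function.bijective_iff_has_inverse.2 ⟨E.res (inv f), fun r => ?_, fun r => ?_⟩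
  · rw [← E.res_comp, IsIso.inv_hom_id, E.res_id]
  · rw [← E.res_comp, IsIso.hom_inv_id, E.res_id]

/-! ### Vector bundles, pointwise -/

/-- The sheaf property of `E` for the coverings of `x`. -/
def OMod.IsSheafAt (E : OMod.{t} X) (x : X.obj) : Prop :=
  ∀ (R : Sieve x) (_ : IsCovering R) (s : ∀ ⦃y : X.obj⦄ (f : y ⟶ x), R f → E.obj y)
    (_ : ∀ ⦃y z : X.obj⦄ (f : y ⟶ x) (hf : R f) (g : z ⟶ y),
      E.res g (s f hf) = s (g ≫ f) (R.downward_closed hf g)),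
    ∃! m : E.obj x, ∀ ⦃y : X.obj⦄ (f : y ⟶ x) (hf : R f), E.res f m = s f hf

/-- The existence of a covering of `x` over which `E` is finite free. -/
def OMod.IsLocallyFreeAt (E : OMod.{t} X) (x : X.obj) : Prop :=
  ∃ R : Sieve x, IsCovering R ∧ ∀ ⦃y : X.obj⦄ (f : y ⟶ x), R f →
    ∃ (n : ℕ) (e : Fin n → E.obj y), ∀ ⦃z : X.obj⦄ (g : z ⟶ y),
      IsBasisFamily (O X z) (fun i => E.res g (e i))

/-- Being a vector bundle is a condition at each object separately. This makes it possible to check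
the universal bundle one slice at a time. -/
lemma OMod.isVect_iff (E : OMod.{t} X) :
    E.IsVect ↔ ∀ x, E.IsSheafAt x ∧ E.IsLocallyFreeAt x := by
  constructor
  · intro h x
    refine ⟨fun R => h.isSheaf R, ?_⟩
    obtain ⟨R, hR, H⟩ := h.locallyFree x
    refine ⟨R, hR, fun y f hf => ?_⟩
    obtain ⟨n, e, he⟩ := H f hf
    exact ⟨n, e, fun z g => (isBasisFamily_iff _ _).1 (he g)⟩
  · intro h
    refine ⟨fun {x} R hR => (h x).1 R hR, fun x => ?_⟩
    obtain ⟨R, hR, H⟩ := (h x).2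
    refine ⟨R, hR, fun y f hf => ?_⟩
    obtain ⟨n, e, he⟩ := H f hf
    exact ⟨n, e, fun z g => (isBasisFamily_iff _ _).2 (he g)⟩

lemma OMod.res_iso_eq (E : OMod.{t} X) {x y : X.obj} (i : x ≅ y) (m : E.obj x) :
    E.res i.hom (E.res i.inv m) = m := by
  rw [← E.res_comp, i.hom_inv_id, E.res_id]

lemma OMod.isSheafAt_pullback_iff' (F : BasedFunctor X Y) (E : OMod.{t} Y) {x : X.obj} :
    (pullback F E).IsSheafAt x ↔ ∀ (R : Sieve x) (_ : IsCovering R)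
      (s : ∀ ⦃y : X.obj⦄ (f : y ⟶ x), R f → E.obj (F.obj y))
      (_ : ∀ ⦃y z : X.obj⦄ (f : y ⟶ x) (hf : R f) (g : z ⟶ y),
        E.res (F.map g) (s f hf) = s (g ≫ f) (R.downward_closed hf g)),
      ∃! m : E.obj (F.obj x), ∀ ⦃y : X.obj⦄ (f : y ⟶ x) (hf : R f),
        E.res (F.map f) m = s f hf :=
  Iff.rfl

/-- A compatible family on `R` extends to the sieve generated by its image: every `k` over `F x` is
isomorphic to some `F.map k₀`, and the section at `k₀` is transported along this isomorphism. The
sheaf property at `F x` then glues. -/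
lemma OMod.isSheafAt_pullback (hX : IsCart X) (hY : IsCart Y) (F : BasedFunctor X Y)
    (E : OMod.{t} Y) {x : X.obj} (h : E.IsSheafAt (F.obj x)) : (pullback F E).IsSheafAt x := by
  rw [isSheafAt_pullback_iff']
  intro R hR s hs
  -- The replacement `k₀` is chosen for every `k`, whether or not it is in the sieve, so that it
  -- depends on no membership proof.
  choose w k₀ i hi _ using fun (z : Y.obj) (k : z ⟶ F.obj x) => hX.exists_lift hY F k
  -- The transported section may be computed from any factorisation of `k` through the image of a
  -- member of `R`.
  have key {z : Y.obj} (k : z ⟶ F.obj x) {y : X.obj} (f : y ⟶ x) (hf : R f) (h : z ⟶ F.obj y)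
      (e : h ≫ F.map f = k) : ∃ hk : R (k₀ z k),
        E.res (i z k).hom (s (k₀ z k) hk) = E.res h (s f hf) := by
    have hi' := hi z k
    rw [← Iso.eq_inv_comp] at hi'
    obtain ⟨g, hg, hg'⟩ := hX.exists_hom hY F f (k₀ z k) ((i z k).inv ≫ h)
      (by rw [Category.assoc, e, ← hi'])
    have hk : R (k₀ z k) := hg ▸ R.downward_closed hf g
    have h₂ : E.res (F.map g) (s f hf) = s (k₀ z k) hk := by
      rw [hs f hf g]
      simp only [hg]
    refine ⟨hk, ?_⟩
    rw [← h₂, ← E.res_comp, hg', Iso.hom_inv_id_assoc]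
  have key' {z : Y.obj} {k : z ⟶ F.obj x} (hk : R.functorPushforward F.toFunctor k) :
      R (k₀ z k) := by
    obtain ⟨y, f, h, hf, e⟩ := hk
    exact (key k f hf h e.symm).1
  obtain ⟨m, hm, hm'⟩ := h (R.functorPushforward F.toFunctor)
    ((isCovering_functorPushforward_iff F).2 hR)
    (fun z k hk => E.res (i z k).hom (s (k₀ z k) (key' hk))) (by
      rintro z z' k hk g
      rw [← E.res_comp]
      refine ((key (g ≫ k) (k₀ z k) (key' hk) (g ≫ (i z k).hom) ?_).2).symm
      rw [Category.assoc, hi])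
  refine ⟨m, fun y f hf => ?_, fun m' hm₂ => hm' m' fun z k hk => ?_⟩
  · refine (hm (F.map f) (Sieve.image_mem_functorPushforward F.toFunctor R hf)).trans ?_
    exact (key (F.map f) f hf (𝟙 (F.obj y)) (Category.id_comp (F.map f))).2.trans
      (E.res_id (F.obj y) (s f hf))
  · rw [← hm₂ (k₀ z k) (key' hk), ← E.res_comp, hi]

/-- Glue the part of the family indexed by morphisms in the image of `F`. The result restricts
correctly along all of `R`, since every member of `R` is isomorphic to one in the image. -/
lemma OMod.IsSheafAt.of_pullback (hX : IsCart X) (hY : IsCart Y) (F : BasedFunctor X Y)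
    (E : OMod.{t} Y) {x : X.obj} (h : (pullback F E).IsSheafAt x) : E.IsSheafAt (F.obj x) := by
  rw [isSheafAt_pullback_iff'] at h
  intro R hR s hs
  obtain ⟨m, hm, hm'⟩ := h (R.functorPullback F.toFunctor) (isCovering_functorPullback hX hY F hR)
    (fun y f hf => s (F.map f) hf) (fun y z f hf g => by
      refine (hs (F.map f) hf (F.map g)).trans ?_
      simp only [F.map_comp])
  refine ⟨m, fun z k hk => ?_, fun m' h₂ => hm' m' fun y f hf => h₂ (F.map f) hf⟩
  obtain ⟨w, k₀, i, hi, -⟩ := hX.exists_lift hY F k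
  have hk₀ : R (F.map k₀) := by
    rw [← Iso.eq_inv_comp] at hi
    rw [hi]
    exact R.downward_closed hk _
  have h₁ : E.res (F.map k₀) m = s (F.map k₀) hk₀ := hm k₀ hk₀
  have h₂ := hs (F.map k₀) hk₀ i.hom
  rw [← h₁, ← E.res_comp] at h₂
  subst hi
  exact h₂

/-- Coverings of `x` and of `F x` correspond, and a family is a basis over `O X z` exactly when it
is one over `O Y (F.obj z)`, as `O.comparison` is bijective. -/
lemma OMod.isLocallyFreeAt_pullback_iff (hX : IsCart X) (hY : IsCart Y) (F : BasedFunctor X Y)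
    (E : OMod.{t} Y) {x : X.obj} :
    (pullback F E).IsLocallyFreeAt x ↔ E.IsLocallyFreeAt (F.obj x) := by
  have key {y z : X.obj} (g : z ⟶ y) {n : ℕ} (e : Fin n → E.obj (F.obj y)) :
      IsBasisFamily (O X z) (fun i => (pullback F E).res g (e i)) ↔
        IsBasisFamily (O Y (F.obj z)) (fun i => E.res (F.map g) (e i)) :=
    ⟨IsBasisFamily.transport (M := (pullback F E).obj z) (O.comparison F z)
      (O.comparison_bijective F z) (AddMonoidHom.id (E.obj (F.obj z))) Function.bijective_id
      fun _ _ => rfl,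
    IsBasisFamily.of_transport (M := (pullback F E).obj z) (O.comparison F z)
      (O.comparison_bijective F z) (AddMonoidHom.id (E.obj (F.obj z))) Function.bijective_id
      fun _ _ => rfl⟩
  constructor
  · rintro ⟨R, hR, H⟩
    refine ⟨_, (isCovering_functorPushforward_iff F).2 hR, ?_⟩
    rintro z _ ⟨y, f, h, hf, rfl⟩
    obtain ⟨n, e, he⟩ := H f hf
    refine ⟨n, fun i => E.res h (e i), fun z' g => ?_⟩
    -- The morphism `g ≫ h` need not be in the image of `F`; it is replaced by an isomorphic `F.map
    -- k₀`, along which `e` is known to stay a basis.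
    obtain ⟨w, k₀, j, hj, -⟩ := hX.exists_lift hY F (g ≫ h)
    have := (key k₀ e).1 (he k₀)
    have e' (i : Fin n) : E.res g (E.res h (show E.obj (F.obj y) from e i)) =
        E.res j.hom (E.res (F.map k₀) (show E.obj (F.obj y) from e i)) := by
      rw [← E.res_comp, ← E.res_comp, hj]
    refine (congrArg (IsBasisFamily (O Y z')) (funext e')).mpr ?_
    exact this.transport (O.res j.hom) (O.res_bijective j.hom) (E.res j.hom).toAddMonoidHom
      (E.res_bijective j.hom) fun r m => (E.res j.hom).map_smulₛₗ r m
  · rintro ⟨R, hR, H⟩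
    refine ⟨_, isCovering_functorPullback hX hY F hR, fun y f hf => ?_⟩
    obtain ⟨n, e, he⟩ := H (F.map f) hf
    exact ⟨n, e, fun z g => (key g e).2 (he (F.map g))⟩

lemma OMod.IsVect.pullback (hX : IsCart X) (hY : IsCart Y) (F : BasedFunctor X Y)
    {E : OMod.{t} Y} (h : E.IsVect) : (OMod.pullback F E).IsVect := by
  rw [isVect_iff] at h ⊢
  exact fun x => ⟨isSheafAt_pullback hX hY F E (h _).1,
    (isLocallyFreeAt_pullback_iff hX hY F E).2 (h _).2⟩

lemma OMod.iso_app_bijective {E E' : OMod.{t} X} (e : E ≅ E') (x : X.obj) :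
    Function.Bijective (Hom.app e.hom x) :=
  Function.bijective_iff_has_inverse.2 ⟨Hom.app e.inv x,
    fun m => congrArg (fun φ : Hom E E => φ.app x m) e.hom_inv_id,
    fun m => congrArg (fun φ : Hom E' E' => φ.app x m) e.inv_hom_id⟩

lemma OMod.IsSheafAt.of_iso {E E' : OMod.{t} X} (e : E ≅ E') {x : X.obj} (h : E.IsSheafAt x) :
    E'.IsSheafAt x := by
  intro R hR s hs
  have h₁ (y : X.obj) (m) : Hom.app e.hom y (Hom.app e.inv y m) = m :=
    congrArg (fun φ : Hom E' E' => φ.app y m) e.inv_hom_id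
  obtain ⟨m, hm, hm'⟩ := h R hR (fun y f hf => Hom.app e.inv y (s f hf))
    (fun y z f hf g => by rw [← hs f hf g, ← Hom.naturality])
  refine ⟨Hom.app e.hom x m, fun y f hf => ?_, fun m' h₂ => ?_⟩
  · rw [← Hom.naturality, hm f hf, h₁]
  · rw [← hm' (Hom.app e.inv x m') fun y f hf => by rw [← Hom.naturality, h₂ f hf], h₁]

lemma OMod.IsLocallyFreeAt.of_iso {E E' : OMod.{t} X} (e : E ≅ E') {x : X.obj}
    (h : E.IsLocallyFreeAt x) : E'.IsLocallyFreeAt x := by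
  obtain ⟨R, hR, H⟩ := h
  refine ⟨R, hR, fun y f hf => ?_⟩
  obtain ⟨n, b, hb⟩ := H f hf
  refine ⟨n, fun i => Hom.app e.hom y (b i), fun z g => ?_⟩
  simp only [← Hom.naturality]
  exact (hb g).transport (RingHom.id _) Function.bijective_id (Hom.app e.hom z).toAddMonoidHom
    (iso_app_bijective e z) fun r m => (Hom.app e.hom z).map_smul r m

end

section

variable {S : Scheme.{u}} {X : BasedCategory.{v, w} (AffOver S)}
  {Y : BasedCategory.{v₁, w₁} (AffOver S)} {Z : BasedCategory.{v₂, w₂} (AffOver S)}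

/-! ### The prestacks of vector bundles and of arrow bundles -/

namespace PullIso

/-- Pullback isomorphisms can be divided on the right, by composing with the inverse of the pullback
of `a`. With `comp_right_cancel`, this makes all morphisms of `Bun X` cartesian. -/
lemma exists_div {U V W : AffOver S} {f : V ⟶ W} {k : U ⟶ W} {E : OMod.{t} (affProd U X)}
    {E' : OMod.{t} (affProd V X)} {E'' : OMod.{t} (affProd W X)} (a : PullIso f E'' E')
    (c : PullIso k E'' E) (g : U ⟶ V) (h : g ≫ f = k) :
    ∃ b : PullIso g E' E, (b.comp a).Eqv c := by
  subst h
  refine ⟨(OMod.pullbackIso (affProdMap g X) a).symm ≪≫ (basePullbackComp g f E'').symm ≪≫ c,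
    rfl, fun y m => ?_⟩
  rw [res_self _ _ rfl]
  refine congrArg (fun b : PullIso (g ≫ f) E'' E => b.app y m) (?_ : comp _ a = c)
  unfold comp
  simp

lemma comp_right_cancel {U V W : AffOver S} {f : V ⟶ W} {g : U ⟶ V} {E : OMod.{t} (affProd U X)}
    {E' : OMod.{t} (affProd V X)} {E'' : OMod.{t} (affProd W X)} (a : PullIso f E'' E')
    {b b' : PullIso g E' E} (h : b.comp a = b'.comp a) : b = b' := by
  have := congrArg (fun k => (OMod.pullbackIso (affProdMap g X) a).symm ≪≫
    (basePullbackComp g f E'').symm ≪≫ k) h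
  unfold comp at this
  simpa using this

lemma app_bijective {U V : AffOver S} {f : U ⟶ V} {E : OMod.{t} (affProd U X)}
    {E' : OMod.{t} (affProd V X)} (a : PullIso f E' E) (y : AffProdObj U X) :
    Function.Bijective (a.app y) :=
  OMod.iso_app_bijective (E := basePullback f E') a y

end PullIso

lemma OMod.IsVect.basePullback (hX : IsCart X) {U V : AffOver S} (f : U ⟶ V)
    {E : OMod.{t} (affProd V X)} (h : E.IsVect) : (ArrowBundle.basePullback f E).IsVect :=
  h.pullback (hX.affProd U) (hX.affProd V) (affProdMap f X)

lemma Bun.isCart (hX : IsCart X) : IsCart (Bun X) where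
  lift {b V} f := ⟨⟨V, basePullback f (BunObj.E b), (BunObj.isVect b).basePullback hX f⟩,
    ⟨f, Iso.refl _⟩, rfl, (Category.id_comp f).symm⟩
  fill {a b c} φ ψ g hg := by
    obtain ⟨β, hβ⟩ := PullIso.exists_div (BunHom.iso φ) (BunHom.iso ψ) g hg
    exact ⟨⟨g, β⟩, rfl, BunHom.ext' hβ⟩
  uniq {a b c} φ χ χ' e e' := by
    obtain ⟨f, χ⟩ := χ
    obtain ⟨f', χ'⟩ := χ'
    obtain rfl : f = f' := e
    have h : BunHom.mk (f ≫ BunHom.base φ) (χ.comp (BunHom.iso φ)) =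
      BunHom.mk (f ≫ BunHom.base φ) (χ'.comp (BunHom.iso φ)) := e'
    injection h with _ h
    exact congrArg (BunHom.mk f) (PullIso.comp_right_cancel _ h)

lemma ArrBun.isCart (hX : IsCart X) : IsCart (ArrBun X) where
  lift {b V} f := ⟨⟨V, basePullback f (ArrObj.E b), basePullback f (ArrObj.F b),
    (ArrObj.isVect_E b).basePullback hX f, (ArrObj.isVect_F b).basePullback hX f,
    OMod.pullbackMap (affProdMap f X) (ArrObj.s b)⟩,
    ⟨f, Iso.refl _, Iso.refl _, rfl⟩, rfl, (Category.id_comp f).symm⟩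
  fill {x y z} φ ψ g hg := by
    obtain ⟨α, h, hα⟩ := PullIso.exists_div (ArrHom.a φ) (ArrHom.a ψ) g hg
    obtain ⟨β, h', hβ⟩ := PullIso.exists_div (ArrHom.b φ) (ArrHom.b ψ) g hg
    refine ⟨⟨g, α, β, OMod.Hom.ext' fun q m => ?_⟩, rfl, ArrHom.ext' ⟨h, hα⟩ ⟨h', hβ⟩⟩
    obtain ⟨f, a, b, hab⟩ := φ
    obtain ⟨f', a', b', hab'⟩ := ψ
    dsimp only at α β h hα h' hβ
    subst h
    -- Since `a` is bijective on sections, the square may be tested on its image, where it follows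
    -- from the squares of `φ` and `ψ`.
    obtain ⟨m, rfl⟩ := (PullIso.app_bijective a ⟨q.pt, q.str ≫ g⟩).2 m
    have e : (q.str ≫ g) ≫ f = q.str ≫ g ≫ f := Category.assoc _ _ _
    have h₁ (m') : α.app q (a.app ⟨q.pt, q.str ≫ g⟩ (x.E.res (affProdEq e) m')) = a'.app q m' := by
      rw [← hα, PullIso.comp_app, PullIso.res_self _ _ rfl]
    have h₂ (m') : β.app q (b.app ⟨q.pt, q.str ≫ g⟩ (x.F.res (affProdEq e) m')) = b'.app q m' := by
      rw [← hβ, PullIso.comp_app, PullIso.res_self _ _ rfl]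
    obtain ⟨m', rfl⟩ : ∃ m', x.E.res (affProdEq e) m' = m :=
      ⟨x.E.res (affProdEq e.symm) m, by
        rw [PullIso.res_res _ _ _ (𝟙 _) (Category.comp_id _), PullIso.res_self _ _ rfl]⟩
    change β.app q (y.app ⟨q.pt, q.str ≫ g⟩ (a.app ⟨q.pt, q.str ≫ g⟩ _)) =
      z.app q (α.app q (a.app ⟨q.pt, q.str ≫ g⟩ _))
    have c₁ := ArrHom.comm_app ⟨f, a, b, hab⟩ ⟨q.pt, q.str ≫ g⟩ (x.E.res (affProdEq e) m')
    have c₂ := ArrHom.comm_app ⟨g ≫ f, a', b', hab'⟩ q m'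
    dsimp only at c₁ c₂
    rw [h₁, ← c₁, ← c₂, ArrObj.app_res, h₂]
  uniq {a b c} φ χ χ' e e' := by
    obtain ⟨f, χ₁, χ₂, hχ⟩ := χ
    obtain ⟨f', χ₁', χ₂', hχ'⟩ := χ'
    obtain rfl : f = f' := e
    have h₁ : χ₁.comp (ArrHom.a φ) = χ₁'.comp (ArrHom.a φ) := by
      injection e' with _ h
    have h₂ : χ₂.comp (ArrHom.b φ) = χ₂'.comp (ArrHom.b φ) := by
      injection e' with _ _ h
    obtain rfl := PullIso.comp_right_cancel _ h₁
    obtain rfl := PullIso.comp_right_cancel _ h₂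
    rfl

lemma BGL.isCart (S : Scheme.{u}) : IsCart (BGL S) := Bun.isCart (terminal.isCart S)

lemma BX.isCart (hX : IsCart X) : IsCart (BX X) := (IsCart.map (BGL.isCart S)).prod hX

/-! ### The universal vector bundle -/

/-- A morphism of modules which is bijective on sections is an isomorphism. -/
def OMod.isoOfBijective {E E' : OMod.{t} X} (φ : Hom E E')
    (h : ∀ x, Function.Bijective (φ.app x)) : E ≅ E' where
  hom := φ
  inv :=
    { app := fun x => (LinearEquiv.ofBijective (φ.app x) (h x)).symm
      naturality := fun {x y} f m => by
        refine (LinearEquiv.symm_apply_eq _).2 ?_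
        change _ = φ.app x (E.res f _)
        rw [φ.naturality]
        exact congrArg _ ((LinearEquiv.ofBijective (φ.app y) (h y)).apply_symm_apply m).symm }
  hom_inv_id := Hom.ext' fun x m => (LinearEquiv.ofBijective (φ.app x) (h x)).symm_apply_apply m
  inv_hom_id := Hom.ext' fun x m => (LinearEquiv.ofBijective (φ.app x) (h x)).apply_symm_apply m

/-- The identification of the sections of `E` over `f : V ⟶ U` with those of the universal
vector bundle over `(V, E')`, for a morphism `(V, E') ⟶ (U, E)` over `f`. -/
def univFib {a b : BunObj (terminal S)} (φ : b ⟶ a) (m : a.E.obj ⟨b.base, BunHom.base φ⟩) :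
    b.E.obj ⟨b.base, 𝟙 b.base⟩ :=
  (BunHom.iso φ).app ⟨b.base, 𝟙 b.base⟩ (a.E.res (affProdEq (Category.id_comp _)) m)

lemma univFib_bijective {a b : BunObj (terminal S)} (φ : b ⟶ a) :
    Function.Bijective (univFib φ) := by
  have : IsIso (affProdEq (Category.id_comp (BunHom.base φ)) :
      (⟨b.base, 𝟙 b.base ≫ BunHom.base φ⟩ : AffProdObj a.base (terminal S)) ⟶ _) :=
    (affProdEqIso (Y := terminal S) (Category.id_comp (BunHom.base φ))).isIso_hom
  exact (PullIso.app_bijective (BunHom.iso φ) ⟨b.base, 𝟙 b.base⟩).comp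
    (a.E.res_bijective (affProdEq (Category.id_comp (BunHom.base φ))))

/-- The morphism of `U ×_S S` defined by a composition. -/
abbrev compHom {U V W : AffOver S} {f : U ⟶ V} {g : V ⟶ W} {h : U ⟶ W} (e : f ≫ g = h) :
    (⟨U, h⟩ : AffProdObj W (terminal S)) ⟶ ⟨V, g⟩ :=
  { hom := f, w := e }

/-- The naturality of `univFibIso`: the restriction maps of `E` correspond to those of the universal
bundle. -/
lemma univFib_comp {a b c : BunObj (terminal S)} (φ : c ⟶ b) (ψ : b ⟶ a) (θ : c ⟶ a)
    (h : φ ≫ ψ = θ) (e : BunHom.base φ ≫ BunHom.base ψ = BunHom.base θ)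
    (m : a.E.obj ⟨b.base, BunHom.base ψ⟩) :
    univFib θ (a.E.res (compHom e) m) = univRes φ (univFib ψ m) := by
  subst h
  unfold univFib univRes
  rw [← PullIso.naturality]
  refine (PullIso.comp_app (BunHom.iso φ) (BunHom.iso ψ) _ _).trans ?_
  refine congrArg (fun l => PullIso.app (BunHom.iso φ) ⟨c.base, 𝟙 c.base⟩
    (PullIso.app (BunHom.iso ψ) ⟨c.base, 𝟙 c.base ≫ BunHom.base φ⟩ l)) ?_
  let k : (⟨c.base, (𝟙 c.base ≫ BunHom.base φ) ≫ BunHom.base ψ⟩ : AffProdObj a.base (terminal S)) ⟶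
    ⟨b.base, BunHom.base ψ⟩ := { hom := BunHom.base φ, w := by simp }
  have h₁ := PullIso.res_res a.E (affProdEq (Category.id_comp (BunHom.base φ ≫ BunHom.base ψ)))
    (compHom rfl) (compHom (by simp) : (⟨c.base, 𝟙 c.base ≫ BunHom.base φ ≫ BunHom.base ψ⟩ :
      AffProdObj a.base (terminal S)) ⟶ ⟨b.base, BunHom.base ψ⟩) (Category.id_comp _) m
  refine (congrArg (a.E.res (affProdEq (Category.assoc _ _ _))) h₁).trans ?_
  refine (PullIso.res_res a.E _ _ k (Category.id_comp _) m).trans ?_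
  exact (PullIso.res_res a.E _ _ k (Category.comp_id _) m).symm

lemma univFib_add {a b : BunObj (terminal S)} (φ : b ⟶ a)
    (m m' : a.E.obj ⟨b.base, BunHom.base φ⟩) :
    univFib φ (m + m') = univFib φ m + univFib φ m' := by
  unfold univFib
  rw [map_add]
  exact map_add (OMod.Hom.app (BunHom.iso φ).hom ⟨b.base, 𝟙 b.base⟩) _ _

lemma univFib_smul {a b : BunObj (terminal S)} (φ : b ⟶ a) (r : Fn b.base)
    (m : a.E.obj ⟨b.base, BunHom.base φ⟩) :
    univFib φ ((show O (affProd a.base (terminal S)) ⟨b.base, BunHom.base φ⟩ from r) • m) =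
      (show O (affProd b.base (terminal S)) ⟨b.base, 𝟙 b.base⟩ from r) • univFib φ m := by
  unfold univFib
  rw [LinearMap.map_smulₛₗ]
  refine (PullIso.app_smul _ _ _ _).trans ?_
  exact congrArg (fun s : O (affProd b.base (terminal S)) ⟨b.base, 𝟙 b.base⟩ =>
    s • univFib φ m) (Fn.map_id _ r)

/-- The functor which maps a morphism `(V, E') ⟶ (U, E)` to the underlying morphism `V ⟶ U`. -/
def BGL.sliceBase (a : BunObj (terminal S)) :
    BasedFunctor (slice (BGL S) a) (affProd a.base (terminal S)) where
  obj y := ⟨BunObj.base y.left, BunHom.base y.hom⟩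
  map {y z} f := compHom (f := BunHom.base f.left) (congrArg BunHom.base (Over.w f))
  w := rfl

/-- The pullback of `E` to the slice over `(U, E)` is the restriction of the universal vector
bundle. -/
def univFibIso (a : BunObj (terminal S)) :
    OMod.pullback (BGL.sliceBase a) a.E ≅ (univBundle S).restrict a :=
  OMod.isoOfBijective
    { app := fun y =>
        { toFun := univFib y.hom
          map_add' := univFib_add y.hom
          map_smul' := fun r m => by
            refine (congrArg (fun s => univFib y.hom
              ((show O (affProd a.base (terminal S)) ⟨BunObj.base y.left, BunHom.base y.hom⟩ from s)
                • (show a.E.obj ⟨BunObj.base y.left, BunHom.base y.hom⟩ from m)))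
                (Fn.map_id _ r)).trans ((univFib_smul y.hom r m).trans ?_)
            exact congrArg (fun s : O (affProd (BunObj.base y.left) (terminal S))
              ⟨BunObj.base y.left, 𝟙 (BunObj.base y.left)⟩ => s • univFib y.hom m)
              (Fn.map_id _ r).symm }
      naturality := fun {y z} f m => univFib_comp f.left z.hom y.hom (Over.w f) _ m }
    fun y => univFib_bijective y.hom

/-- On the slice over `a = (U, E)` the universal bundle is the pullback of `E`, hence a vector
bundle. The conditions at `a` descend along `slice.forget`, which sends the object `𝟙 a` of the
slice to `a`. -/
lemma univBundle.isVect (S : Scheme.{u}) : (univBundle S).IsVect := by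
  rw [OMod.isVect_iff]
  intro a
  have ha := (BunObj.isVect a).pullback ((BGL.isCart S).slice a)
    ((terminal.isCart S).affProd _) (BGL.sliceBase a)
  rw [OMod.isVect_iff] at ha
  obtain ⟨h₁, h₂⟩ := ha (Over.mk (𝟙 a))
  exact ⟨(h₁.of_iso (univFibIso a)).of_pullback ((BGL.isCart S).slice a) (BGL.isCart S),
    (OMod.isLocallyFreeAt_pullback_iff ((BGL.isCart S).slice a) (BGL.isCart S)
      (slice.forget (BGL S) a) _).1 (h₂.of_iso (univFibIso a))⟩

lemma univE.isVect (hX : IsCart X) : (univE X).IsVect :=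
  (univBundle.isVect S).pullback (BX.isCart hX) (BGL.isCart S) _

end

section

variable {S : Scheme.{u}} {X : BasedCategory.{v, w} (AffOver S)}

/-! ### Local morphisms of modules -/

namespace OMod

variable {E : OMod.{t₁} X} {F : OMod.{t₂} X}

/-- The slice has the same base functor as `X` after forgetting, so the two actions differ only by
`Fn.map` of an identity. -/
lemma restrict_smul (E : OMod.{t} X) {x y : X.obj} (f : y ⟶ x) (r : O X y) (m : E.obj y) :
    @HSMul.hSMul (O (slice X x) (Over.mk f)) ((E.restrict x).obj (Over.mk f))
      ((E.restrict x).obj (Over.mk f)) _ r m = (r • m : E.obj y) :=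
  congrArg (fun s : O X y => s • m) (Fn.map_id _ r)

/-- The morphism `E(y) ⟶ F(y)` given by a morphism `E|_x ⟶ F|_x` and `f : y ⟶ x`. -/
def Hom.at {x y : X.obj} (φ : Hom (E.restrict x) (F.restrict x)) (f : y ⟶ x) :
    E.obj y →ₗ[O X y] F.obj y where
  toFun m := φ.app (Over.mk f) m
  map_add' m m' := map_add (φ.app (Over.mk f)) m m'
  map_smul' r m := (congrArg (φ.app (Over.mk f)) (E.restrict_smul f r m)).symm.trans
    (((φ.app (Over.mk f)).map_smul r m).trans (F.restrict_smul f r _))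

lemma Hom.at_res {x y z : X.obj} (φ : Hom (E.restrict x) (F.restrict x)) (f : y ⟶ x) (g : z ⟶ y)
    (m : E.obj y) : φ.at (g ≫ f) (E.res g m) = F.res g (φ.at f m) :=
  φ.naturality (Over.homMk g : Over.mk (g ≫ f) ⟶ Over.mk f) m

lemma Hom.ext_at {x : X.obj} {φ ψ : Hom (E.restrict x) (F.restrict x)}
    (h : ∀ ⦃y : X.obj⦄ (f : y ⟶ x) (m : E.obj y), φ.at f m = ψ.at f m) : φ = ψ :=
  Hom.ext' fun y m => h y.hom m

/-- The construction of a morphism `E|_x ⟶ F|_x` from morphisms `E(y) ⟶ F(y)`. -/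
def Hom.mkAt {x : X.obj} (φ : ∀ ⦃y : X.obj⦄ (_ : y ⟶ x), E.obj y →ₗ[O X y] F.obj y)
    (h : ∀ ⦃y z : X.obj⦄ (f : y ⟶ x) (g : z ⟶ y) (m : E.obj y),
      φ (g ≫ f) (E.res g m) = F.res g (φ f m)) : Hom (E.restrict x) (F.restrict x) where
  app y :=
    { toFun := fun m => φ y.hom m
      map_add' := map_add (φ y.hom)
      map_smul' := fun r m => (congrArg (φ y.hom) (E.restrict_smul y.hom r m)).trans
        (((φ y.hom).map_smul r m).trans (F.restrict_smul y.hom r _).symm) }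
  naturality {y z} f m := by
    refine Eq.trans ?_ (h z.hom f.left m)
    exact congrArg (fun k => φ k (E.res f.left m)) (Over.w f).symm

lemma Hom.at_add {x y : X.obj} (φ ψ : Hom (E.restrict x) (F.restrict x)) (f : y ⟶ x)
    (m : E.obj y) : (φ + ψ).at f m = φ.at f m + ψ.at f m := rfl

lemma Hom.at_smul {x y : X.obj} (r : O X x) (φ : Hom (E.restrict x) (F.restrict x)) (f : y ⟶ x)
    (m : E.obj y) : (r • φ).at f m = O.res f r • φ.at f m :=
  congrArg (fun s : O X y => s • φ.at f m) (Fn.map_id _ (O.res f r))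

/-- The evaluation of local morphisms, as a homomorphism of groups. -/
def Hom.atHom {x y : X.obj} (f : y ⟶ x) (m : E.obj y) :
    Hom (E.restrict x) (F.restrict x) →+ F.obj y where
  toFun φ := φ.at f m
  map_zero' := rfl
  map_add' φ ψ := φ.at_add ψ f m

lemma Hom.at_sum {x y : X.obj} {ι : Type*} (s : Finset ι)
    (φ : ι → Hom (E.restrict x) (F.restrict x)) (f : y ⟶ x) (m : E.obj y) :
    (∑ i ∈ s, φ i).at f m = ∑ i ∈ s, (φ i).at f m :=
  map_sum (Hom.atHom f m) φ s

/-- The restriction of local morphisms. -/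
abbrev Hom.res {x y : X.obj} (f : y ⟶ x) (φ : Hom (E.restrict x) (F.restrict x)) :
    Hom (E.restrict y) (F.restrict y) := Hom.restrict f φ

lemma Hom.res_at {x y z : X.obj} (f : y ⟶ x) (φ : Hom (E.restrict x) (F.restrict x)) (g : z ⟶ y)
    (m : E.obj z) : (Hom.res f φ).at g m = φ.at (g ≫ f) m := rfl

lemma Hom.at_congr {x y : X.obj} (φ : Hom (E.restrict x) (F.restrict x)) {f g : y ⟶ x}
    (h : f = g) (m : E.obj y) : φ.at f m = φ.at g m := by
  rw [h]

/-! ### Local dual bases -/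

/-- A linear functional on `P|_x`. -/
abbrev Functional (P : OMod.{t} X) (x : X.obj) := Hom (P.restrict x) ((unit X).restrict x)

/-- The value of a functional, as a function. -/
abbrev Functional.val {P : OMod.{t} X} {x y : X.obj} (l : Functional P x) (f : y ⟶ x)
    (m : P.obj y) : O X y := Hom.at l f m

lemma Functional.val_res {P : OMod.{t} X} {x y z : X.obj} (l : Functional P x) (f : y ⟶ x)
    (g : z ⟶ y) (m : P.obj y) : l.val (g ≫ f) (P.res g m) = O.res g (l.val f m) :=
  Hom.at_res l f g m

lemma Functional.val_smul {P : OMod.{t} X} {x y : X.obj} (l : Functional P x) (f : y ⟶ x)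
    (r : O X y) (m : P.obj y) : l.val f (r • m) = r * l.val f m :=
  (Hom.at l f).map_smul r m

lemma Functional.val_sum {P : OMod.{t} X} {x y : X.obj} (l : Functional P x) (f : y ⟶ x)
    {ι : Type*} (s : Finset ι) (m : ι → P.obj y) :
    l.val f (∑ i ∈ s, m i) = ∑ i ∈ s, l.val f (m i) :=
  map_sum (Hom.at l f) m s

/-- A dual basis over `y`: elements `e i` and functionals `e' i` with `∑ e' i (m) • e i = m`. -/
def IsDualBasis {P : OMod.{t} X} {y : X.obj} {ι : Type} [Fintype ι] (e : ι → P.obj y)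
    (e' : ι → Functional P y) : Prop :=
  ∀ ⦃z : X.obj⦄ (g : z ⟶ y) (m : P.obj z), ∑ i, (e' i).val g m • P.res g (e i) = m

/-- The existence of dual bases over a covering of `x`. -/
def HasDualBasisAt (P : OMod.{t} X) (x : X.obj) : Prop :=
  ∃ R : Sieve x, IsCovering R ∧ ∀ ⦃y : X.obj⦄ (f : y ⟶ x), R f →
    ∃ (ι : Type) (_ : Fintype ι) (e : ι → P.obj y) (e' : ι → Functional P y), IsDualBasis e e'

/-- The functionals are the coordinates; uniqueness of coordinates makes them linear and compatible
with restriction. -/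
lemma exists_dualBasis {P : OMod.{t} X} {y : X.obj} {n : ℕ} (e : Fin n → P.obj y)
    (he : ∀ ⦃z : X.obj⦄ (g : z ⟶ y), IsBasisFamily (O X z) (fun i => P.res g (e i))) :
    ∃ e' : Fin n → Functional P y, IsDualBasis e e' := by
  choose c hc hc' using fun (z : X.obj) (g : z ⟶ y) (m : P.obj z) => he g m
  refine ⟨fun i => Hom.mkAt (fun z g =>
    { toFun := fun m => c z g m i
      map_add' := fun m m' => ?_
      map_smul' := fun r m => ?_ }) fun z z' g h m => ?_, fun z g m => hc z g m⟩
  · refine (congrFun (hc' z g (m + m') (c z g m + c z g m') ?_) i).symm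
    simp only [Pi.add_apply, add_smul, Finset.sum_add_distrib]
    rw [hc, hc]
  · refine (congrFun (hc' z g (r • m) (r • c z g m) ?_) i).symm
    simp only [Pi.smul_apply, smul_eq_mul, mul_smul]
    rw [← Finset.smul_sum, hc]
  · refine (congrFun (hc' z' (h ≫ g) (P.res h m) (fun i => O.res h (c z g m i)) ?_) i).symm
    have := congrArg (P.res h) (hc z g m)
    rw [map_sum] at this
    simpa only [LinearMap.map_smulₛₗ, P.res_comp] using this

lemma IsLocallyFreeAt.hasDualBasisAt {P : OMod.{t} X} {x : X.obj} (h : P.IsLocallyFreeAt x) :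
    P.HasDualBasisAt x := by
  obtain ⟨R, hR, H⟩ := h
  refine ⟨R, hR, fun y f hf => ?_⟩
  obtain ⟨n, e, he⟩ := H f hf
  obtain ⟨e', he'⟩ := exists_dualBasis e he
  exact ⟨Fin n, inferInstance, e, e', he'⟩

end OMod

/-- The local character of the étale topology, tested on scheme morphisms that factor through
members of `R`. -/
lemma isCovering_transitive {x : X.obj} {R R' : Sieve x} (hR : IsCovering R)
    (h : ∀ ⦃y : X.obj⦄ (f : y ⟶ x), R f → IsCovering (R'.pullback f)) : IsCovering R' := by
  refine GrothendieckTopology.transitive _ hR _ ?_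
  rintro T _ ⟨y, f, k, hf, rfl⟩
  rw [Sieve.pullback_comp]
  refine GrothendieckTopology.pullback_stable _ k
    (GrothendieckTopology.superset_covering _ ?_ (h f hf))
  rintro T' _ ⟨z, g, k', hg, rfl⟩
  refine ⟨z, g ≫ f, k', hg, ?_⟩
  rw [Functor.map_comp, Category.assoc]

/-- Over a member of `R` the first sieve imposes no condition, so only the pullback of `R'` has to
cover. -/
lemma isCovering_inf (hX : IsCart X) {x : X.obj} {R R' : Sieve x} (hR : IsCovering R)
    (hR' : IsCovering R') : IsCovering (R ⊓ R') :=
  isCovering_transitive hR fun _ f hf =>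
    GrothendieckTopology.superset_covering _
      (Sieve.functorPushforward_monotone _ _ fun _ g hg => ⟨R.downward_closed hf g, hg⟩)
      (isCovering_pullback hX f hR')

/-! ### The internal Hom of vector bundles -/

namespace OMod

variable {E : OMod.{t₁} X} {F : OMod.{t₂} X}

/-- The local morphism `m ↦ l(m) • b`. -/
def Hom.rankOne {y : X.obj} (l : Functional E y) (b : F.obj y) :
    Hom (E.restrict y) (F.restrict y) :=
  Hom.mkAt (fun _ g =>
    { toFun := fun m => l.val g m • F.res g b
      map_add' := fun m m' => by
        rw [show l.val g (m + m') = l.val g m + l.val g m' from map_add (Hom.at l g) m m', add_smul]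
      map_smul' := fun r m => by rw [Functional.val_smul, mul_smul, RingHom.id_apply] })
    fun _ _ g h m => by
      change l.val (h ≫ g) (E.res h m) • F.res (h ≫ g) b = F.res h (l.val g m • F.res g b)
      rw [Functional.val_res, F.res_comp, LinearMap.map_smulₛₗ]

lemma Hom.rankOne_at {y z : X.obj} (l : Functional E y) (b : F.obj y) (g : z ⟶ y) (m : E.obj z) :
    (Hom.rankOne l b).at g m = l.val g m • F.res g b := rfl

/-- The functional `φ ↦ l(φ(e))` on local morphisms. -/
def Functional.entry {y : X.obj} (l : Functional F y) (e : E.obj y) : Functional (ihom E F) y :=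
  Hom.mkAt (E := ihom E F) (fun z g =>
    { toFun := fun φ : Hom (E.restrict z) (F.restrict z) => l.val g (φ.at (𝟙 z) (E.res g e))
      map_add' := fun _ _ => map_add (Hom.at l g) _ _
      map_smul' := fun r (φ : Hom (E.restrict z) (F.restrict z)) => by
        refine (congrArg (l.val g) (Hom.at_smul r φ (𝟙 z) (E.res g e))).trans ?_
        rw [O.res_id, Functional.val_smul]
        rfl })
    fun z z' g h (φ : Hom (E.restrict z) (F.restrict z)) => by
      change l.val (h ≫ g) ((Hom.res h φ).at (𝟙 z') (E.res (h ≫ g) e)) =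
        O.res h (l.val g (φ.at (𝟙 z) (E.res g e)))
      rw [Hom.res_at, ← Functional.val_res, E.res_comp,
        Hom.at_congr φ ((Category.id_comp h).trans (Category.comp_id h).symm), Hom.at_res]

/-- The dual basis consists of the matrix units `m ↦ e'_i(m) b_j` and the matrix entries `φ ↦
b'_j(φ(e_i))`, on a covering where both modules have dual bases. -/
lemma hasDualBasisAt_ihom (hX : IsCart X) {x : X.obj} (hE : E.HasDualBasisAt x)
    (hF : F.HasDualBasisAt x) : (ihom E F).HasDualBasisAt x := by
  obtain ⟨R, hR, H⟩ := hE
  obtain ⟨R', hR', H'⟩ := hF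
  refine ⟨R ⊓ R', isCovering_inf hX hR hR', fun y f hf => ?_⟩
  obtain ⟨ι, _, e, e', he⟩ := H f hf.1
  obtain ⟨κ, _, b, b', hb⟩ := H' f hf.2
  refine ⟨ι × κ, inferInstance, fun i => Hom.rankOne (e' i.1) (b i.2),
    fun i => (b' i.2).entry (e i.1), fun z g (φ : Hom (E.restrict z) (F.restrict z)) =>
      Hom.ext_at fun z' h m => ?_⟩
  have key (i : ι × κ) : (((b' i.2).val g (φ.at (𝟙 z) (E.res g (e i.1))) : O X z) •
      (Hom.res g (Hom.rankOne (e' i.1) (b i.2)) : Hom (E.restrict z) (F.restrict z))).at h m =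
      (e' i.1).val (h ≫ g) m • (b' i.2).val (h ≫ g) (φ.at h (E.res (h ≫ g) (e i.1))) •
        F.res (h ≫ g) (b i.2) := by
    rw [Hom.at_smul, Hom.res_at, Hom.rankOne_at, ← Functional.val_res, ← Hom.at_res, ← E.res_comp,
      Hom.at_congr φ (Category.comp_id h), smul_comm]
  refine (Hom.at_sum _ _ h m).trans ((Finset.sum_congr rfl fun i _ => key i).trans ?_)
  rw [Fintype.sum_prod_type]
  -- Summing over the second index rebuilds `φ(e_i)` from its coordinates; the sum over the first
  -- index is then `φ` applied to the expansion of `m`.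
  simp only [← Finset.smul_sum, hb (h ≫ g) _]
  rw [← congrArg (φ.at h) (he (h ≫ g) m), map_sum]
  exact Finset.sum_congr rfl fun i _ => ((φ.at h).map_smul _ _).symm

lemma isSheafAt_ihom_iff (x : X.obj) : (ihom E F).IsSheafAt x ↔
    ∀ (R : Sieve x) (_ : IsCovering R)
    (s : ∀ ⦃y : X.obj⦄ (f : y ⟶ x), R f → Hom (E.restrict y) (F.restrict y))
    (_ : ∀ ⦃y z : X.obj⦄ (f : y ⟶ x) (hf : R f) (g : z ⟶ y),
      Hom.res g (s f hf) = s (g ≫ f) (R.downward_closed hf g)),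
    ∃! m : Hom (E.restrict x) (F.restrict x),
      ∀ ⦃y : X.obj⦄ (f : y ⟶ x) (hf : R f), Hom.res f m = s f hf := Iff.rfl

lemma IsSheafAt.eq_of_covering {x : X.obj} (hF : F.IsSheafAt x) {R : Sieve x} (hR : IsCovering R)
    {a b : F.obj x} (h : ∀ ⦃y : X.obj⦄ (f : y ⟶ x), R f → F.res f a = F.res f b) : a = b :=
  (hF R hR (fun _ f _ => F.res f b) fun _ _ f _ g => (F.res_comp g f b).symm).unique h
    fun _ _ _ => rfl

/-- Only the target has to be a sheaf. The value of the glued morphism on `m` over `c : z ⟶ x` is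
glued in `F(z)` from the values of the given local morphisms on the restrictions of `m`; linearity
and naturality are checked locally. -/
lemma isSheafAt_ihom (hX : IsCart X) (hF : ∀ x, F.IsSheafAt x) (x : X.obj) :
    (ihom E F).IsSheafAt x := by
  rw [isSheafAt_ihom_iff]
  intro R hR s hs
  -- Compatibility in a form where the composite is a free variable, so that associativity of
  -- composition needs no transport of membership proofs.
  have hs' {y z z' : X.obj} (f : y ⟶ x) (hf : R f) (g : z ⟶ y) (h : z' ⟶ z) (k : z ⟶ x)
      (hk : R k) (e : g ≫ f = k) (m) : (s f hf).at (h ≫ g) m = (s k hk).at h m := by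
    subst e
    exact congrArg (fun φ : Hom (E.restrict z) (F.restrict z) => φ.at h m) (hs f hf g)
  have sep {z : X.obj} (c : z ⟶ x) {a b : F.obj z}
      (h : ∀ ⦃w : X.obj⦄ (k : w ⟶ z), R (k ≫ c) → F.res k a = F.res k b) : a = b :=
    (hF z).eq_of_covering (isCovering_pullback hX c hR) h
  -- The characterisation of `a` again allows any name `l` for the composite `k ≫ c`, for the same
  -- reason.
  have glue {z : X.obj} (c : z ⟶ x) (m : E.obj z) : ∃ a : F.obj z, ∀ ⦃w : X.obj⦄ (k : w ⟶ z)
      (l : w ⟶ x) (_ : k ≫ c = l) (hl : R l), F.res k a = (s l hl).at (𝟙 w) (E.res k m) := by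
    obtain ⟨a, ha⟩ := (hF z (R.pullback c) (isCovering_pullback hX c hR)
      (fun w k (hk : R (k ≫ c)) => (s (k ≫ c) hk).at (𝟙 w) (E.res k m))
      fun w w' k (hk : R (k ≫ c)) g => by
        rw [← Hom.at_res, Hom.at_congr _ ((Category.comp_id g).trans (Category.id_comp g).symm),
          ← E.res_comp]
        exact hs' _ _ _ _ _ _ (Category.assoc _ _ _).symm _).exists
    exact ⟨a, fun w k l e hl => by subst e; exact ha k hl⟩
  choose a ha using @glue
  refine ⟨Hom.mkAt (fun z c =>
    { toFun := a c
      map_add' := fun m m' => sep c fun w k hk => ?_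
      map_smul' := fun r m => sep c fun w k hk => ?_ }) fun y z f g m =>
        sep (g ≫ f) fun w k hk => ?_,
    fun y f hf => Hom.ext_at fun z g m => sep (g ≫ f) fun w k hk => ?_,
    fun ψ hψ => Hom.ext_at fun z g m => sep g fun w k hk => ?_⟩
  · rw [map_add, ha _ _ _ _ rfl hk, ha _ _ _ _ rfl hk, ha _ _ _ _ rfl hk, map_add, map_add]
  · rw [LinearMap.map_smulₛₗ, ha _ _ _ _ rfl hk, ha _ _ _ _ rfl hk, LinearMap.map_smulₛₗ, map_smul]
    rfl
  · change F.res k (a (g ≫ f) (E.res g m)) = F.res k (F.res g (a f m))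
    rw [ha _ _ _ _ rfl hk, ← F.res_comp, ha _ _ _ _ (Category.assoc _ _ _) hk, ← E.res_comp]
  · change F.res k (a (g ≫ f) m) = F.res k ((s f hf).at g m)
    rw [ha _ _ _ _ rfl hk, ← Hom.at_res, ← Hom.at_congr (s f hf) (Category.id_comp (k ≫ g))]
    exact (hs' _ _ _ _ _ _ (Category.assoc _ _ _) _).symm
  · change F.res k (ψ.at g m) = F.res k (a g m)
    rw [ha _ _ _ _ rfl hk, ← Hom.at_res, ← hψ _ hk]
    exact Hom.at_congr ψ (Category.id_comp _).symm _

end OMod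

end

section

variable {S : Scheme.{u}} {X : BasedCategory.{v, w} (AffOver S)}

/-! ### Separatedness of the structure sheaf -/

/-- The morphism to the affine line (over the integers) defined by a function. -/
def toLine {T : Scheme.{u}} (r : Γ(T, ⊤)) :
    T ⟶ Spec (CommRingCat.of (Polynomial (ULift.{u} ℤ))) :=
  T.toSpecΓ ≫ Spec.map (CommRingCat.ofHom
    (Polynomial.eval₂RingHom ((Int.castRingHom Γ(T, ⊤)).comp
      (ULift.ringEquiv (R := ℤ)).toRingHom) r))

lemma comp_toLine {T T' : Scheme.{u}} (f : T ⟶ T') (r : Γ(T', ⊤)) :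
    f ≫ toLine r = toLine (f.appTop.hom r) := by
  unfold toLine
  rw [Scheme.toSpecΓ_naturality_assoc, ← Spec.map_comp, ← CommRingCat.ofHom_hom f.appTop,
    ← CommRingCat.ofHom_comp]
  congr 3
  refine Polynomial.ringHom_ext' (RingHom.ext fun a => ?_) ?_ <;>
  simp [-Polynomial.eval₂_C, -Polynomial.eval₂_X, Polynomial.eval₂_C, Polynomial.eval₂_X,
    -CommRingCat.ofHom_hom]

/-- For affine `T` the morphism `T.toSpecΓ` can be cancelled, and the function is the image of the
variable `X` of the polynomial ring. -/
lemma toLine_injective {T : Scheme.{u}} [IsAffine T] :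
    Function.Injective (toLine (T := T)) := by
  intro r r' h
  have h₁ := Spec.map_injective ((cancel_epi T.toSpecΓ).1 h)
  have h₂ := congrArg (fun φ => CommRingCat.Hom.hom φ Polynomial.X) h₁
  exact (Polynomial.eval₂_X _ _).symm.trans (h₂.trans (Polynomial.eval₂_X _ _))

/-- The étale topology is contained in the pro-étale topology, which is subcanonical. -/
instance : Scheme.etaleTopology.{u}.Subcanonical :=
  .of_le Scheme.etaleTopology_le_proetaleTopology

/-- Functions are morphisms to the affine line, and a representable presheaf is a sheaf for the
étale topology. Only separatedness is needed. -/
lemma O.eq_of_covering {x : X.obj} {R : Sieve x} (hR : IsCovering R) {r r' : O X x}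
    (h : ∀ ⦃y : X.obj⦄ (f : y ⟶ x), R f → O.res f r = O.res f r') : r = r' := by
  have := (X.p.obj x).property
  have : IsAffine ((X.p ⋙ AffOver.toScheme S).obj x) := (X.p.obj x).property
  refine toLine_injective (T := (X.p ⋙ AffOver.toScheme S).obj x) ?_
  have hs := (GrothendieckTopology.Subcanonical.isSheaf_of_isRepresentable
    (J := Scheme.etaleTopology.{u})
    (yoneda.obj (Spec (CommRingCat.of (Polynomial (ULift.{u} ℤ)))))) _ hR
  refine hs.isSeparatedFor.ext ?_
  rintro T _ ⟨y, f, k, hf, rfl⟩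
  have e := (comp_toLine ((X.p ⋙ AffOver.toScheme S).map f) r).trans
    ((congrArg toLine (h f hf)).trans (comp_toLine ((X.p ⋙ AffOver.toScheme S).map f) r').symm)
  exact (Category.assoc _ _ _).trans ((congrArg (k ≫ ·) e).trans (Category.assoc _ _ _).symm)

/-! ### Reflexivity -/

namespace OMod

/-- A sheaf of modules with local dual bases. -/
structure IsLocallyProjective (P : OMod.{t} X) : Prop where
  isSheafAt (x : X.obj) : P.IsSheafAt x
  hasDualBasisAt (x : X.obj) : P.HasDualBasisAt x

lemma IsVect.isLocallyProjective {P : OMod.{t} X} (h : P.IsVect) : P.IsLocallyProjective where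
  isSheafAt x := ((isVect_iff P).1 h x).1
  hasDualBasisAt x := ((isVect_iff P).1 h x).2.hasDualBasisAt

lemma IsLocallyProjective.ihom (hX : IsCart X) {E : OMod.{t₁} X} {F : OMod.{t₂} X}
    (hE : E.IsLocallyProjective) (hF : F.IsLocallyProjective) :
    (OMod.ihom E F).IsLocallyProjective where
  isSheafAt := isSheafAt_ihom hX hF.isSheafAt
  hasDualBasisAt x := hasDualBasisAt_ihom hX (hE.hasDualBasisAt x) (hF.hasDualBasisAt x)

variable {P : OMod.{t} X}

/-- Locally an element is recovered from its values under the functionals of a dual basis, and `P`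
is separated. -/
lemma IsLocallyProjective.eq_of_functional (hP : P.IsLocallyProjective) {x : X.obj}
    {p p' : P.obj x} (h : ∀ ⦃y : X.obj⦄ (f : y ⟶ x) (l : Functional P y),
      l.val (𝟙 y) (P.res f p) = l.val (𝟙 y) (P.res f p')) : p = p' := by
  obtain ⟨R, hR, H⟩ := hP.hasDualBasisAt x
  refine (hP.isSheafAt x).eq_of_covering hR fun y f hf => ?_
  obtain ⟨ι, _, e, e', he⟩ := H f hf
  rw [← he (𝟙 y) (P.res f p), ← he (𝟙 y) (P.res f p')]
  exact Finset.sum_congr rfl fun i _ => by rw [h]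

/-- A functional on the dual of `P`. -/
abbrev BiFunctional (P : OMod.{t} X) (x : X.obj) := Functional P.dual x

/-- The value of a functional on the dual of `P`. -/
abbrev BiFunctional.val {x y : X.obj} (φ : BiFunctional P x) (f : y ⟶ x) (l : Functional P y) :
    O X y := Functional.val (P := P.dual) φ f l

lemma BiFunctional.val_res {x y z : X.obj} (φ : BiFunctional P x) (f : y ⟶ x) (g : z ⟶ y)
    (l : Functional P y) : φ.val (g ≫ f) (Hom.res g l) = O.res g (φ.val f l) :=
  Hom.at_res φ f g l

lemma BiFunctional.val_sum_smul {x y : X.obj} (φ : BiFunctional P x) (f : y ⟶ x)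
    {ι : Type*} [Fintype ι] (r : ι → O X y) (l : ι → Functional P y) :
    φ.val f (∑ i, r i • l i) = ∑ i, r i * φ.val f (l i) :=
  (Functional.val_sum φ f _ _).trans
    (Finset.sum_congr rfl fun i _ => Functional.val_smul φ f (r i) (l i))

/-- A dual basis also expands functionals: apply `l` to the expansion of an element `m`. -/
lemma IsDualBasis.eq_sum {y z : X.obj} {ι : Type} [Fintype ι] {e : ι → P.obj y}
    {e' : ι → Functional P y} (he : IsDualBasis e e') (g : z ⟶ y) (l : Functional P z) :
    ∑ i, l.val (𝟙 z) (P.res g (e i)) • (Hom.res g (e' i) : Functional P z) = l := by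
  refine Hom.ext_at fun z' h m => ?_
  refine (Hom.at_sum _ _ h m).trans ?_
  have := congrArg (l.val h) (he (h ≫ g) m)
  rw [Functional.val_sum] at this
  refine Eq.trans ?_ this
  refine Finset.sum_congr rfl fun i _ => (Hom.at_smul _ _ h m).trans ?_
  rw [Functional.val_smul, P.res_comp, ← Functional.val_res, mul_comm,
    show l.val (h ≫ 𝟙 z) _ = l.val h _ from Hom.at_congr l (Category.comp_id h) _]
  rfl

/-- Reflexivity of `P`. Over a covering, `p = ∑ φ(e'_i) e_i` works by `IsDualBasis.eq_sum`; these
elements agree on overlaps because functionals separate elements, so they glue. The resulting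
identity between functions is checked locally. -/
lemma IsLocallyProjective.exists_eval (hX : IsCart X) (hP : P.IsLocallyProjective) {x : X.obj}
    (φ : BiFunctional P x) : ∃ p : P.obj x, ∀ ⦃y : X.obj⦄ (f : y ⟶ x) (l : Functional P y),
      l.val (𝟙 y) (P.res f p) = φ.val f l := by
  obtain ⟨R, hR, H⟩ := hP.hasDualBasisAt x
  have key {y : X.obj} (f : y ⟶ x) (hf : R f) : ∃ s : P.obj y, ∀ ⦃z : X.obj⦄ (g : z ⟶ y)
      (h : z ⟶ x) (_ : g ≫ f = h) (l : Functional P z),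
      l.val (𝟙 z) (P.res g s) = φ.val h l := by
    obtain ⟨ι, _, e, e', he⟩ := H f hf
    refine ⟨∑ i, φ.val f (e' i) • e i, fun z g h hh l => ?_⟩
    subst hh
    rw [map_sum, Functional.val_sum]
    -- Expand the functional to which `φ` is applied; linearity of `φ` then gives the same sum as on
    -- the left.
    nth_rw 2 [← he.eq_sum g l]
    rw [BiFunctional.val_sum_smul]
    refine Finset.sum_congr rfl fun i _ => ?_
    rw [BiFunctional.val_res, LinearMap.map_smulₛₗ, Functional.val_smul, mul_comm]
  choose s hs using @key
  obtain ⟨p, hp, -⟩ := hP.isSheafAt x R hR (fun y f hf => s f hf) fun y z f hf g => by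
    refine hP.eq_of_functional fun z' h l => ?_
    rw [← P.res_comp, hs f hf _ _ rfl, hs _ _ _ _ rfl, Category.assoc]
  refine ⟨p, fun y f l => O.eq_of_covering (isCovering_pullback hX f hR)
    fun z k (hk : R (k ≫ f)) => ?_⟩
  rw [← BiFunctional.val_res, ← Functional.val_res, ← P.res_comp, hp _ hk,
    ← hs (k ≫ f) hk (𝟙 z) _ (Category.id_comp _), P.res_id]
  exact Hom.at_congr l ((Category.comp_id k).trans (Category.id_comp k).symm) _

end OMod

/-! ### Points of the total space -/

namespace RelSpecObj

open OMod

variable {P : OMod.{t} X}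

/-- The homomorphisms from the symmetric algebras of the dual of `P` given by a point of `𝕍 P`. -/
def symHom (a : RelSpecObj (Sym P.dual)) {y : X.obj} (f : y ⟶ a.pt) :
    SymmetricAlgebra (O X y) (P.dual.obj y) →ₐ[O X y] O X y :=
  a.sec (Over.mk f)

/-- The functional on the dual of `P` defined by a point of `𝕍 P`. -/
def functional (a : RelSpecObj (Sym P.dual)) : BiFunctional P a.pt :=
  Hom.mkAt (E := P.dual) (fun _ f =>
    (a.symHom f).toLinearMap.comp (SymmetricAlgebra.ι (O X _) (P.dual.obj _)))
    fun y z f g l => by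
      refine Eq.trans ?_ (a.naturality (Over.homMk g : Over.mk (g ≫ f) ⟶ Over.mk f)
        (SymmetricAlgebra.ι (O X y) (P.dual.obj y) l))
      exact congrArg (a.symHom (g ≫ f)) (symMap_ι (P.dual.res g) l).symm

lemma functional_val (a : RelSpecObj (Sym P.dual)) {y : X.obj} (f : y ⟶ a.pt)
    (l : Functional P y) : a.functional.val f l =
      a.symHom f (SymmetricAlgebra.ι (O X y) (P.dual.obj y) l) := rfl

/-- The value at `p` of functionals on `P`. -/
def evalAt {x : X.obj} (p : P.obj x) {y : X.obj} (f : y ⟶ x) : P.dual.obj y →ₗ[O X y] O X y where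
  toFun l := Functional.val (P := P) l (𝟙 y) (P.res f p)
  map_add' _ _ := rfl
  map_smul' r l := by
    refine (Hom.at_smul (E := P) (F := unit X) r l (𝟙 y) (P.res f p)).trans ?_
    rw [O.res_id]
    rfl

/-- The point of `𝕍 P` defined by a section of `P`. -/
def ofSection {x : X.obj} (p : P.obj x) : RelSpecObj (Sym P.dual) where
  pt := x
  sec y := SymmetricAlgebra.lift (evalAt p y.hom)
  naturality {y z} f a := by
    refine symRingHom_ext
      (f := (SymmetricAlgebra.lift (evalAt p y.hom)).toRingHom.comp (symMap (P.dual.res f.left)))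
      (g := (O.res f.left).comp (SymmetricAlgebra.lift (evalAt p z.hom)).toRingHom)
      (fun r => ?_) (fun l => ?_) a
    · change SymmetricAlgebra.lift _ (symMap _ _) = O.res f.left (SymmetricAlgebra.lift _ _)
      rw [symMap_algebraMap, AlgHom.commutes, AlgHom.commutes]
      rfl
    · change SymmetricAlgebra.lift _ (symMap _ _) = O.res f.left (SymmetricAlgebra.lift _ _)
      rw [symMap_ι, SymmetricAlgebra.lift_ι_apply, SymmetricAlgebra.lift_ι_apply]
      change Functional.val (P := P) (Hom.res f.left l) (𝟙 _) (P.res y.hom p) =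
        O.res f.left (Functional.val (P := P) l (𝟙 _) (P.res z.hom p))
      refine Eq.trans ?_ (Functional.val_res (P := P) l (𝟙 _) f.left (P.res z.hom p))
      rw [← P.res_comp, Over.w f]
      exact Hom.at_congr (E := P) (F := unit X) l
        ((Category.id_comp f.left).trans (Category.comp_id f.left).symm) _

lemma ofSection_functional_val {x : X.obj} (p : P.obj x) {y : X.obj} (f : y ⟶ x)
    (l : Functional P y) : (ofSection p).functional.val f l = l.val (𝟙 y) (P.res f p) :=
  SymmetricAlgebra.lift_ι_apply (evalAt p f) l

/-- An algebra morphism out of a symmetric algebra is determined by its restriction to the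
generating module. -/
lemma symHom_eq_iff (a b : RelSpecObj (Sym P.dual)) {y : X.obj} (f : y ⟶ a.pt) (g : y ⟶ b.pt) :
    a.symHom f = b.symHom g ↔
      ∀ l : Functional P y, a.functional.val f l = b.functional.val g l := by
  constructor
  · intro h l
    rw [functional_val, functional_val]
    exact congrArg (fun k => k (SymmetricAlgebra.ι (O X y) (P.dual.obj y) l)) h
  · intro h
    exact SymmetricAlgebra.algHom_ext (LinearMap.ext h)

variable (hX : IsCart X) (hP : P.IsLocallyProjective)

/-- The section of `P` defined by a point of `𝕍 P`. -/
def toSection (a : RelSpecObj (Sym P.dual)) : P.obj a.pt :=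
  (hP.exists_eval hX a.functional).choose

lemma toSection_spec (a : RelSpecObj (Sym P.dual)) {y : X.obj} (f : y ⟶ a.pt)
    (l : Functional P y) : l.val (𝟙 y) (P.res f (a.toSection hX hP)) = a.functional.val f l :=
  (hP.exists_eval hX a.functional).choose_spec f l

/-- Both elements have the same values under all local functionals, which separate the elements of
`P`. -/
lemma toSection_ofSection {x : X.obj} (p : P.obj x) :
    (ofSection p).toSection hX hP = p :=
  hP.eq_of_functional fun _ f l =>
    ((ofSection p).toSection_spec hX hP f l).trans (ofSection_functional_val p f l)

/-- A morphism between the underlying objects of points of `𝕍 P` is a morphism of points if and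
only if it is compatible with the sections of `P`. -/
lemma forall_sec_eq_iff (a b : RelSpecObj (Sym P.dual)) (f : a.pt ⟶ b.pt) :
    (∀ y : Over a.pt, b.sec ((Over.map f).obj y) = a.sec y) ↔
      P.res f (b.toSection hX hP) = a.toSection hX hP := by
  constructor
  · intro h
    refine hP.eq_of_functional fun y g l => ?_
    rw [← P.res_comp, toSection_spec, toSection_spec]
    exact (symHom_eq_iff b a (g ≫ f) g).1 (h (Over.mk g)) l
  · intro h y
    refine (symHom_eq_iff b a (y.hom ≫ f) y.hom).2 fun l => ?_
    rw [← toSection_spec hX hP, ← toSection_spec hX hP, ← h, P.res_comp]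

end RelSpecObj

end

section

variable {S : Scheme.{u}} {X : BasedCategory.{v, w} (AffOver S)}
  {Y : BasedCategory.{v₁, w₁} (AffOver S)} {B : BasedCategory.{v₂, w₂} (AffOver S)}

/-! ### Extension of morphisms of modules along full and essentially surjective functors -/

namespace OMod

/-- A morphism of pullbacks is linear over the functions on the target. -/
def Hom.overLin {F : BasedFunctor X Y} {P : OMod.{t₁} Y} {Q : OMod.{t₂} Y}
    (s : Hom (pullback F P) (pullback F Q)) (x : X.obj) :
    P.obj (F.obj x) →ₗ[O Y (F.obj x)] Q.obj (F.obj x) where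
  toFun m := s.app x m
  map_add' m m' := map_add (s.app x) m m'
  map_smul' r m := by
    obtain ⟨r, rfl⟩ := (O.comparison_bijective F x).2 r
    exact (s.app x).map_smul r m

lemma Hom.overLin_naturality {F : BasedFunctor X Y} {P : OMod.{t₁} Y} {Q : OMod.{t₂} Y}
    (s : Hom (pullback F P) (pullback F Q)) {x y : X.obj} (k : x ⟶ y) (m : P.obj (F.obj y)) :
    s.overLin x (P.res (F.map k) m) = Q.res (F.map k) (s.overLin y m) :=
  s.naturality k m

/-- The morphism of pullbacks given by linear maps over the functions on the target. -/
def Hom.ofOverLin {F : BasedFunctor X Y} {P : OMod.{t₁} Y} {Q : OMod.{t₂} Y}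
    (s : ∀ x : X.obj, P.obj (F.obj x) →ₗ[O Y (F.obj x)] Q.obj (F.obj x))
    (hs : ∀ ⦃x y : X.obj⦄ (k : x ⟶ y) (m : P.obj (F.obj y)),
      s x (P.res (F.map k) m) = Q.res (F.map k) (s y m)) :
    Hom (pullback F P) (pullback F Q) where
  app x :=
    { toFun := s x
      map_add' := map_add (s x)
      map_smul' := fun r m => (s x).map_smul (O.comparison F x r) m }
  naturality k m := hs k m

variable {P : OMod.{t₁} Y} {Q : OMod.{t₂} Y}

lemma Hom.ext_of_ess {F : BasedFunctor X Y} (hF : IsFullEss F) {φ ψ : Hom P Q}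
    (h : ∀ (x : X.obj) (m : P.obj (F.obj x)), φ.app (F.obj x) m = ψ.app (F.obj x) m) : φ = ψ := by
  refine Hom.ext' fun z m => ?_
  obtain ⟨y, ⟨i⟩⟩ := hF.ess z
  rw [← P.res_iso_eq i m, φ.naturality, ψ.naturality, h]

/-- The conjugate of a linear map of sections by an isomorphism. -/
def conjRes {z z' : Y.obj} (j : z ≅ z') (s : P.obj z' →ₗ[O Y z'] Q.obj z') :
    P.obj z →ₗ[O Y z] Q.obj z where
  toFun m := Q.res j.hom (s (P.res j.inv m))
  map_add' m m' := by rw [map_add, map_add, map_add]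
  map_smul' r m := by
    rw [LinearMap.map_smulₛₗ, map_smul, LinearMap.map_smulₛₗ, ← O.res_comp, Iso.hom_inv_id,
      O.res_id]
    rfl

/-- Fullness writes the morphism between the chosen representatives as some `F.map k`, where `hs`
applies. For `f` an identity this says that the conjugate does not depend on the choice of
representative. -/
lemma conjRes_naturality {F : BasedFunctor X Y} (hF : IsFullEss F)
    {s : ∀ x : X.obj, P.obj (F.obj x) →ₗ[O Y (F.obj x)] Q.obj (F.obj x)}
    (hs : ∀ ⦃x y : X.obj⦄ (k : x ⟶ y) (m : P.obj (F.obj y)),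
      s x (P.res (F.map k) m) = Q.res (F.map k) (s y m))
    {z z' : Y.obj} (f : z ⟶ z') {x x' : X.obj} (j : z ≅ F.obj x) (j' : z' ≅ F.obj x')
    (m : P.obj z') : conjRes j (s x) (P.res f m) = Q.res f (conjRes j' (s x') m) := by
  obtain ⟨k, hk⟩ := hF.full (j.inv ≫ f ≫ j'.hom)
  have e : P.res j.inv (P.res f m) = P.res (F.map k) (P.res j'.inv m) := by
    refine (P.res_comp _ _ _).symm.trans (Eq.trans ?_ (P.res_comp _ _ _))
    exact congrArg (fun l => P.res l m) (by rw [hk]; simp)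
  refine (congrArg (fun l => Q.res j.hom (s x l)) e).trans ?_
  refine (congrArg (Q.res j.hom) (hs k _)).trans ?_
  refine (Q.res_comp _ _ _).symm.trans (Eq.trans ?_ (Q.res_comp _ _ _))
  exact congrArg (fun l => Q.res l (s x' (P.res j'.inv m))) (by rw [hk]; simp)

/-- Each object of `Y` is isomorphic to one in the image, and the extension conjugates `s` by a
chosen such isomorphism. Independence of this choice gives back `s` at `F.obj x`. -/
lemma Hom.exists_extension {F : BasedFunctor X Y} (hF : IsFullEss F)
    (s : ∀ x : X.obj, P.obj (F.obj x) →ₗ[O Y (F.obj x)] Q.obj (F.obj x))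
    (hs : ∀ ⦃x y : X.obj⦄ (k : x ⟶ y) (m : P.obj (F.obj y)),
      s x (P.res (F.map k) m) = Q.res (F.map k) (s y m)) :
    ∃ φ : Hom P Q, ∀ x m, φ.app (F.obj x) m = s x m := by
  choose y i using hF.ess
  refine ⟨⟨fun z => conjRes (i z).some (s (y z)),
    fun f m => conjRes_naturality hF hs f _ _ m⟩, fun x m => ?_⟩
  have h := conjRes_naturality hF hs (𝟙 (F.obj x)) (i (F.obj x)).some (Iso.refl _) m
  rw [P.res_id, Q.res_id] at h
  refine h.trans ((Q.res_id _ _).trans ?_)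
  exact congrArg (s x) (P.res_id _ _)

/-! ### Families of local morphisms -/

variable {G : BasedFunctor X Y}

/-- Up to isomorphism, every morphism to `G x` is some `G.map k`, and compatibility of the family
moves the value there to a value at an identity. -/
lemma Hom.eq_of_families (hX : IsCart X) (hY : IsCart Y)
    {m m' : ∀ x : X.obj, Hom (P.restrict (G.obj x)) (Q.restrict (G.obj x))}
    (hm : ∀ ⦃x y : X.obj⦄ (k : x ⟶ y), Hom.res (G.map k) (m y) = m x)
    (hm' : ∀ ⦃x y : X.obj⦄ (k : x ⟶ y), Hom.res (G.map k) (m' y) = m' x)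
    (h : ∀ x p, (m x).at (𝟙 _) p = (m' x).at (𝟙 _) p) : m = m' := by
  funext x
  refine Hom.ext_at fun z f p => ?_
  obtain ⟨w, k, i, rfl, -⟩ := hX.exists_lift hY G f
  rw [← P.res_iso_eq i p, Hom.at_res, Hom.at_res]
  refine congrArg _ ?_
  rw [← Hom.at_congr (m x) (Category.id_comp (G.map k)),
    ← Hom.at_congr (m' x) (Category.id_comp (G.map k)), ← Hom.res_at, ← Hom.res_at, hm, hm', h]

/-- For each `x`, the maps `s` define a morphism of modules on the slice over `x`, which extends to
the slice over `G x` along the full and essentially surjective `sliceMap G x`. -/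
lemma Hom.exists_family (hX : IsCart X) (hY : IsCart Y)
    (s : ∀ x : X.obj, P.obj (G.obj x) →ₗ[O Y (G.obj x)] Q.obj (G.obj x))
    (hs : ∀ ⦃x y : X.obj⦄ (k : x ⟶ y) (m : P.obj (G.obj y)),
      s x (P.res (G.map k) m) = Q.res (G.map k) (s y m)) :
    ∃ m : ∀ x : X.obj, Hom (P.restrict (G.obj x)) (Q.restrict (G.obj x)),
      (∀ ⦃x y : X.obj⦄ (k : x ⟶ y), Hom.res (G.map k) (m y) = m x) ∧
        ∀ x p, (m x).at (𝟙 _) p = s x p := by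
  have key (x : X.obj) : ∃ φ : Hom (P.restrict (G.obj x)) (Q.restrict (G.obj x)),
      ∀ ⦃y : X.obj⦄ (f : y ⟶ x) (p : P.obj (G.obj y)), φ.at (G.map f) p = s y p := by
    obtain ⟨φ, hφ⟩ := Hom.exists_extension (hX.isFullEss_sliceMap hY G x)
      (P := P.restrict (G.obj x)) (Q := Q.restrict (G.obj x)) (fun y =>
        { toFun := fun m => s y.left m
          map_add' := map_add (s y.left)
          map_smul' := fun r m => (congrArg (s y.left)
            (P.restrict_smul (G.map y.hom) r m)).trans
            (((s y.left).map_smul r m).trans (Q.restrict_smul (G.map y.hom) r _).symm) })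
      (fun y z k m => hs k.left m)
    exact ⟨φ, fun y f p => hφ (Over.mk f) p⟩
  choose m hm using key
  have hm₁ (x : X.obj) (p : P.obj (G.obj x)) : (m x).at (𝟙 _) p = s x p := by
    rw [← hm x (𝟙 x) p]
    exact Hom.at_congr _ (G.map_id x).symm p
  refine ⟨m, fun x y k => Hom.ext_at fun z f p => ?_, hm₁⟩
  obtain ⟨w, l, i, rfl, -⟩ := hX.exists_lift hY G f
  rw [← P.res_iso_eq i p, Hom.at_res, Hom.at_res]
  refine congrArg _ ?_
  rw [Hom.res_at, hm, ← G.map_comp, hm]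

end OMod

/-! ### Families of sections along mapping prestacks -/

/-- The compatible families of sections of `M` along a morphism `U ×_S X → B`. -/
structure Family (M : OMod.{t} B) (a : MapObj X B) where
  val (y : AffProdObj a.base X) : M.obj (a.toFun.obj y)
  res ⦃y z : AffProdObj a.base X⦄ (k : y ⟶ z) : M.res (a.toFun.map k) (val z) = val y

namespace Family

variable {M : OMod.{t} B} {a b c : MapObj X B}

lemma ext_val {m m' : Family M a} (h : ∀ y, m.val y = m'.val y) : m = m' := by
  obtain ⟨m, hm⟩ := m
  obtain ⟨m', hm'⟩ := m'
  obtain rfl : m = m' := funext h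
  rfl

/-- The pullback of families along a morphism of the mapping prestack. -/
def pull (φ : MapHom a b) (m : Family M b) : Family M a where
  val y := M.res (φ.app y) (m.val ⟨y.pt, y.str ≫ φ.base⟩)
  res y z k := by
    rw [← M.res_comp, φ.naturality, M.res_comp, m.res]

lemma pull_id (m : Family M a) : m.pull (𝟙 a : a ⟶ a) = m :=
  ext_val fun y => m.res (affProdEq (by simp))

lemma pull_comp (φ : a ⟶ b) (ψ : b ⟶ c) (m : Family M c) :
    m.pull (φ ≫ ψ) = (m.pull ψ).pull φ := by
  refine ext_val fun y => ?_
  change M.res (MapHom.app (MapHom.comp φ ψ) y) (m.val _) = M.res _ (M.res _ (m.val _))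
  rw [MapHom.comp_app, M.res_comp, M.res_comp, m.res]

end Family

namespace RelSpecObj

open OMod

variable {P : OMod.{t} B}

/-- The morphism to `𝕍 P` defined by a compatible family of sections. -/
def mapObjOfFamily (hB : IsCart B) (hP : P.IsLocallyProjective) (a : MapObj X B)
    (m : Family P a) : MapObj X (totalSpace P) where
  base := a.base
  mor :=
    { obj := fun y => ofSection (m.val y)
      map := fun {y z} k => ⟨a.toFun.map k, (forall_sec_eq_iff hB hP (ofSection (m.val y))
        (ofSection (m.val z)) (a.toFun.map k)).2 (by
          rw [toSection_ofSection, toSection_ofSection]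
          exact m.res k)⟩
      map_id := fun y => RelSpecHom.ext (a.toFun.map_id y)
      map_comp := fun k l => RelSpecHom.ext (a.toFun.map_comp k l)
      w := a.mor.w }

/-- The compatible family of sections defined by a morphism to `𝕍 P`. -/
def family (hB : IsCart B) (hP : P.IsLocallyProjective) (a : MapObj X (totalSpace P)) :
    Family P ((Map.postcomp X (relSpec.proj (Sym P.dual))).obj a) where
  val y := toSection hB hP (a.toFun.obj y)
  res {y z} k := (forall_sec_eq_iff hB hP (a.toFun.obj y) (a.toFun.obj z)
    (RelSpecHom.hom (a.toFun.map k))).1 (RelSpecHom.sec_map (a.toFun.map k))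

lemma family_mapObjOfFamily (hB : IsCart B) (hP : P.IsLocallyProjective) (a : MapObj X B)
    (m : Family P a) (y : AffProdObj a.base X) :
    (family hB hP (mapObjOfFamily hB hP a m)).val y = m.val y :=
  toSection_ofSection hB hP (m.val y)

lemma family_pull (hB : IsCart B) (hP : P.IsLocallyProjective) {a b : MapObj X (totalSpace P)}
    (φ : a ⟶ b) :
    (family hB hP b).pull ((Map.postcomp X (relSpec.proj (Sym P.dual))).map φ) =
      family hB hP a :=
  Family.ext_val fun y => (forall_sec_eq_iff hB hP (a.toFun.obj y) _
    (RelSpecHom.hom (MapHom.app φ y))).1 (RelSpecHom.sec_map (MapHom.app φ y))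

/-- By `forall_sec_eq_iff`, equality of the families at each point is exactly the condition for the
components of `φ` to be morphisms of `𝕍 P`. -/
lemma exists_mapHom (hB : IsCart B) (hP : P.IsLocallyProjective) {a b : MapObj X (totalSpace P)}
    (φ : (Map.postcomp X (relSpec.proj (Sym P.dual))).obj a ⟶
      (Map.postcomp X (relSpec.proj (Sym P.dual))).obj b)
    (h : (family hB hP b).pull φ = family hB hP a) :
    ∃ ψ : a ⟶ b, (Map.postcomp X (relSpec.proj (Sym P.dual))).map ψ = φ := by
  obtain ⟨f, c⟩ := φ
  have hy (y : AffProdObj a.base X) := (forall_sec_eq_iff hB hP (a.toFun.obj y)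
    (b.toFun.obj ⟨y.pt, y.str ≫ f⟩) (c.app y)).2
      (congrArg (fun m : Family P _ => m.val y) h)
  refine ⟨⟨f, ⟨{ app := fun y => ⟨c.app y, hy y⟩
                 naturality := fun y z k => RelSpecHom.ext (c.naturality k) }, fun y => ?_⟩⟩, rfl⟩
  exact isHomLift_id (X := totalSpace P) _ (a.mor.w_obj y) (b.mor.w_obj _)
    (based_app c y)

/-- A morphism of the relative spectrum is a morphism of the base with a property, so the projection
is faithful. -/
lemma postcomp_proj_injective {a b : MapObj X (totalSpace P)} {φ ψ : a ⟶ b}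
    (h : (Map.postcomp X (relSpec.proj (Sym P.dual))).map φ =
      (Map.postcomp X (relSpec.proj (Sym P.dual))).map ψ) : φ = ψ := by
  obtain ⟨f, c⟩ := φ
  obtain ⟨f', c'⟩ := ψ
  obtain rfl : f = f' := congrArg (MapHom.base (a := (Map.postcomp X (relSpec.proj (Sym P.dual))).obj a)
    (b := (Map.postcomp X (relSpec.proj (Sym P.dual))).obj b)) h
  refine MapHom.ext_mk fun y => RelSpecHom.ext ?_
  exact congrArg (fun d => d.toNatTrans.app y) (MapHom.cell_congr h)

end RelSpecObj

end

section

variable {S : Scheme.{u}} {X : BasedCategory.{v, w} (AffOver S)}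
  {Y : BasedCategory.{v₁, w₁} (AffOver S)}

/-! ### Equivalences over `Aff_{/S}` -/

/-- A fully faithful functor over `Aff_{/S}` such that every object of the target is isomorphic,
over an identity, to an object of the image. -/
structure IsBasedEquiv (F : BasedFunctor X Y) : Prop where
  faithful {x y : X.obj} {f g : x ⟶ y} (h : F.map f = F.map g) : f = g
  full {x y : X.obj} (h : F.obj x ⟶ F.obj y) : ∃ f : x ⟶ y, F.map f = h
  ess (z : Y.obj) : ∃ (x : X.obj) (i : F.obj x ≅ z) (e : Y.p.obj (F.obj x) = Y.p.obj z),
    Y.p.map i.hom = eqToHom e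

lemma map_inv_eq_eqToHom {x y : X.obj} (i : x ≅ y) (e : X.p.obj x = X.p.obj y)
    (h : X.p.map i.hom = eqToHom e) : X.p.map i.inv = eqToHom e.symm := by
  rw [← cancel_epi (X.p.map i.hom), ← Functor.map_comp, i.hom_inv_id, h]
  simp

lemma map_eq_of_based_map (F : BasedFunctor X Y) {x y : X.obj} (f : x ⟶ y) :
    X.p.map f = eqToHom (F.w_obj x).symm ≫ Y.p.map (F.map f) ≫ eqToHom (F.w_obj y) := by
  rw [based_map]
  simp

namespace IsBasedEquiv

variable {F : BasedFunctor X Y}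

/-- The usual construction by choice. Since the isomorphisms in `ess` lie over equalities of base
objects, the inverse commutes with the projections strictly, as a based functor must. -/
lemma exists_quasiInverse (hF : IsBasedEquiv F) :
    ∃ G : BasedFunctor Y X, Nonempty (BasedFunctor.comp F G ≅ BasedFunctor.id X) ∧
      Nonempty (BasedFunctor.comp G F ≅ BasedFunctor.id Y) := by
  choose g i e hi using hF.ess
  have hi' (z : Y.obj) := map_inv_eq_eqToHom (i z) (e z) (hi z)
  choose m hm using fun (z z' : Y.obj) (k : z ⟶ z') => hF.full ((i z).hom ≫ k ≫ (i z').inv)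
  let G : BasedFunctor Y X :=
    { obj := g
      map := fun {z z'} k => m z z' k
      map_id := fun z => hF.faithful (by simp [hm])
      map_comp := fun k l => hF.faithful (by simp [hm])
      w := CategoryTheory.Functor.ext (fun z => (F.w_obj (g z)).symm.trans (e z)) fun z z' k => by
        change X.p.map (m z z' k) = _
        rw [map_eq_of_based_map F, hm, Functor.map_comp, Functor.map_comp, hi, hi']
        simp }
  have hm₁ {z z' : Y.obj} (k : z ⟶ z') : F.map (G.map k) = (i z).hom ≫ k ≫ (i z').inv := hm _ _ k
  choose n hn using fun x : X.obj => hF.full (i (F.obj x)).hom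
  choose n' hn' using fun x : X.obj => hF.full (i (F.obj x)).inv
  let a (x : X.obj) : G.obj (F.obj x) ≅ x :=
    { hom := n x
      inv := n' x
      hom_inv_id := hF.faithful (by rw [F.map_comp, hn, hn', F.map_id, Iso.hom_inv_id])
      inv_hom_id := hF.faithful (by rw [F.map_comp, hn, hn', F.map_id, Iso.inv_hom_id]) }
  refine ⟨G, ⟨BasedNatIso.mkNatIso
    (NatIso.ofComponents (F := (BasedFunctor.comp F G).toFunctor)
      (G := (BasedFunctor.id X).toFunctor) a fun {x y} f => hF.faithful ?_) fun x => ?_⟩,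
    ⟨BasedNatIso.mkNatIso
    (NatIso.ofComponents (F := (BasedFunctor.comp G F).toFunctor)
      (G := (BasedFunctor.id Y).toFunctor) i fun {z z'} k => ?_) fun z => ?_⟩⟩
  · refine (F.map_comp _ _).trans (Eq.trans ?_ (F.map_comp _ _).symm)
    change F.map (G.map (F.map f)) ≫ F.map (n y) = F.map (n x) ≫ F.map f
    rw [hm₁, hn, hn]
    simp
  · refine isHomLift_id (X := X) (n x) ((G.w_obj (F.obj x)).trans (F.w_obj x)) rfl ?_
    rw [map_eq_of_based_map F, hn, hi]
    simp
  · change F.map (G.map k) ≫ (i z').hom = (i z).hom ≫ k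
    rw [hm₁]
    simp
  · exact isHomLift_id (X := Y) (i z).hom ((F.w_obj (g z)).trans (G.w_obj z)) rfl (hi z)

/-- A category over `Aff_{/S}` which is equivalent to a prestack is a prestack. -/
lemma isCart (hF : IsBasedEquiv F) (hY : IsCart Y) : IsCart X where
  lift {x V} f := by
    obtain ⟨z, φ, rfl, hφ⟩ := hY.lift (x := F.obj x) (f ≫ eqToHom (F.w_obj x).symm)
    obtain ⟨y, i, e, hi⟩ := hF.ess z
    obtain ⟨ψ, hψ⟩ := hF.full (i.hom ≫ φ)
    refine ⟨y, ψ, (F.w_obj y).symm.trans e, ?_⟩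
    rw [map_eq_of_based_map F, hψ, Functor.map_comp, hi, hφ]
    simp
  fill {x y z} φ ψ g h := by
    obtain ⟨χ, h₁, h₂⟩ := hY.fill (F.map φ) (F.map ψ)
      (eqToHom (F.w_obj z) ≫ g ≫ eqToHom (F.w_obj y).symm) (by
        rw [based_map, based_map, ← h]
        simp)
    obtain ⟨χ, rfl⟩ := hF.full χ
    refine ⟨χ, ?_, hF.faithful ((F.map_comp _ _).trans h₂)⟩
    rw [map_eq_of_based_map F, h₁]
    simp
  uniq {x y z} φ χ χ' h h' := hF.faithful (hY.uniq (F.map φ) (by rw [based_map, based_map, h])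
    (by rw [← F.map_comp, ← F.map_comp, h']))

lemma isFullEss (hF : IsBasedEquiv F) : IsFullEss F where
  ess z := by
    obtain ⟨x, i, -⟩ := hF.ess z
    exact ⟨x, ⟨i.symm⟩⟩
  full h := hF.full h

end IsBasedEquiv

lemma OMod.exists_isoExtension {F : BasedFunctor X Y} (hF : IsFullEss F) {P Q : OMod.{t} Y}
    (σ : pullback F P ≅ pullback F Q) :
    ∃ φ : P ≅ Q, ∀ x m, Hom.app φ.hom (F.obj x) m = Hom.app σ.hom x m := by
  obtain ⟨φ, hφ⟩ := Hom.exists_extension hF (Hom.overLin σ.hom) (fun _ _ => Hom.overLin_naturality σ.hom)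
  obtain ⟨ψ, hψ⟩ := Hom.exists_extension hF (Hom.overLin σ.inv) (fun _ _ => Hom.overLin_naturality σ.inv)
  refine ⟨⟨φ, ψ, Hom.ext_of_ess hF fun x m => ?_, Hom.ext_of_ess hF fun x m => ?_⟩, hφ⟩
  · exact ((congrArg _ (hφ x m)).trans (hψ x _)).trans
      (congrArg (fun c : Hom (pullback F P) (pullback F P) => c.app x m) σ.hom_inv_id)
  · exact ((congrArg _ (hψ x m)).trans (hφ x _)).trans
      (congrArg (fun c : Hom (pullback F Q) (pullback F Q) => c.app x m) σ.inv_hom_id)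

/-! ### Slices of prestacks over affine schemes -/

/-- The functor from the slice over `y` to the affine scheme `p y`. -/
def sliceBase (X : BasedCategory.{v, w} (AffOver S)) {y : X.obj} {U : AffOver S}
    (e : X.p.obj y = U) : BasedFunctor (slice X y) (affProd U (terminal S)) where
  obj l := ⟨X.p.obj l.left, X.p.map l.hom ≫ eqToHom e⟩
  map {l l'} f := compHom (f := X.p.map f.left) (by
    rw [← Category.assoc, ← Functor.map_comp, Over.w])
  map_id _ := AffProdObj.hom_ext (X.p.map_id _)
  map_comp _ _ := AffProdObj.hom_ext (X.p.map_comp _ _)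
  w := rfl

/-- An object over `y` is determined by its base morphism: faithfulness, fullness and essential
surjectivity are the uniqueness of fillers, the existence of fillers and the existence of lifts. -/
lemma IsCart.isBasedEquiv_sliceBase (hX : IsCart X) {y : X.obj} {U : AffOver S}
    (e : X.p.obj y = U) : IsBasedEquiv (sliceBase X e) where
  faithful {l l' f g} h := Over.OverMorphism.ext
    (hX.uniq l'.hom (congrArg AffProdHom.hom h) ((Over.w f).trans (Over.w g).symm))
  full {l l'} h := by
    obtain ⟨q, hq⟩ : ∃ q : X.p.obj l.left ⟶ X.p.obj l'.left, q = h.hom := ⟨_, rfl⟩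
    have hw : q ≫ X.p.map l'.hom ≫ eqToHom e = X.p.map l.hom ≫ eqToHom e := hq ▸ h.w
    obtain ⟨k, hk, hk'⟩ := hX.fill l'.hom l.hom q (by
      rw [← cancel_mono (eqToHom e), Category.assoc, hw])
    exact ⟨Over.homMk k hk', AffProdObj.hom_ext (hk.trans hq)⟩
  ess z := by
    -- The point is split into free variables `V` and `g` so that they can be replaced by the base
    -- of the lift.
    have key (V : AffOver S) (g : V ⟶ U) : ∃ (l : Over y)
        (i : (sliceBase X e).obj l ≅ (⟨V, g⟩ : AffProdObj U (terminal S)))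
        (e' : X.p.obj l.left = V), (ArrowBundle.affProd U (terminal S)).p.map i.hom = eqToHom e' := by
      obtain ⟨x, l, rfl, hl⟩ := hX.lift (x := y) (g ≫ eqToHom e.symm)
      obtain rfl : X.p.map l ≫ eqToHom e = g := by
        rw [hl]
        simp
      exact ⟨Over.mk l, Iso.refl _, rfl, rfl⟩
    exact key z.pt z.str

end

section

variable {S : Scheme.{u}} {T : BasedCategory.{v, w} (AffOver S)}

lemma OMod.res_affProdEq_trans {U : AffOver S} (E : OMod.{t} (affProd U T)) {y : T.obj}
    {f g h : T.p.obj y ⟶ U} (e : f = g) (e' : g = h) (m : E.obj ⟨y, h⟩) :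
    E.res (affProdEq e) (E.res (affProdEq e') m) = E.res (affProdEq (e.trans e')) m :=
  PullIso.res_res E _ _ _ (Category.comp_id _) m

lemma OMod.res_affProdEq_surjective {U : AffOver S} (E : OMod.{t} (affProd U T)) {y : T.obj}
    {f g : T.p.obj y ⟶ U} (e : f = g) : Function.Surjective (E.res (affProdEq e)) := fun m =>
  ⟨E.res (affProdEq e.symm) m, (E.res_affProdEq_trans _ _ m).trans (PullIso.res_self _ _ rfl m)⟩

/-! ### Local models of modules -/

/-- A module on the affine scheme under `y` with an isomorphism of its pullback to the slice
over `y` and the restriction of `M`. -/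
structure LocalModel (M : OMod.{t} T) (y : T.obj) where
  base : AffOver S
  e : T.p.obj y = base
  E : OMod.{t} (affProd base (terminal S))
  iso : OMod.pullback (sliceBase T e) E ≅ M.restrict y

namespace LocalModel

variable {M M' M'' : OMod.{t} T} {x y z : T.obj}

/-- The identification of the sections of a local model with the sections of `M`. -/
def sec (A : LocalModel M y) (l : x ⟶ y)
    (m : A.E.obj ⟨T.p.obj x, T.p.map l ≫ eqToHom A.e⟩) : M.obj x :=
  OMod.Hom.app A.iso.hom (Over.mk l) m

lemma sec_bijective (A : LocalModel M y) (l : x ⟶ y) : Function.Bijective (A.sec l) :=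
  OMod.iso_app_bijective A.iso (Over.mk l)

lemma sec_congr (A : LocalModel M y) {l l' : x ⟶ y} (h : l = l')
    (m : A.E.obj ⟨T.p.obj x, T.p.map l' ≫ eqToHom A.e⟩) :
    A.sec l (A.E.res (affProdEq (by rw [h])) m) = A.sec l' m := by
  subst h
  exact congrArg (A.sec l) (PullIso.res_self _ _ rfl m)

lemma sec_res (A : LocalModel M y) (k : z ⟶ x) (l : x ⟶ y)
    (m : A.E.obj ⟨T.p.obj x, T.p.map l ≫ eqToHom A.e⟩) :
    A.sec (k ≫ l) (A.E.res (compHom (f := T.p.map k) (by simp)) m) = M.res k (A.sec l m) :=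
  OMod.Hom.naturality A.iso.hom (Over.homMk k : Over.mk (k ≫ l) ⟶ Over.mk l) m

/-- An isomorphism of local models lies over an isomorphism `β` of modules. -/
def Compat (A : LocalModel M y) (B : LocalModel M' z) (k : y ⟶ z) (β : OMod.Hom M' M)
    {f : A.base ⟶ B.base} (φ : PullIso f B.E A.E) : Prop :=
  ∀ ⦃x : T.obj⦄ (l : x ⟶ y) (h : (T.p.map l ≫ eqToHom A.e) ≫ f = T.p.map (l ≫ k) ≫ eqToHom B.e)
    (m : B.E.obj ⟨T.p.obj x, T.p.map (l ≫ k) ≫ eqToHom B.e⟩),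
    A.sec l (φ.app ⟨T.p.obj x, T.p.map l ≫ eqToHom A.e⟩ (B.E.res (affProdEq h) m)) =
      β.app x (B.sec (l ≫ k) m)

lemma comp_base {y z : T.obj} {U V : AffOver S} {e : T.p.obj y = U} {e' : T.p.obj z = V}
    {k : y ⟶ z} {f : U ⟶ V} (hf : eqToHom e ≫ f = T.p.map k ≫ eqToHom e') (l : x ⟶ y) :
    (T.p.map l ≫ eqToHom e) ≫ f = T.p.map (l ≫ k) ≫ eqToHom e' := by
  rw [Category.assoc, hf, Functor.map_comp, Category.assoc]

variable {A : LocalModel M y} {B : LocalModel M' z} {k : y ⟶ z} {β : OMod.Hom M' M}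
  {f : A.base ⟶ B.base}

/-- Compatibility fixes `φ` at the points that come from the slice over `y`, and up to isomorphism
these are all points of the affine scheme. -/
lemma Compat.unique (hT : IsCart T) (hf : eqToHom A.e ≫ f = T.p.map k ≫ eqToHom B.e)
    {φ ψ : PullIso f B.E A.E} (hφ : A.Compat B k β φ) (hψ : A.Compat B k β ψ) : φ = ψ := by
  refine Iso.ext (OMod.Hom.ext_of_ess (hT.isBasedEquiv_sliceBase A.e).isFullEss fun l m => ?_)
  have h := comp_base hf l.hom
  obtain ⟨m, rfl⟩ := OMod.res_affProdEq_surjective B.E h m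
  exact (A.sec_bijective l.hom).1 ((hφ l.hom h m).trans (hψ l.hom h m).symm)

lemma Compat.comp {w : T.obj} {C : LocalModel M'' w} {k' : z ⟶ w} {β' : OMod.Hom M'' M'}
    {g : B.base ⟶ C.base} {φ : PullIso f B.E A.E} {ψ : PullIso g C.E B.E}
    (hf : eqToHom A.e ≫ f = T.p.map k ≫ eqToHom B.e)
    (hg : eqToHom B.e ≫ g = T.p.map k' ≫ eqToHom C.e)
    (hφ : A.Compat B k β φ) (hψ : B.Compat C k' β' ψ) :
    A.Compat C (k ≫ k') (β'.comp β) (φ.comp ψ) := by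
  intro x l h m
  have h₁ := comp_base hf l
  have h₂ := comp_base hg (l ≫ k)
  rw [PullIso.comp_app]
  have h₃ : T.p.map ((l ≫ k) ≫ k') ≫ eqToHom C.e = T.p.map (l ≫ k ≫ k') ≫ eqToHom C.e := by simp
  -- Naturality of `ψ` along an equality of structure morphisms moves it to the point to which `hψ`
  -- applies.
  have e : ψ.app ⟨T.p.obj x, (T.p.map l ≫ eqToHom A.e) ≫ f⟩
      (C.E.res (affProdEq (Category.assoc _ f g)) (C.E.res (affProdEq h) m)) =
      B.E.res (affProdEq h₁) (ψ.app ⟨T.p.obj x, T.p.map (l ≫ k) ≫ eqToHom B.e⟩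
        (C.E.res (affProdEq h₂) (C.E.res (affProdEq h₃) m))) := by
    have h₄ : ((T.p.map l ≫ eqToHom A.e) ≫ f) ≫ g = (T.p.map (l ≫ k) ≫ eqToHom B.e) ≫ g :=
      congrArg (· ≫ g) h₁
    rw [← PullIso.naturality]
    refine congrArg (ψ.app ⟨T.p.obj x, (T.p.map l ≫ eqToHom A.e) ≫ f⟩) ?_
    refine (C.E.res_affProdEq_trans _ h m).trans ?_
    refine ((C.E.res_affProdEq_trans h₄ (h₂.trans h₃) m).symm.trans ?_)
    exact congrArg (C.E.res (affProdEq h₄)) (C.E.res_affProdEq_trans h₂ h₃ m).symm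
  rw [e, hφ l h₁, hψ (l ≫ k) h₂]
  exact congrArg (fun s => β.app x (β'.app x s)) (C.sec_congr (Category.assoc l k k') m)

lemma compat_id : A.Compat A (𝟙 y) (OMod.Hom.id M) (basePullbackId A.E) := by
  intro x l h m
  rw [PullIso.id_app]
  exact (congrArg (A.sec l) (PullIso.res_res A.E _ _ (affProdEq (by simp))
    (Category.comp_id _) m)).trans (A.sec_congr (Category.comp_id l).symm m)

/-- The functor between slices induced by `k : y ⟶ z`. -/
def sliceMor (T : BasedCategory.{v, w} (AffOver S)) {y z : T.obj} (k : y ⟶ z) :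
    BasedFunctor (slice T y) (slice T z) where
  toFunctor := Over.map k
  w := rfl

/-- The isomorphism of functors on the slice over `y` induced by `k : y ⟶ z`. -/
def sliceBaseIso {y z : T.obj} {U V : AffOver S} {e : T.p.obj y = U} {e' : T.p.obj z = V}
    {k : y ⟶ z} {f : U ⟶ V} (hf : eqToHom e ≫ f = T.p.map k ≫ eqToHom e') :
    BasedFunctor.comp (sliceMor T k) (sliceBase T e') ≅
      BasedFunctor.comp (sliceBase T e) (affProdMap f (terminal S)) :=
  BasedNatIso.mkNatIso
    (NatIso.ofComponents (F := (BasedFunctor.comp (sliceMor T k) (sliceBase T e')).toFunctor)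
      (G := (BasedFunctor.comp (sliceBase T e) (affProdMap f (terminal S))).toFunctor)
      (fun l => affProdEqIso (comp_base hf l.hom).symm)
      (fun _ => AffProdObj.hom_ext ((Category.comp_id _).trans (Category.id_comp _).symm)))
    fun l => affProdEq_lift (Y := terminal S) (comp_base hf l.hom).symm

/-- On the slice over `y`, conjugate `β` by the isomorphisms of the two models, and extend the
result to the affine scheme along the equivalence `sliceBase`. -/
lemma exists_compat (hT : IsCart T) (hf : eqToHom A.e ≫ f = T.p.map k ≫ eqToHom B.e)
    (β : M' ≅ M) : ∃ φ : PullIso f B.E A.E, A.Compat B k β.hom φ := by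
  -- Pass from `f^* B.E` to the restriction of `M'` through the model `B`, apply `β`, and return to
  -- `A.E` through the model `A`.
  let σ : OMod.pullback (sliceBase T A.e) (basePullback f B.E) ≅
      OMod.pullback (sliceBase T A.e) A.E :=
    (OMod.pullbackComp _ _ B.E).symm ≪≫ OMod.pullbackNatIso (sliceBaseIso hf) B.E ≪≫
      OMod.pullbackComp _ _ B.E ≪≫ OMod.pullbackIso (sliceMor T k) B.iso ≪≫
      (OMod.pullbackComp (sliceMor T k) (slice.forget T z) M').symm ≪≫
      OMod.pullbackIso (slice.forget T y) β ≪≫ A.iso.symm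
  obtain ⟨φ, hφ⟩ := OMod.exists_isoExtension (hT.isBasedEquiv_sliceBase A.e).isFullEss σ
  refine ⟨φ, fun x l h m => ?_⟩
  refine (congrArg (A.sec l) (hφ (Over.mk l) _)).trans ?_
  refine (congrArg (fun c : OMod.Hom (M.restrict y) (M.restrict y) => c.app (Over.mk l) _)
    A.iso.inv_hom_id).trans ?_
  refine congrArg (fun s => OMod.Hom.app β.hom x (B.sec (l ≫ k) s)) ?_
  exact (B.E.res_affProdEq_trans (comp_base hf l).symm h m).trans
    (PullIso.res_self B.E (affProdEq rfl) rfl m)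

end LocalModel

end

section

variable {S : Scheme.{u}} {T : BasedCategory.{v, w} (AffOver S)}

namespace LocalModel

variable {M M' : OMod.{t} T} {y z : T.obj} {A : LocalModel M y} {B : LocalModel M' z}
  {k : y ⟶ z} {β : OMod.Hom M' M}

lemma Compat.eqv (hT : IsCart T) {f g : A.base ⟶ B.base}
    (hf : eqToHom A.e ≫ f = T.p.map k ≫ eqToHom B.e)
    (hg : eqToHom A.e ≫ g = T.p.map k ≫ eqToHom B.e)
    {φ : PullIso f B.E A.E} {ψ : PullIso g B.E A.E} (hφ : A.Compat B k β φ)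
    (hψ : A.Compat B k β ψ) : φ.Eqv ψ := by
  obtain rfl : f = g := (cancel_epi (eqToHom A.e)).1 (hf.trans hg.symm)
  obtain rfl := hφ.unique hT hf hψ
  exact ⟨rfl, fun y m => congrArg (φ.app y) (PullIso.res_self _ _ rfl m)⟩

lemma Compat.congr {f : A.base ⟶ B.base} {φ : PullIso f B.E A.E} (hφ : A.Compat B k β φ)
    {k' : y ⟶ z} (h : k = k') {β' : OMod.Hom M' M} (h' : β = β') : A.Compat B k' β' φ := by
  subst h h'
  exact hφ

/-- Every element of `M'(y)` is a section of the model `B` along `𝟙 y ≫ k`, and on such sections `φ`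
determines `β`. -/
lemma Compat.app_eq {f : A.base ⟶ B.base} (hf : eqToHom A.e ≫ f = T.p.map k ≫ eqToHom B.e)
    {φ : PullIso f B.E A.E} (hφ : A.Compat B k β φ) {β' : OMod.Hom M' M}
    (hφ' : A.Compat B k β' φ) (m : M'.obj y) : β.app y m = β'.app y m := by
  obtain ⟨m, rfl⟩ := (B.sec_bijective (𝟙 y ≫ k)).2 m
  rw [← hφ (𝟙 y) (comp_base hf _), hφ' (𝟙 y) (comp_base hf _)]

end LocalModel

/-! ### The universal vector bundle and morphisms to the stack of vector bundles -/

section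

variable {v v' : BasedFunctor T (BGL S)}

lemma univFib_comp_eq {a b c : BunObj (terminal S)} (θ : c ⟶ a) (φ : a ⟶ b)
    (m : b.E.obj ⟨c.base, BunHom.base θ ≫ BunHom.base φ⟩) :
    univFib (θ ≫ φ) m = univFib θ ((BunHom.iso φ).app ⟨c.base, BunHom.base θ⟩ m) := by
  unfold univFib
  rw [← PullIso.naturality]
  refine (PullIso.comp_app (BunHom.iso θ) (BunHom.iso φ) _ _).trans ?_
  refine congrArg (fun l => PullIso.app (BunHom.iso θ) ⟨c.base, 𝟙 c.base⟩
    (PullIso.app (BunHom.iso φ) ⟨c.base, 𝟙 c.base ≫ BunHom.base θ⟩ l)) ?_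
  exact PullIso.res_res b.E _ _ _ (Category.comp_id _) m

/-- The morphism of `U ×_S S` comparing the points defined by `l` and by `v l`. -/
abbrev univModelHom (v : BasedFunctor T (BGL S)) {x y : T.obj} (l : x ⟶ y) :
    (⟨BunObj.base (v.obj x), BunHom.base (v.map l)⟩ :
      AffProdObj (BunObj.base (v.obj y)) (terminal S)) ⟶
      ⟨T.p.obj x, T.p.map l ≫ eqToHom (v.w_obj y).symm⟩ :=
  compHom (f := eqToHom (v.w_obj x)) (based_map v l).symm

lemma univModelHom_inv (v : BasedFunctor T (BGL S)) {x y : T.obj} (l : x ⟶ y) :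
    eqToHom (v.w_obj x).symm ≫ BunHom.base (v.map l) =
      T.p.map l ≫ eqToHom (v.w_obj y).symm := by
  rw [show BunHom.base (v.map l) = _ from based_map v l]
  exact (eqToHom_trans_assoc _ _ _).trans (Category.id_comp _)

/-- The isomorphism of `U ×_S S` comparing the points defined by `l` and by `v l`. -/
abbrev univModelObjIso (v : BasedFunctor T (BGL S)) {x y : T.obj} (l : x ⟶ y) :
    (⟨BunObj.base (v.obj x), BunHom.base (v.map l)⟩ :
      AffProdObj (BunObj.base (v.obj y)) (terminal S)) ≅
      ⟨T.p.obj x, T.p.map l ≫ eqToHom (v.w_obj y).symm⟩ where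
  hom := univModelHom v l
  inv := compHom (f := eqToHom (v.w_obj x).symm) (univModelHom_inv v l)
  hom_inv_id := AffProdObj.hom_ext (eqToHom_trans (v.w_obj x) (v.w_obj x).symm)
  inv_hom_id := AffProdObj.hom_ext (eqToHom_trans (v.w_obj x).symm (v.w_obj x))

lemma univModelHom_naturality (v : BasedFunctor T (BGL S)) {x y : T.obj} (k : x ⟶ y) :
    BunHom.base (v.map k) ≫ eqToHom (v.w_obj y) = eqToHom (v.w_obj x) ≫ T.p.map k := by
  rw [show BunHom.base (v.map k) = _ from based_map v k]
  simp

/-- The isomorphism of functors comparing `l` and `v l`. -/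
def univModelIso (v : BasedFunctor T (BGL S)) (y : T.obj) :
    BasedFunctor.comp (sliceMap v y) (BGL.sliceBase (v.obj y)) ≅
      sliceBase T (v.w_obj y).symm :=
  BasedNatIso.mkNatIso
    (NatIso.ofComponents
      (F := (BasedFunctor.comp (sliceMap v y) (BGL.sliceBase (v.obj y))).toFunctor)
      (G := (sliceBase T (v.w_obj y).symm).toFunctor)
      (fun l => univModelObjIso v l.hom)
      (fun f => AffProdObj.hom_ext (univModelHom_naturality v f.left)))
    fun l => isHomLift_id (X := affProd (BunObj.base (v.obj y)) (terminal S))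
      (univModelHom v l.hom) (v.w_obj l.left) rfl rfl

/-- The local model of `v^*` of the universal vector bundle defined by the vector bundle `v y`. -/
def univModel (v : BasedFunctor T (BGL S)) (y : T.obj) :
    LocalModel (OMod.pullback v (univBundle S)) y where
  base := BunObj.base (v.obj y)
  e := (v.w_obj y).symm
  E := BunObj.E (v.obj y)
  iso := OMod.pullbackNatIso (univModelIso v y) (BunObj.E (v.obj y)) ≪≫
    OMod.pullbackComp (sliceMap v y) (BGL.sliceBase (v.obj y)) _ ≪≫
    OMod.pullbackIso (sliceMap v y) (univFibIso (v.obj y)) ≪≫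
    (OMod.pullbackComp (sliceMap v y) (slice.forget (BGL S) (v.obj y)) (univBundle S)).symm ≪≫
    OMod.pullbackComp (slice.forget T y) v (univBundle S)

lemma univModel_sec (v : BasedFunctor T (BGL S)) {x y : T.obj} (l : x ⟶ y)
    (m : (BunObj.E (v.obj y)).obj ⟨T.p.obj x, T.p.map l ≫ eqToHom (v.w_obj y).symm⟩) :
    (univModel v y).sec l m =
      univFib (v.map l) ((BunObj.E (v.obj y)).res (univModelHom v l) m) := rfl

/-- The common computation behind `compat_map` and `compat_nat`: a commutative square in the stack
of vector bundles, one of whose sides lies over an equality, becomes an identity between sections.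
-/
lemma univModel_sec_app {x y z : T.obj} (l : x ⟶ y) (l' : x ⟶ z) (φ : v.obj y ⟶ v'.obj z)
    (ψ : v.obj x ⟶ v'.obj x)
    (hψ : BunHom.base ψ = eqToHom ((v.w_obj x).trans (v'.w_obj x).symm))
    (h : v.map l ≫ φ = ψ ≫ v'.map l')
    (e : (T.p.map l ≫ eqToHom (v.w_obj y).symm) ≫ BunHom.base φ =
      T.p.map l' ≫ eqToHom (v'.w_obj z).symm)
    (m : (BunObj.E (v'.obj z)).obj ⟨T.p.obj x, T.p.map l' ≫ eqToHom (v'.w_obj z).symm⟩) :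
    (univModel v y).sec l ((BunHom.iso φ).app
      ⟨T.p.obj x, T.p.map l ≫ eqToHom (v.w_obj y).symm⟩
        ((BunObj.E (v'.obj z)).res (affProdEq e) m)) =
      univRes ψ ((univModel v' z).sec l' m) := by
  rw [univModel_sec, univModel_sec]
  rw [← PullIso.naturality]
  refine (univFib_comp_eq (v.map l) φ _).symm.trans ?_
  refine Eq.trans ?_ (univFib_comp ψ (v'.map l') (v.map l ≫ φ) h.symm
    (congrArg BunHom.base h).symm _)
  have hw : eqToHom (v.w_obj x) ≫ T.p.map l' ≫ eqToHom (v'.w_obj z).symm =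
      BunHom.base (v.map l ≫ φ) := by
    rw [h]
    change _ = BunHom.base ψ ≫ BunHom.base (v'.map l')
    rw [hψ, show BunHom.base (v'.map l') = _ from based_map v' l']
    exact (eqToHom_trans_assoc _ _ _).symm
  refine congrArg (univFib (v.map l ≫ φ)) ?_
  exact (PullIso.res_res _ _ _ (compHom hw) (Category.comp_id _) m).trans
    (PullIso.res_res _ _ _ (compHom hw) ((congrArg (· ≫ eqToHom (v'.w_obj x)) hψ).trans
      (eqToHom_trans _ _)) m).symm

lemma compat_map {y z : T.obj} (k : y ⟶ z) :
    (univModel v y).Compat (univModel v z) k (OMod.Hom.id _) (BunHom.iso (v.map k)) :=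
  fun x l h m => (univModel_sec_app l (l ≫ k) (v.map k) (𝟙 _) rfl (by simp) h m).trans
    ((univBundle S).res_id _ _)

lemma compat_nat (α : v ⟶ v') (y : T.obj) :
    (univModel v y).Compat (univModel v' y) (𝟙 y) (OMod.pullbackNat α (univBundle S))
      (BunHom.iso (α.app y)) :=
  fun x l h m => univModel_sec_app l (l ≫ 𝟙 y) (α.app y) (α.app x) (based_app α x)
    (by rw [Category.comp_id]; exact α.naturality l) h m

end

end

/-! ### Pullback of the universal bundle is fully faithful -/

section

variable {S : Scheme.{u}} {T : BasedCategory.{v, w} (AffOver S)}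
  {v v' v'' : BasedFunctor T (BGL S)}

lemma BunHom.hom_ext {a b : BunObj (terminal S)} {φ ψ : a ⟶ b}
    (h : (BunHom.iso φ).Eqv (BunHom.iso ψ)) : φ = ψ :=
  BunHom.ext' h

/-- The uniqueness of compatible isomorphisms of models, as an equality criterion for morphisms in
the stack of vector bundles. -/
lemma univModel_hom_ext (hT : IsCart T) {y z : T.obj} {k : y ⟶ z} {φ ψ : v.obj y ⟶ v'.obj z}
    {β : OMod.Hom (OMod.pullback v' (univBundle S)) (OMod.pullback v (univBundle S))}
    (hφ : eqToHom (univModel v y).e ≫ BunHom.base φ = T.p.map k ≫ eqToHom (univModel v' z).e)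
    (hψ : eqToHom (univModel v y).e ≫ BunHom.base ψ = T.p.map k ≫ eqToHom (univModel v' z).e)
    (cφ : (univModel v y).Compat (univModel v' z) k β (BunHom.iso φ))
    (cψ : (univModel v y).Compat (univModel v' z) k β (BunHom.iso ψ)) : φ = ψ := by
  apply BunHom.hom_ext
  have := LocalModel.Compat.eqv hT hφ hψ cφ cψ
  exact this

lemma univModel_compat_comp {y z w : T.obj} {k : y ⟶ z} {l : z ⟶ w} {φ : v.obj y ⟶ v'.obj z}
    {ψ : v'.obj z ⟶ v''.obj w}
    {β : OMod.Hom (OMod.pullback v' (univBundle S)) (OMod.pullback v (univBundle S))}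
    {β' : OMod.Hom (OMod.pullback v'' (univBundle S)) (OMod.pullback v' (univBundle S))}
    (hφ : eqToHom (univModel v y).e ≫ BunHom.base φ = T.p.map k ≫ eqToHom (univModel v' z).e)
    (hψ : eqToHom (univModel v' z).e ≫ BunHom.base ψ = T.p.map l ≫ eqToHom (univModel v'' w).e)
    (cφ : (univModel v y).Compat (univModel v' z) k β (BunHom.iso φ))
    (cψ : (univModel v' z).Compat (univModel v'' w) l β' (BunHom.iso ψ)) :
    (univModel v y).Compat (univModel v'' w) (k ≫ l) (β'.comp β) (BunHom.iso (φ ≫ ψ)) := by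
  have := cφ.comp hφ hψ cψ
  exact this

/-- The component of `α` at `y` is the unique isomorphism of models compatible with the pulled back
morphism of modules, so the latter determines it. -/
lemma univPullback_faithful (hT : IsCart T) {α α' : v ⟶ v'}
    (h : OMod.pullbackNat α (univBundle S) = OMod.pullbackNat α' (univBundle S)) : α = α' := by
  ext y
  have hf (α : v ⟶ v') : eqToHom (univModel v y).e ≫ BunHom.base (α.app y) =
      T.p.map (𝟙 y) ≫ eqToHom (univModel v' y).e := by
    rw [show BunHom.base (α.app y) = _ from based_app α y, T.p.map_id, Category.id_comp]
    exact eqToHom_trans _ _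
  exact univModel_hom_ext hT (hf α) (hf α') (compat_nat α y) ((compat_nat α' y).congr rfl h.symm)

lemma eqToHom_comp_comp_eqToHom {U V W U' V' W' : AffOver S} {p : U = U'} {q : V = V'}
    {r : W = W'} {f : U ⟶ V} {g : V ⟶ W} {h : U ⟶ W} {φ : U' ⟶ V'} {ψ : V' ⟶ W'}
    (hφ : eqToHom p ≫ φ = f ≫ eqToHom q) (hψ : eqToHom q ≫ ψ = g ≫ eqToHom r) (e : f ≫ g = h) :
    eqToHom p ≫ φ ≫ ψ = h ≫ eqToHom r := by
  rw [← Category.assoc, hφ, Category.assoc, hψ, ← e, Category.assoc]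

lemma univModel_base_map (v : BasedFunctor T (BGL S)) {y z : T.obj} (k : y ⟶ z) :
    eqToHom (univModel v y).e ≫ BunHom.base (v.map k) = T.p.map k ≫ eqToHom (univModel v z).e :=
  univModelHom_inv v k

lemma univModel_exists_hom (hT : IsCart T)
    (β : OMod.pullback v' (univBundle S) ≅ OMod.pullback v (univBundle S)) (y : T.obj) :
    ∃ α : v.obj y ⟶ v'.obj y, eqToHom (univModel v y).e ≫ BunHom.base α =
        T.p.map (𝟙 y) ≫ eqToHom (univModel v' y).e ∧
      (univModel v y).Compat (univModel v' y) (𝟙 y) β.hom (BunHom.iso α) := by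
  have hf : eqToHom (univModel v y).e ≫ eqToHom ((v.w_obj y).trans (v'.w_obj y).symm) =
      T.p.map (𝟙 y) ≫ eqToHom (univModel v' y).e := by
    rw [T.p.map_id, Category.id_comp]
    exact eqToHom_trans _ _
  obtain ⟨φ, hφ⟩ := LocalModel.exists_compat (A := univModel v y) (B := univModel v' y) hT hf β
  let α : v.obj y ⟶ v'.obj y := ⟨eqToHom ((v.w_obj y).trans (v'.w_obj y).symm), φ⟩
  have h : (univModel v y).Compat (univModel v' y) (𝟙 y) β.hom (BunHom.iso α) := hφ
  exact ⟨α, hf, h⟩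

/-- The components are the isomorphisms of models compatible with `β`. Both composites in a
naturality square are compatible with `β` over the same morphism, so they agree; finally `β` is
recovered from the components. -/
lemma univPullback_full (hT : IsCart T)
    (β : OMod.pullback v' (univBundle S) ≅ OMod.pullback v (univBundle S)) :
    ∃ α : v ⟶ v', OMod.pullbackNat α (univBundle S) = β.hom := by
  choose α hα hα' using univModel_exists_hom hT β
  have nat {y z : T.obj} (k : y ⟶ z) : v.map k ≫ α z = α y ≫ v'.map k := by
    have h₁ := univModel_compat_comp (univModel_base_map v k) (hα z) (compat_map k) (hα' z)
    have h₂ := univModel_compat_comp (hα y) (univModel_base_map v' k) (hα' y) (compat_map k)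
    refine univModel_hom_ext hT ?_ ?_ (h₁.congr (Category.comp_id k) rfl)
      (h₂.congr (Category.id_comp k) rfl)
    · exact eqToHom_comp_comp_eqToHom (univModel_base_map v k) (hα z) (by simp)
    · exact eqToHom_comp_comp_eqToHom (hα y) (univModel_base_map v' k) (by simp)
  let α' : v ⟶ v' :=
    { app := α
      naturality := fun y z k => nat k
      isHomLift' := fun y => isHomLift_id (X := BGL S) (α y) (v.w_obj y) (v'.w_obj y)
        ((cancel_epi (eqToHom (v.w_obj y).symm)).1 ((hα y).trans (by
          rw [T.p.map_id, Category.id_comp]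
          exact (eqToHom_trans _ _).symm))) }
  refine ⟨α', OMod.Hom.ext' fun y m => ?_⟩
  have := LocalModel.Compat.app_eq (hα y) (compat_nat α' y) (hα' y) m
  exact this

/-! ### Every vector bundle is a pullback of the universal bundle -/

namespace LocalModel

variable {M : OMod.{t} T} {y : T.obj}

/-- The local model defined by a quasi-inverse of the functor from the slice over `y`. -/
lemma exists_of_isVect (hT : IsCart T) (hM : M.IsVect) (y : T.obj) :
    ∃ (E : OMod.{t} (affProd (T.p.obj y) (terminal S)))
      (_ : OMod.pullback (sliceBase T (rfl : T.p.obj y = _)) E ≅ M.restrict y), E.IsVect := by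
  obtain ⟨ρ, ⟨i⟩, -⟩ := (hT.isBasedEquiv_sliceBase (rfl : T.p.obj y = _)).exists_quasiInverse
  exact ⟨OMod.pullback ρ (M.restrict y), (OMod.pullbackComp _ ρ (M.restrict y)).symm ≪≫
    OMod.pullbackNatIso i.symm _ ≪≫ OMod.pullbackId _,
    (hM.pullback (hT.slice y) hT _).pullback ((terminal.isCart S).affProd _) (hT.slice y) ρ⟩

lemma sec_smul (A : LocalModel M y) {x : T.obj} (l : x ⟶ y) (r : Fn (T.p.obj x))
    (m : A.E.obj ⟨T.p.obj x, T.p.map l ≫ eqToHom A.e⟩) :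
    A.sec l ((show O (affProd A.base (terminal S))
      ⟨T.p.obj x, T.p.map l ≫ eqToHom A.e⟩ from r) • m) =
      (show O T x from r) • A.sec l m := by
  refine Eq.trans (congrArg (A.sec l) ?_)
    (((OMod.Hom.app A.iso.hom (Over.mk l)).map_smul r m).trans (M.restrict_smul l r _))
  exact congrArg (fun s : O (affProd A.base (terminal S))
      ⟨T.p.obj x, T.p.map l ≫ eqToHom A.e⟩ => s • m) (Fn.map_id _ r).symm

end LocalModel

/-- The morphism to the stack of vector bundles defined by a compatible family of vector bundles
on the affine schemes under the objects of `T`. -/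
def bglOfFamily (E : ∀ y : T.obj, OMod.{u} (affProd (T.p.obj y) (terminal S)))
    (hE : ∀ y, (E y).IsVect) (φ : ∀ (y z : T.obj) (k : y ⟶ z), PullIso (T.p.map k) (E z) (E y))
    (hid : ∀ y, (φ y y (𝟙 y)).Eqv (basePullbackId (E y)))
    (hcomp : ∀ (x y z : T.obj) (k : x ⟶ y) (l : y ⟶ z),
      (φ x z (k ≫ l)).Eqv ((φ x y k).comp (φ y z l))) : BasedFunctor T (BGL S) where
  obj y := ⟨T.p.obj y, E y, hE y⟩
  map {y z} k := ⟨T.p.map k, φ y z k⟩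
  map_id y := BunHom.hom_ext (hid y)
  map_comp {x y z} k l := BunHom.hom_ext (hcomp x y z k l)
  w := rfl

namespace LocalModel

variable {M : OMod.{u} T}

/-- The local model given by a vector bundle on the affine scheme under `y`. -/
abbrev ofIso {y : T.obj} (E : OMod.{t} (affProd (T.p.obj y) (terminal S))) {M : OMod.{t} T}
    (i : OMod.pullback (sliceBase T (rfl : T.p.obj y = _)) E ≅ M.restrict y) : LocalModel M y :=
  ⟨T.p.obj y, rfl, E, i⟩

/-- The sections over `y` of a local model at `y`. -/
def secId {y : T.obj} {E : OMod.{t} (affProd (T.p.obj y) (terminal S))} {M : OMod.{t} T}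
    (i : OMod.pullback (sliceBase T (rfl : T.p.obj y = _)) E ≅ M.restrict y)
    (m : E.obj ⟨T.p.obj y, 𝟙 _⟩) : M.obj y :=
  (ofIso E i).sec (𝟙 y) (E.res (affProdEq (by simp)) m)

lemma secId_bijective {y : T.obj} {E : OMod.{t} (affProd (T.p.obj y) (terminal S))}
    {M : OMod.{t} T} (i : OMod.pullback (sliceBase T (rfl : T.p.obj y = _)) E ≅ M.restrict y) :
    Function.Bijective (secId i) := by
  have h : T.p.map (𝟙 y) ≫ eqToHom rfl = 𝟙 (T.p.obj y) := by simp
  have : IsIso (affProdEq h : (⟨T.p.obj y, _⟩ : AffProdObj (T.p.obj y) (terminal S)) ⟶ _) :=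
    (affProdEqIso (Y := terminal S) h).isIso_hom
  exact ((ofIso E i).sec_bijective (𝟙 y)).comp (E.res_bijective (affProdEq h))

lemma secId_smul {y : T.obj} {E : OMod.{t} (affProd (T.p.obj y) (terminal S))} {M : OMod.{t} T}
    (i : OMod.pullback (sliceBase T (rfl : T.p.obj y = _)) E ≅ M.restrict y)
    (r : Fn (T.p.obj y)) (m : E.obj ⟨T.p.obj y, 𝟙 _⟩) :
    secId i ((show O (affProd (T.p.obj y) (terminal S)) ⟨T.p.obj y, 𝟙 _⟩ from r) • m) =
      (show O T y from r) • secId i m := by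
  unfold secId
  rw [LinearMap.map_smulₛₗ]
  refine Eq.trans ?_ ((ofIso E i).sec_smul (𝟙 y) r _)
  refine congrArg ((ofIso E i).sec (𝟙 y)) ?_
  exact congrArg (fun s : O (affProd (T.p.obj y) (terminal S))
    ⟨T.p.obj y, T.p.map (𝟙 y) ≫ eqToHom rfl⟩ => s • E.res (affProdEq _) m) (Fn.map_id _ r)

/-- The naturality of `bglOfFamilyIso`: restriction in the universal bundle, computed through `φ`,
is restriction in `M`. -/
lemma secId_res {y z : T.obj} {E : OMod.{t} (affProd (T.p.obj y) (terminal S))}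
    {E' : OMod.{t} (affProd (T.p.obj z) (terminal S))} {M : OMod.{t} T}
    {i : OMod.pullback (sliceBase T (rfl : T.p.obj y = _)) E ≅ M.restrict y}
    {i' : OMod.pullback (sliceBase T (rfl : T.p.obj z = _)) E' ≅ M.restrict z}
    {k : y ⟶ z} {φ : PullIso (T.p.map k) E' E}
    (hφ : (ofIso E i).Compat (ofIso E' i') k (OMod.Hom.id M) φ)
    (m : E'.obj ⟨T.p.obj z, 𝟙 _⟩) :
    secId i (φ.app ⟨T.p.obj y, 𝟙 _⟩ (E'.res (univHom (T.p.map k)) m)) =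
      M.res k (secId i' m) := by
  unfold secId
  have h : (T.p.map (𝟙 y) ≫ eqToHom (ofIso E i).e) ≫ T.p.map k =
      T.p.map (𝟙 y ≫ k) ≫ eqToHom (ofIso E' i').e := by simp
  have h₁ : T.p.map (𝟙 y ≫ k) ≫ eqToHom rfl = T.p.map k := by simp
  have h₂ : T.p.map (𝟙 y ≫ k) ≫ eqToHom rfl = T.p.map (k ≫ 𝟙 z) ≫ eqToHom rfl := by simp
  have h₃ : T.p.map k ≫ 𝟙 _ = T.p.map (𝟙 y ≫ k) ≫ eqToHom rfl := by simp
  have h₄ : T.p.map k ≫ T.p.map (𝟙 z) ≫ eqToHom rfl = T.p.map (k ≫ 𝟙 z) ≫ eqToHom rfl := by simp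
  have h₅ : T.p.map (𝟙 z) ≫ eqToHom rfl = 𝟙 _ := by simp
  rw [← sec_res, ← sec_congr (ofIso E' i') ((Category.id_comp k).trans (Category.comp_id k).symm),
    ← PullIso.naturality]
  refine Eq.trans (congrArg (fun s => (ofIso E i).sec (𝟙 y) (φ.app _ s)) ?_)
    ((hφ (𝟙 y) h (E'.res (compHom h₃) m)).trans
      (congrArg ((ofIso E' i').sec (𝟙 y ≫ k)) (Eq.symm ?_)))
  · exact (PullIso.res_res E' _ _ (compHom (by simp)) (Category.id_comp _) m).trans
      (PullIso.res_res E' _ _ _ (Category.id_comp _) m).symm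
  · refine (congrArg (E'.res (affProdEq h₂)) (PullIso.res_res E' (compHom h₄) (affProdEq h₅)
      (compHom (h₃.trans h₂)) (Category.comp_id _) m)).trans ?_
    exact PullIso.res_res E' _ _ _ (Category.id_comp _) m

end LocalModel

end

section

variable {S : Scheme.{u}} {T : BasedCategory.{v, w} (AffOver S)}

namespace LocalModel

section

variable {M : OMod.{t} T} {x y z : T.obj}
    {E : OMod.{t} (affProd (T.p.obj y) (terminal S))}
    {E' : OMod.{t} (affProd (T.p.obj z) (terminal S))}
    {E'' : OMod.{t} (affProd (T.p.obj x) (terminal S))}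
    (i : OMod.pullback (sliceBase T (rfl : T.p.obj y = _)) E ≅ M.restrict y)
    (i' : OMod.pullback (sliceBase T (rfl : T.p.obj z = _)) E' ≅ M.restrict z)
    (i'' : OMod.pullback (sliceBase T (rfl : T.p.obj x = _)) E'' ≅ M.restrict x)

lemma ofIso_base (k : y ⟶ z) :
    eqToHom (ofIso E i).e ≫ T.p.map k = T.p.map k ≫ eqToHom (ofIso E' i').e :=
  (Category.id_comp _).trans (Category.comp_id _).symm

lemma ofIso_exists_compat (hT : IsCart T) (k : y ⟶ z) : ∃ φ : PullIso (T.p.map k) E' E,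
    (ofIso E i).Compat (ofIso E' i') k (OMod.Hom.id M) φ :=
  exists_compat (A := ofIso E i) (B := ofIso E' i') (k := k) (f := T.p.map k) hT
    (ofIso_base i i' k) (Iso.refl M)

variable {i i' i''}

lemma ofIso_eqv_id (hT : IsCart T) {φ : PullIso (T.p.map (𝟙 y)) E E}
    (hφ : (ofIso E i).Compat (ofIso E i) (𝟙 y) (OMod.Hom.id M) φ) :
    φ.Eqv (basePullbackId E) := by
  have h : eqToHom (ofIso E i).e ≫ 𝟙 (T.p.obj y) =
      T.p.map (𝟙 y) ≫ eqToHom (ofIso E i).e := by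
    rw [T.p.map_id]
    rfl
  have := Compat.eqv (A := ofIso E i) (B := ofIso E i) (k := 𝟙 y) (f := T.p.map (𝟙 y))
    (g := 𝟙 (T.p.obj y)) hT (ofIso_base i i (𝟙 y)) h hφ compat_id
  exact this

/-- The cocycle condition. Both sides are compatible with the identity of `M` over `k ≫ l`, and such
an isomorphism is unique. -/
lemma ofIso_eqv_comp (hT : IsCart T) {k : x ⟶ y} {l : y ⟶ z} {φ : PullIso (T.p.map k) E E''}
    {ψ : PullIso (T.p.map l) E' E} {χ : PullIso (T.p.map (k ≫ l)) E' E''}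
    (hφ : (ofIso E'' i'').Compat (ofIso E i) k (OMod.Hom.id M) φ)
    (hψ : (ofIso E i).Compat (ofIso E' i') l (OMod.Hom.id M) ψ)
    (hχ : (ofIso E'' i'').Compat (ofIso E' i') (k ≫ l) (OMod.Hom.id M) χ) :
    χ.Eqv (φ.comp ψ) := by
  have h : eqToHom (ofIso E'' i'').e ≫ T.p.map k ≫ T.p.map l =
      T.p.map (k ≫ l) ≫ eqToHom (ofIso E' i').e := by
    rw [T.p.map_comp]
    exact (Category.id_comp _).trans (Category.comp_id _).symm
  have c := Compat.comp (A := ofIso E'' i'') (B := ofIso E i) (C := ofIso E' i') (f := T.p.map k)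
    (g := T.p.map l) (ofIso_base i'' i k) (ofIso_base i i' l) hφ hψ
  have := Compat.eqv (A := ofIso E'' i'') (B := ofIso E' i') (k := k ≫ l) (f := T.p.map (k ≫ l))
    (g := T.p.map k ≫ T.p.map l) hT (ofIso_base i'' i' (k ≫ l)) h hχ c
  exact this

end

end LocalModel

section

variable {M : OMod.{u} T} (E : ∀ y : T.obj, OMod.{u} (affProd (T.p.obj y) (terminal S)))
    (hE : ∀ y, (E y).IsVect) (φ : ∀ (y z : T.obj) (k : y ⟶ z), PullIso (T.p.map k) (E z) (E y))
    (hid : ∀ y, (φ y y (𝟙 y)).Eqv (basePullbackId (E y)))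
    (hcomp : ∀ (x y z : T.obj) (k : x ⟶ y) (l : y ⟶ z),
      (φ x z (k ≫ l)).Eqv ((φ x y k).comp (φ y z l)))
    (i : ∀ y, OMod.pullback (sliceBase T (rfl : T.p.obj y = _)) (E y) ≅ M.restrict y)

/-- The identification of the pullback of the universal vector bundle. -/
def bglOfFamilyIso (hφ : ∀ (y z : T.obj) (k : y ⟶ z), (LocalModel.ofIso (E y) (i y)).Compat
      (LocalModel.ofIso (E z) (i z)) k (OMod.Hom.id M) (φ y z k)) :
    OMod.pullback (bglOfFamily E hE φ hid hcomp) (univBundle S) ≅ M :=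
  OMod.isoOfBijective
    { app := fun y =>
        { toFun := LocalModel.secId (i y)
          map_add' := fun m m' => (congrArg ((LocalModel.ofIso (E y) (i y)).sec (𝟙 y))
            (map_add ((E y).res _) m m')).trans
              (map_add (OMod.Hom.app (i y).hom (Over.mk (𝟙 y))) _ _)
          map_smul' := fun r m => by
            refine Eq.trans ?_ (LocalModel.secId_smul (i y) r m)
            refine congrArg (LocalModel.secId (i y)) ?_
            exact congrArg (fun s : O (affProd (T.p.obj y) (terminal S)) ⟨T.p.obj y, 𝟙 _⟩ =>
              s • (show (E y).obj ⟨T.p.obj y, 𝟙 _⟩ from m)) (Fn.map_id _ r) }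
      naturality := fun {y z} k m => LocalModel.secId_res (hφ y z k) m }
    fun y => LocalModel.secId_bijective (i y)

end

/-- Choose at each object a model of `M` which is a vector bundle. The transition isomorphisms are
then forced by compatibility with the identity of `M`, so any choice of models assembles into a
functor. -/
lemma exists_univPullback_iso (hT : IsCart T) {M : OMod.{u} T} (hM : M.IsVect) :
    ∃ v : BasedFunctor T (BGL S), Nonempty (OMod.pullback v (univBundle S) ≅ M) := by
  choose E i hE using LocalModel.exists_of_isVect hT hM
  choose φ hφ using fun (y z : T.obj) (k : y ⟶ z) =>
    LocalModel.ofIso_exists_compat (i y) (i z) hT k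
  exact ⟨_, ⟨bglOfFamilyIso E hE φ (fun y => LocalModel.ofIso_eqv_id hT (hφ y y (𝟙 y)))
    (fun x y z k l => LocalModel.ofIso_eqv_comp hT (hφ x y k) (hφ y z l) (hφ x z (k ≫ l))) i hφ⟩⟩

end

section

variable {S : Scheme.{u}} {X : BasedCategory.{v, w} (AffOver S)}
  {Z : BasedCategory.{v₁, w₁} (AffOver S)} {B : BasedCategory.{v₂, w₂} (AffOver S)}

/-! ### Points of mapping prestacks with families of sections -/

/-- An object `z` of `Z` with a compatible family of sections of `P` along `H z`. -/
structure FamObj (P : OMod.{t} B) (H : BasedFunctor Z (Map X B)) where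
  pt : Z.obj
  fam : Family P (H.obj pt)

/-- A morphism along which families of sections are compatible. -/
@[ext]
structure FamHom {P : OMod.{t} B} {H : BasedFunctor Z (Map X B)} (a b : FamObj P H) where
  hom : a.pt ⟶ b.pt
  pull : b.fam.pull (H.map hom) = a.fam

instance (P : OMod.{t} B) (H : BasedFunctor Z (Map X B)) : Category (FamObj P H) where
  Hom := FamHom
  id a := ⟨𝟙 a.pt, (congrArg (fun k => a.fam.pull k) (H.map_id a.pt)).trans a.fam.pull_id⟩
  comp {_ _ c} φ ψ := ⟨φ.hom ≫ ψ.hom, (congrArg (fun k => c.fam.pull k) (H.map_comp _ _)).trans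
    ((Family.pull_comp _ _ _).trans ((congrArg _ ψ.pull).trans φ.pull))⟩
  id_comp φ := FamHom.ext (Category.id_comp φ.hom)
  comp_id φ := FamHom.ext (Category.comp_id φ.hom)
  assoc φ ψ χ := FamHom.ext (Category.assoc φ.hom ψ.hom χ.hom)

/-- The category over `Aff_{/S}` of objects of `Z` with families of sections. -/
abbrev famCat (P : OMod.{t} B) (H : BasedFunctor Z (Map X B)) : BasedCategory (AffOver S) where
  obj := FamObj P H
  p :=
    { obj := fun a => Z.p.obj (FamObj.pt a)
      map := fun φ => Z.p.map (FamHom.hom φ)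
      map_id := fun a => Z.p.map_id (FamObj.pt a)
      map_comp := fun φ ψ => Z.p.map_comp (FamHom.hom φ) (FamHom.hom ψ) }

namespace famCat

variable {P : OMod.{t} B} {H : BasedFunctor Z (Map X B)}

/-- The functor `P ↦ Map_S(X, 𝕍 P)`. -/
abbrev projMap (X : BasedCategory.{v, w} (AffOver S)) (P : OMod.{t} B) :
    BasedFunctor (Map X (totalSpace P)) (Map X B) :=
  Map.postcomp X (relSpec.proj (Sym P.dual))

/-- The functor which maps an object of the fibre product to its family of sections. -/
def ofFibProd (hB : IsCart B) (hP : P.IsLocallyProjective) (H : BasedFunctor Z (Map X B)) :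
    BasedFunctor (fibProd (projMap X P) H) (famCat P H) :=
  basedOfLift
    { obj := fun a => ⟨FibProdObj.snd a,
        (RelSpecObj.family hB hP (FibProdObj.fst a)).pull (FibProdObj.iso a).inv⟩
      map := fun {a b} φ => ⟨FibProdHom.snd φ, by
        have h : H.map (FibProdHom.snd φ) ≫ (FibProdObj.iso b).inv =
            (FibProdObj.iso a).inv ≫ (projMap X P).map (FibProdHom.fst φ) := by
          rw [Iso.comp_inv_eq, Category.assoc, FibProdHom.comm, Iso.inv_hom_id_assoc]
        exact (Family.pull_comp _ _ _).symm.trans ((congrArg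
          (fun k => (RelSpecObj.family hB hP (FibProdObj.fst b)).pull k) h).trans
            ((Family.pull_comp _ _ _).trans (congrArg _ (RelSpecObj.family_pull hB hP _))))⟩
      map_id := fun _ => rfl
      map_comp := fun _ _ => rfl }
    fun {a b} φ => by
      have := FibProdHom.snd_lift φ
      exact IsHomLift.of_fac' _ _ _ a.snd_base b.snd_base
        (IsHomLift.fac' Z.p (FibProdHom.base φ) (FibProdHom.snd φ))

lemma map_iso_hom {G : BasedFunctor X B} {F : BasedFunctor Z B} (a : FibProdObj G F) :
    B.p.map a.iso.hom = eqToHom (((G.w_obj a.fst).trans a.fst_base).trans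
      ((F.w_obj a.snd).trans a.snd_base).symm) := by
  have := a.iso_lift
  simpa using IsHomLift.fac' B.p (𝟙 a.base) a.iso.hom

/-- The second component determines the image of the first in `Map_S(X, B)`, and the condition on
families says that this image lifts to `𝕍 P`. -/
lemma exists_fibProdHom (hB : IsCart B) (hP : P.IsLocallyProjective)
    {a b : FibProdObj (projMap X P) H} (k : a.snd ⟶ b.snd)
    (hk : ((RelSpecObj.family hB hP b.fst).pull b.iso.inv).pull (H.map k) =
      (RelSpecObj.family hB hP a.fst).pull a.iso.inv) :
    ∃ φ : a ⟶ b, FibProdHom.snd φ = k := by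
  -- The composite `a.iso.hom ≫ H.map k ≫ b.iso.inv` is the only candidate for that image, by the
  -- commutativity required in the fibre product.
  have hk' : (RelSpecObj.family hB hP b.fst).pull
      (a.iso.hom ≫ H.map k ≫ b.iso.inv) = RelSpecObj.family hB hP a.fst := by
    rw [Family.pull_comp, Family.pull_comp]
    refine (congrArg _ hk).trans ?_
    refine (Family.pull_comp _ _ _).symm.trans ?_
    rw [Iso.hom_inv_id]
    exact Family.pull_id _
  obtain ⟨ψ, hψ⟩ := RelSpecObj.exists_mapHom hB hP (a.iso.hom ≫ H.map k ≫ b.iso.inv) hk'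
  let φ : FibProdHom a b :=
    { base := eqToHom a.snd_base.symm ≫ Z.p.map k ≫ eqToHom b.snd_base
      fst := ψ
      snd := k
      fst_lift := IsHomLift.of_fac' _ _ _ a.fst_base b.fst_base (by
        have h₁ : (Map X (totalSpace P)).p.map ψ =
          (Map X B).p.map (a.iso.hom ≫ H.map k ≫ b.iso.inv) := congrArg (Map X B).p.map hψ
        rw [h₁, Functor.map_comp, Functor.map_comp, map_iso_hom,
          map_inv_eq_eqToHom _ _ (map_iso_hom b), based_map]
        simp
        rfl)
      snd_lift := IsHomLift.of_fac' _ _ _ a.snd_base b.snd_base (by simp)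
      comm := by rw [hψ]; simp }
  exact ⟨φ, rfl⟩

/-- Faithfulness holds because the first component is determined by its image in `Map_S(X, B)`. For
essential surjectivity, a family along `H z` defines a morphism to `𝕍 P` lying strictly over `H z`,
so the comparison isomorphism can be the identity and the family is recovered exactly. -/
lemma isBasedEquiv_ofFibProd (hB : IsCart B) (hP : P.IsLocallyProjective)
    (H : BasedFunctor Z (Map X B)) : IsBasedEquiv (ofFibProd hB hP H) where
  faithful {a b φ ψ} h := by
    have h₂ : FibProdHom.snd φ = FibProdHom.snd ψ := congrArg FamHom.hom h
    have h₁ : FibProdHom.fst φ = FibProdHom.fst ψ := by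
      refine RelSpecObj.postcomp_proj_injective ?_
      rw [← cancel_mono b.iso.hom]
      exact (FibProdHom.comm φ).trans ((congrArg (fun k => a.iso.hom ≫ H.map k) h₂).trans
        (FibProdHom.comm ψ).symm)
    refine FibProdHom.ext ?_ h₁ h₂
    have e (φ : a ⟶ b) : FibProdHom.base φ = eqToHom a.snd_base.symm ≫
        Z.p.map (FibProdHom.snd φ) ≫ eqToHom b.snd_base := by
      have := FibProdHom.snd_lift φ
      rw [IsHomLift.fac' Z.p (FibProdHom.base φ) (FibProdHom.snd φ)]
      simp
    rw [e φ, e ψ, h₂]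
  full {a b} k := by
    obtain ⟨φ, hφ⟩ := exists_fibProdHom hB hP (FamHom.hom k) (FamHom.pull k)
    exact ⟨φ, FamHom.ext hφ⟩
  ess z := by
    let a : FibProdObj (projMap X P) H :=
      { base := Z.p.obj z.pt
        fst := RelSpecObj.mapObjOfFamily hB hP (H.obj z.pt) z.fam
        snd := z.pt
        fst_base := H.w_obj z.pt
        snd_base := rfl
        iso := Iso.refl (H.obj z.pt)
        iso_lift := IsHomLift.id (H.w_obj z.pt) }
    have h : (RelSpecObj.family hB hP a.fst).pull (𝟙 (H.obj z.pt)) = z.fam :=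
      (Family.pull_id _).trans
        (Family.ext_val (RelSpecObj.family_mapObjOfFamily hB hP (H.obj z.pt) z.fam))
    have e : (ofFibProd hB hP H).obj a = z := by
      obtain ⟨z, m⟩ := z
      exact congrArg (FamObj.mk z) h
    exact ⟨a, eqToIso e, congrArg (famCat P H).p.obj e, eqToHom_map (famCat P H).p e⟩

end famCat

end

section

variable {S : Scheme.{u}} {Y : BasedCategory.{v₁, w₁} (AffOver S)}
  {Z : BasedCategory.{v₂, w₂} (AffOver S)}

/-! ### Evaluation of points of mapping prestacks -/

namespace Map

/-- The evaluation of a point of the mapping prestack on `U ×_S Y`. -/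
abbrev prodIdEval (v : MapObj Y Z) {U : AffOver S} (h : v.base = U) :
    BasedFunctor (affProd U Y) Z :=
  BasedFunctor.comp (prodId v h) (eval Y Z)

lemma eval_map {a b : ProdObj (Map Y Z) Y} (φ : a ⟶ b) :
    (eval Y Z).map φ = MapHom.app (ProdHom.fst φ) (evalPt a) ≫
      (ProdObj.fst b).toFun.map (evalHom φ) := rfl

/-- The structure morphism of the point of `v.base ×_S Y` at which `v × id` is evaluated. -/
abbrev evalStr {v : MapObj Y Z} {U : AffOver S} (h : v.base = U) (y : AffProdObj U Y) :
    Y.p.obj y.pt ⟶ v.base :=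
  eqToHom rfl ≫ y.str ≫ eqToHom h.symm

lemma evalStr_w {v : MapObj Y Z} {U : AffOver S} (h : v.base = U) {y z : AffProdObj U Y}
    (k : y ⟶ z) : Y.p.map k.hom ≫ evalStr h z = evalStr h y := by
  rw [evalStr, evalStr, eqToHom_refl, eqToHom_refl, Category.id_comp, Category.id_comp]
  exact AffProdHom.w_assoc k _

/-- The morphism between points of `v.base ×_S Y` at which `v × id` is evaluated. -/
abbrev evalStrHom {v : MapObj Y Z} {U : AffOver S} (h : v.base = U) {y z : AffProdObj U Y}
    (k : y ⟶ z) : (⟨y.pt, evalStr h y⟩ : AffProdObj v.base Y) ⟶ ⟨z.pt, evalStr h z⟩ :=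
  ⟨k.hom, evalStr_w h k⟩

/-- The evaluation of a pulled back morphism, for an arbitrary point `q`; it specialises to
`prodIdEval_map` and to `evalCell_app`. -/
lemma eval_pull {v w : MapObj Y Z} (φ : MapHom v w) {V V' : AffOver S} (g : V ⟶ v.base)
    (h : V' ⟶ w.base) (k : V ⟶ V') (hk : k ≫ h = g ≫ φ.base) (q : AffProdObj V Y)
    (q' : AffProdObj V' Y) (κ : (⟨q.pt, q.str ≫ k⟩ : AffProdObj V' Y) ⟶ q')
    (l : (⟨q.pt, (q.str ≫ g) ≫ φ.base⟩ : AffProdObj w.base Y) ⟶ ⟨q'.pt, q'.str ≫ h⟩)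
    (hl : l.hom = κ.hom) :
    MapHom.app (φ.pull g h k hk) q ≫ (w.pull h).toFun.map κ =
      φ.app ⟨q.pt, q.str ≫ g⟩ ≫ w.toFun.map l := by
  refine (congrArg (· ≫ _) (MapHom.pull_app φ g h k hk q)).trans
    ((Category.assoc _ _ _).trans (congrArg (φ.app ⟨q.pt, q.str ≫ g⟩ ≫ ·) ?_))
  exact affProd_map_comp w.toFun (affProdEq _) ((affProdMap h Y).map κ) l
    ((Category.id_comp _).trans hl.symm)

/-- Evaluation along `v × id` is therefore `v` itself, except that the structure morphism `y.str` is
replaced by the equal `evalStr h y`. -/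
lemma prodIdEval_map (v : MapObj Y Z) {U : AffOver S} (h : v.base = U) {y z : AffProdObj U Y}
    (k : y ⟶ z) : (prodIdEval v h).map k = v.toFun.map (evalStrHom h k) := by
  refine (eval_map ((prodId v h).map k)).trans ?_
  have e : Y.p.map k.hom ≫ evalStr h z = evalStr h y ≫ 𝟙 v.base := by
    rw [evalStr_w, Category.comp_id]
  have := eval_pull (MapHom.id v) (y.str ≫ eqToHom h.symm) (z.str ≫ eqToHom h.symm)
    (Y.p.map k.hom) (prodId_comm h k) (evalPt ((prodId v h).obj y)) (evalPt ((prodId v h).obj z))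
    (evalHom ((prodId v h).map k)) ⟨k.hom, e⟩ rfl
  refine this.trans ?_
  rw [MapHom.id_app]
  exact affProd_map_comp v.toFun _ _ _ (Category.id_comp _)

variable {v w : MapObj Y Z} {U U' : AffOver S} {f : U ⟶ U'}

lemma evalStr_comp (hv : v.base = U) (hw : w.base = U') {φ : v.base ⟶ w.base}
    (hf : eqToHom hv.symm ≫ φ = f ≫ eqToHom hw.symm) (y : AffProdObj U Y) :
    evalStr hv y ≫ φ = evalStr hw ((affProdMap f Y).obj y) := by
  simp [evalStr, hf]

/-- The `2`-morphism of evaluations induced by a morphism `v ⟶ w` of the mapping prestack. -/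
abbrev evalCell (φ : MapHom v w) (hv : v.base = U) (hw : w.base = U')
    (hf : eqToHom hv.symm ≫ φ.base = f ≫ eqToHom hw.symm) :
    prodIdEval v hv ⟶ BasedFunctor.comp (affProdMap f Y) (prodIdEval w hw) :=
  BasedCategory.whiskerRight (prodIdCell φ hv hw f hf) (eval Y Z)

lemma evalCell_app (φ : MapHom v w) (hv : v.base = U) (hw : w.base = U')
    (hf : eqToHom hv.symm ≫ φ.base = f ≫ eqToHom hw.symm) (y : AffProdObj U Y) :
    (evalCell φ hv hw hf).app y = φ.app ⟨y.pt, evalStr hv y⟩ ≫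
      w.toFun.map (affProdEq (evalStr_comp hv hw hf y)) := by
  refine (eval_map (prodIdCellApp φ hv hw f hf y)).trans ?_
  have := eval_pull φ (y.str ≫ eqToHom hv.symm) ((y.str ≫ f) ≫ eqToHom hw.symm) (𝟙 _)
    (prodIdCell_comm hv hw f hf y) (evalPt ((prodId v hv).obj y))
    (evalPt ((prodId w hw).obj ((affProdMap f Y).obj y))) (evalHom (prodIdCellApp φ hv hw f hf y))
    (affProdEq (evalStr_comp hv hw hf y)) rfl
  exact this

lemma map_affProdEq {U : AffOver S} (F : BasedFunctor (affProd U Y) Z) {y : Y.obj}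
    {g g' : Y.p.obj y ⟶ U} (h : g = g') : Z.p.map (F.map (affProdEq h)) =
      eqToHom ((F.w_obj ⟨y, g⟩).trans (F.w_obj ⟨y, g'⟩).symm) := by
  subst h
  exact ((congrArg Z.p.map (map_eq_id F.toFunctor (f := affProdEq rfl) rfl)).trans
    (Z.p.map_id _)).trans (eqToHom_refl _ _).symm

lemma app_affProdEq (φ : MapHom v w) {y : Y.obj} {g g' : Y.p.obj y ⟶ v.base}
    {k : Y.p.obj y ⟶ w.base} (e : g = g') (h : g ≫ φ.base = k) (h' : g' ≫ φ.base = k) :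
    φ.app ⟨y, g⟩ ≫ w.toFun.map (affProdEq h) =
      v.toFun.map (affProdEq e) ≫ φ.app ⟨y, g'⟩ ≫ w.toFun.map (affProdEq h') := by
  subst e
  exact ((congrArg (· ≫ _) (map_eq_id v.toFun (f := affProdEq rfl) rfl)).trans
    (Category.id_comp _)).symm

/-- The evaluated cell has the components of the morphism at points with structure morphism
`evalStr`. These points are identified with the original ones, so no component is lost. -/
lemma evalCell_injective {φ ψ : MapHom v w} {hv : v.base = U} {hw : w.base = U'}
    {hf : eqToHom hv.symm ≫ φ.base = f ≫ eqToHom hw.symm}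
    {hf' : eqToHom hv.symm ≫ ψ.base = f ≫ eqToHom hw.symm}
    (h : evalCell φ hv hw hf = evalCell ψ hv hw hf') : φ = ψ := by
  subst hv hw
  obtain ⟨φ, c⟩ := φ
  obtain ⟨ψ, d⟩ := ψ
  obtain rfl : φ = ψ := (cancel_epi _).1 (hf.trans hf'.symm)
  refine MapHom.ext' rfl fun y => ?_
  have hy := congrArg (fun c => c.toNatTrans.app y) h
  have e : y.str = evalStr rfl y := by simp [evalStr]
  have h₁ := evalCell_app ⟨φ, c⟩ rfl rfl hf y
  have h₂ := evalCell_app ⟨φ, d⟩ rfl rfl hf' y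
  have h₃ := h₁.symm.trans (hy.trans h₂)
  have h₄ := evalStr_comp rfl rfl hf y
  have h₅ : y.str ≫ φ = _ := (congrArg (· ≫ φ) e).trans h₄
  have k₁ := app_affProdEq ⟨φ, c⟩ e h₅ h₄
  have k₂ := app_affProdEq ⟨φ, d⟩ e h₅ h₄
  have k₃ := k₁.trans ((congrArg _ h₃).trans k₂.symm)
  have : IsIso (w.toFun.map (affProdEq h₅)) := (w.toFun.mapIso (affProdEqIso h₅)).isIso_hom
  have k₄ := (cancel_mono (w.toFun.map (affProdEq h₅))).1 k₃
  exact ((congrArg (_ ≫ ·) (map_eq_id w.toFun (f := affProdEq rfl) rfl)).trans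
    (Category.comp_id _)).trans k₄

lemma comp_comm_three {C : Type*} [Category C] {a₀ a₁ a₂ a₃ b₀ b₁ b₂ b₃ : C} {i : a₀ ⟶ b₀}
    {j : a₁ ⟶ b₁} {k : a₂ ⟶ b₂} {l : a₃ ⟶ b₃} {p₁ : a₀ ⟶ a₁} {p₂ : a₁ ⟶ a₂} {p₃ : a₂ ⟶ a₃}
    {q₁ : b₀ ⟶ b₁} {q₂ : b₁ ⟶ b₂} {q₃ : b₂ ⟶ b₃} (h₁ : i ≫ q₁ = p₁ ≫ j) (h₂ : j ≫ q₂ = p₂ ≫ k)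
    (h₃ : k ≫ q₃ = p₃ ≫ l) : i ≫ q₁ ≫ q₂ ≫ q₃ = (p₁ ≫ p₂ ≫ p₃) ≫ l := by
  rw [reassoc_of% h₁, reassoc_of% h₂, h₃, Category.assoc, Category.assoc]

/-- The required morphism is `α` conjugated by the isomorphisms that exchange `y.str` and `evalStr`.
-/
lemma exists_evalCell (hv : v.base = U) (hw : w.base = U')
    (α : prodIdEval v hv ⟶ BasedFunctor.comp (affProdMap f Y) (prodIdEval w hw)) :
    ∃ (φ : MapHom v w) (hf : eqToHom hv.symm ≫ φ.base = f ≫ eqToHom hw.symm),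
      evalCell φ hv hw hf = α := by
  subst hv hw
  have e (y : AffProdObj v.base Y) : y.str = evalStr rfl y := by simp [evalStr]
  have e' (y : AffProdObj v.base Y) : evalStr rfl ((affProdMap f Y).obj y) = y.str ≫ f := by
    simp [evalStr]
  -- The components of `α`, with source and target written through `v` and `w` rather than through
  -- evaluation.
  obtain ⟨a, ha⟩ : ∃ a : ∀ y : AffProdObj v.base Y, v.toFun.obj ⟨y.pt, evalStr rfl y⟩ ⟶
      w.toFun.obj ⟨y.pt, evalStr rfl ((affProdMap f Y).obj y)⟩, ∀ y, a y = α.app y :=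
    ⟨fun y => α.app y, fun _ => rfl⟩
  have ha_lift (y : AffProdObj v.base Y) : Z.p.map (a y) =
      eqToHom ((v.mor.w_obj ⟨y.pt, evalStr rfl y⟩).trans
        (w.mor.w_obj ⟨y.pt, evalStr rfl ((affProdMap f Y).obj y)⟩).symm) :=
    (congrArg Z.p.map (ha y)).trans (based_app α y)
  have hα {y z : AffProdObj v.base Y} (k : y ⟶ z) :
      v.toFun.map (evalStrHom rfl k) ≫ a z = a y ≫
        w.toFun.map (evalStrHom rfl ((affProdMap f Y).map k)) := by
    rw [ha, ha]
    have h := α.naturality k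
    have h₁ := prodIdEval_map v rfl k
    have h₂ := prodIdEval_map w rfl ((affProdMap f Y).map k)
    exact ((congrArg (· ≫ α.app z) h₁).symm.trans h).trans (congrArg (α.app y ≫ ·) h₂)
  let c (y : AffProdObj v.base Y) : v.toFun.obj y ⟶ w.toFun.obj ⟨y.pt, y.str ≫ f⟩ :=
    v.toFun.map (affProdEq (e y)) ≫ a y ≫ w.toFun.map (affProdEq (e' y))
  have nat {y z : AffProdObj v.base Y} (k : y ⟶ z) : v.toFun.map k ≫ c z = c y ≫
      w.toFun.map ((affProdMap f Y).map k) := by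
    change v.toFun.map k ≫ v.toFun.map (affProdEq (e z)) ≫ a z ≫ w.toFun.map _ =
      (v.toFun.map (affProdEq (e y)) ≫ a y ≫ w.toFun.map _) ≫ w.toFun.map _
    have h₁ : v.toFun.map k ≫ v.toFun.map (affProdEq (e z)) =
        v.toFun.map (affProdEq (e y)) ≫ v.toFun.map (evalStrHom rfl k) := by
      rw [← v.toFun.map_comp, ← v.toFun.map_comp]
      exact congrArg v.toFun.map
        (AffProdObj.hom_ext ((Category.comp_id _).trans (Category.id_comp _).symm))
    have h₂ : w.toFun.map (evalStrHom rfl ((affProdMap f Y).map k)) ≫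
        w.toFun.map (affProdEq (e' z)) =
        w.toFun.map (affProdEq (e' y)) ≫ w.toFun.map ((affProdMap f Y).map k) := by
      rw [← w.toFun.map_comp, ← w.toFun.map_comp]
      exact congrArg w.toFun.map
        (AffProdObj.hom_ext ((Category.comp_id _).trans (Category.id_comp _).symm))
    exact comp_comm_three h₁ (hα k) h₂
  let φ : MapHom v w :=
    { base := f
      cell :=
        { app := c
          naturality := fun y z k => nat k
          isHomLift' := fun y => isHomLift_id (c y) (v.mor.w_obj y) (w.mor.w_obj _) (by
            change Z.p.map (v.toFun.map (affProdEq (e y)) ≫ a y ≫ w.toFun.map _) = _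
            have h₁ : Z.p.map (v.toFun.map (affProdEq (e y))) = eqToHom _ :=
              map_affProdEq v.mor (e y)
            have h₂ : Z.p.map (w.toFun.map (affProdEq (e' y))) = eqToHom _ :=
              map_affProdEq w.mor (e' y)
            rw [Functor.map_comp, Functor.map_comp, h₁, h₂, ha_lift, eqToHom_trans,
              eqToHom_trans]) } }
  have hf : eqToHom rfl ≫ φ.base = f ≫ eqToHom rfl :=
    (Category.id_comp _).trans (Category.comp_id _).symm
  refine ⟨φ, hf, ?_⟩
  ext y
  refine (evalCell_app φ rfl rfl hf y).trans ((?_ : _ = a y).trans (ha y))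
  change (v.toFun.map (affProdEq (e _)) ≫ a ⟨y.pt, evalStr rfl y⟩ ≫ w.toFun.map _) ≫
    w.toFun.map _ = _
  -- The evaluated cell at `y` uses `a` at the point with structure morphism `evalStr`; naturality
  -- along the identification of this point with `y` brings it back to `a y`.
  have h₁ := hα (y := ⟨y.pt, evalStr rfl y⟩) (z := y) (affProdEq (e y).symm)
  have h₂ := congrArg (v.toFun.map (affProdEq (e ⟨y.pt, evalStr rfl y⟩)) ≫ ·) h₁
  refine Eq.trans ?_ (h₂.symm.trans ?_)
  · rw [Category.assoc, Category.assoc, ← Functor.map_comp]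
    exact congrArg (fun l => _ ≫ a ⟨y.pt, evalStr rfl y⟩ ≫ w.toFun.map l)
      (AffProdObj.hom_ext (Category.comp_id _))
  · refine (Category.assoc _ _ _).symm.trans ((congrArg (· ≫ a y) ?_).trans (Category.id_comp _))
    exact (affProd_map_comp v.toFun _ _ (𝟙 _) (Category.comp_id _)).trans (v.toFun.map_id _)

end Map

end

section

variable {S : Scheme.{u}} {X : BasedCategory.{v, w} (AffOver S)}

/-! ### Vector bundles attached to points of `M(X)` -/

/-- The vector bundle `(v × id)^* E(X)` on `U ×_S X`, for a point `v` of `M(X)` over `U`. -/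
abbrev bundleAt (v : MapObj X (BGL S)) {U : AffOver S} (hv : v.base = U) :
    OMod.{u} (affProd U X) :=
  OMod.pullback (Map.prodId v hv) (univE X)

variable {v w : MapObj X (BGL S)} {U U' : AffOver S} {f : U ⟶ U'}

/-- The identification of `(v × id)^* E(X)` with the pullback of the universal vector bundle. -/
abbrev bundleAtIso (v : MapObj X (BGL S)) {U : AffOver S} (hv : v.base = U) :
    OMod.pullback (Map.prodIdEval v hv) (univBundle S) ≅ bundleAt v hv :=
  OMod.pullbackComp (Map.prodId v hv) (Map.eval X (BGL S)) (univBundle S)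

/-- The isomorphism of vector bundles induced by a morphism of points of `M(X)`. -/
def cellIso (hX : IsCart X) (φ : MapHom v w) (hv : v.base = U) (hw : w.base = U')
    (hf : eqToHom hv.symm ≫ φ.base = f ≫ eqToHom hw.symm) :
    PullIso f (bundleAt w hw) (bundleAt v hv) :=
  have := (BX.isCart hX).isIso_nat (Map.prodIdCell φ hv hw f hf)
  (OMod.pullbackComp (affProdMap f X) (Map.prodId w hw) (univE X)).symm ≪≫
    OMod.pullbackNatIso (asIso (Map.prodIdCell φ hv hw f hf)) (univE X)

lemma cellIso_app (hX : IsCart X) (φ : MapHom v w) (hv : v.base = U) (hw : w.base = U')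
    (hf : eqToHom hv.symm ≫ φ.base = f ≫ eqToHom hw.symm) (y : AffProdObj U X)
    (m : (bundleAt w hw).obj ⟨y.pt, y.str ≫ f⟩) :
    (cellIso hX φ hv hw hf).app y m = (univE X).res ((Map.prodIdCell φ hv hw f hf).app y) m :=
  rfl

/-- The isomorphism is the action on the universal bundle of the evaluated cell. A morphism is
determined by its evaluated cell, and the cell by its action. -/
lemma cellIso_injective (hX : IsCart X) {φ ψ : MapHom v w} {hv : v.base = U} {hw : w.base = U'}
    {hf : eqToHom hv.symm ≫ φ.base = f ≫ eqToHom hw.symm}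
    {hf' : eqToHom hv.symm ≫ ψ.base = f ≫ eqToHom hw.symm}
    (h : cellIso hX φ hv hw hf = cellIso hX ψ hv hw hf') : φ = ψ := by
  refine Map.evalCell_injective (hv := hv) (hw := hw) (hf := hf) (hf' := hf') ?_
  refine univPullback_faithful (hX.affProd U) (v := Map.prodIdEval v hv)
    (v' := BasedFunctor.comp (affProdMap f X) (Map.prodIdEval w hw)) ?_
  refine OMod.Hom.ext' fun y m => ?_
  have h₁ : (cellIso hX φ hv hw hf).app y m = (cellIso hX ψ hv hw hf').app y m := by rw [h]
  have h₂ := (cellIso_app hX φ hv hw hf y m).symm.trans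
    (h₁.trans (cellIso_app hX ψ hv hw hf' y m))
  have h₃ : (univBundle S).res ((Map.evalCell φ hv hw hf).app y) m =
    (univBundle S).res ((Map.evalCell ψ hv hw hf').app y) m := h₂
  exact h₃

/-- By `univPullback_full` the isomorphism comes from a `2`-morphism of evaluations, which by
`Map.exists_evalCell` comes from a morphism of points of `M(X)`. -/
lemma exists_cellIso (hX : IsCart X) (hv : v.base = U) (hw : w.base = U')
    (β : PullIso f (bundleAt w hw) (bundleAt v hv)) :
    ∃ (φ : MapHom v w) (hf : eqToHom hv.symm ≫ φ.base = f ≫ eqToHom hw.symm),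
      cellIso hX φ hv hw hf = β := by
  obtain ⟨α, hα⟩ := univPullback_full (hX.affProd U)
    (OMod.pullbackComp (affProdMap f X) (Map.prodIdEval w hw) (univBundle S) ≪≫
      OMod.pullbackIso (affProdMap f X) (bundleAtIso w hw) ≪≫ β ≪≫ (bundleAtIso v hv).symm)
  obtain ⟨φ, hf, rfl⟩ := Map.exists_evalCell hv hw α
  refine ⟨φ, hf, PullIso.ext' fun y m => ?_⟩
  exact congrArg (fun k => OMod.Hom.app k y m) hα

lemma prodIdCellApp_id (hv : v.base = U)
    (hf : eqToHom hv.symm ≫ (MapHom.id v).base = 𝟙 U ≫ eqToHom hv.symm) (y : AffProdObj U X) :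
    Map.prodIdCellApp (MapHom.id v) hv hv (𝟙 U) hf y =
      (Map.prodId v hv).map (affProdEq (Category.comp_id y.str).symm) :=
  ProdHom.ext (X.p.map_id _).symm (MapHom.pull_congr _ (X.p.map_id _).symm _ _) rfl

lemma cellIso_id (hX : IsCart X) (hv : v.base = U)
    (hf : eqToHom hv.symm ≫ (MapHom.id v).base = 𝟙 U ≫ eqToHom hv.symm) :
    cellIso hX (MapHom.id v) hv hv hf = basePullbackId (bundleAt v hv) :=
  PullIso.ext' fun y m => by
    refine (cellIso_app hX (MapHom.id v) hv hv hf y m).trans ?_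
    refine Eq.trans ?_ (PullIso.id_app (bundleAt v hv) y m).symm
    have h := congrArg (fun k => (univE X).res k m) (prodIdCellApp_id hv hf y)
    have h₁ : (univE X).res ((Map.prodIdCell (MapHom.id v) hv hv (𝟙 U) hf).app y) m =
      (univE X).res ((Map.prodId v hv).map (affProdEq (Category.comp_id y.str).symm)) m := h
    exact h₁

lemma cellIso_comp (hX : IsCart X) {v₀ v₁ v₂ : MapObj X (BGL S)} (φ : MapHom v₀ v₁)
    (ψ : MapHom v₁ v₂) {U₀ U₁ U₂ : AffOver S} {f : U₀ ⟶ U₁} {g : U₁ ⟶ U₂} (h₀ : v₀.base = U₀)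
    (h₁ : v₁.base = U₁) (h₂ : v₂.base = U₂)
    (hf : eqToHom h₀.symm ≫ φ.base = f ≫ eqToHom h₁.symm)
    (hg : eqToHom h₁.symm ≫ ψ.base = g ≫ eqToHom h₂.symm)
    (hfg : eqToHom h₀.symm ≫ (φ.comp ψ).base = (f ≫ g) ≫ eqToHom h₂.symm) :
    cellIso hX (φ.comp ψ) h₀ h₂ hfg =
      (cellIso hX φ h₀ h₁ hf).comp (cellIso hX ψ h₁ h₂ hg) := by
  refine PullIso.ext' fun y m => ?_
  refine (cellIso_app hX _ h₀ h₂ hfg y m).trans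
    (Eq.trans ?_ (PullIso.comp_app _ _ y m).symm)
  refine (congrArg (fun k => (univE X).res k m)
    (Map.prodIdCellApp_comp φ ψ h₀ h₁ h₂ f g hf hg hfg y)).trans ?_
  refine ((univE X).res_comp _ _ m).trans ?_
  exact congrArg _ ((univE X).res_comp _ _ m)

end

section

variable {S : Scheme.{u}} {X : BasedCategory.{v, w} (AffOver S)}
  {B : BasedCategory.{v₁, w₁} (AffOver S)}

/-! ### Families of sections of the internal Hom -/

variable {P : OMod.{t₁} B} {Q : OMod.{t₂} B}

lemma OMod.Hom.res_at_id {x y : B.obj} (g : y ⟶ x)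
    (φ : OMod.Hom (P.restrict x) (Q.restrict x)) (p : P.obj x) :
    OMod.Hom.at (OMod.Hom.res g φ) (𝟙 y) (P.res g p) = Q.res g (φ.at (𝟙 x) p) := by
  rw [OMod.Hom.res_at, φ.at_congr ((Category.id_comp g).trans (Category.comp_id g).symm),
    OMod.Hom.at_res]

namespace Family

variable {a b : MapObj X B}

/-- The section at a point of a family of sections of the internal Hom, as a linear map. -/
def linAt (m : Family (OMod.ihom P Q) a) (y : AffProdObj a.base X) :
    P.obj (a.mor.obj y) →ₗ[O B (a.mor.obj y)] Q.obj (a.mor.obj y) :=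
  OMod.Hom.at (m.val y) (𝟙 (a.mor.obj y))

lemma linAt_res (m : Family (OMod.ihom P Q) a) ⦃y z : AffProdObj a.base X⦄ (k : y ⟶ z)
    (p : P.obj (a.mor.obj z)) :
    m.linAt y (P.res (a.mor.map k) p) = Q.res (a.mor.map k) (m.linAt z p) := by
  have h : OMod.Hom.res (a.mor.map k) (m.val z) = m.val y := m.res k
  refine Eq.trans ?_ (OMod.Hom.res_at_id (a.mor.map k) (m.val z) p)
  rw [h]
  rfl

/-- The morphism of modules defined by a family of sections of the internal Hom. -/
def toHom (m : Family (OMod.ihom P Q) a) :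
    OMod.Hom (OMod.pullback a.mor P) (OMod.pullback a.mor Q) :=
  OMod.Hom.ofOverLin (F := a.mor) m.linAt m.linAt_res

lemma linAt_pull (φ : a ⟶ b) (m : Family (OMod.ihom P Q) b) (y : AffProdObj a.base X)
    (p : P.obj (b.toFun.obj ⟨y.pt, y.str ≫ MapHom.base φ⟩)) :
    (m.pull φ).linAt y (P.res (MapHom.app φ y) p) =
      Q.res (MapHom.app φ y) (m.linAt ⟨y.pt, y.str ≫ MapHom.base φ⟩ p) :=
  OMod.Hom.res_at_id (MapHom.app φ y) (m.val ⟨y.pt, y.str ≫ MapHom.base φ⟩) p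

/-- A section of the internal Hom is more than its value at the identity, but a compatible family is
determined by these values (`OMod.Hom.eq_of_families`). -/
lemma ext_linAt (hX : IsCart X) (hB : IsCart B) {m m' : Family (OMod.ihom P Q) a}
    (h : ∀ y p, m.linAt y p = m'.linAt y p) : m = m' := by
  refine ext_val (congrFun ?_)
  exact OMod.Hom.eq_of_families (G := a.mor) (hX.affProd _) hB (fun y z k => m.res k)
    (fun y z k => m'.res k) h

/-- The components of `φ` are isomorphisms of `B`, so every element of the source is a restriction
along one, and equality can be tested there. -/
lemma pull_eq_iff (hX : IsCart X) (hB : IsCart B) (φ : a ⟶ b) (m : Family (OMod.ihom P Q) b)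
    (m' : Family (OMod.ihom P Q) a) : m.pull φ = m' ↔
      ∀ (y : AffProdObj a.base X) (p : P.obj (b.toFun.obj ⟨y.pt, y.str ≫ MapHom.base φ⟩)),
        m'.linAt y (P.res (MapHom.app φ y) p) =
          Q.res (MapHom.app φ y) (m.linAt ⟨y.pt, y.str ≫ MapHom.base φ⟩ p) := by
  constructor
  · rintro rfl y p
    exact linAt_pull φ m y p
  · intro h
    refine ext_linAt hX hB fun y p => ?_
    have := MapHom.app_lift φ y
    have : IsIso (MapHom.app φ y) := hB.isIso_of_lift (𝟙 (X.p.obj y.pt)) _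
    obtain ⟨p, rfl⟩ := (P.res_bijective (MapHom.app φ y)).2 p
    exact (linAt_pull φ m y p).trans (h y p).symm

/-- The values of `s` are linear over the functions on `B`, and `OMod.Hom.exists_family` spreads
them to local morphisms. -/
lemma exists_toHom (hX : IsCart X) (hB : IsCart B)
    (s : OMod.Hom (OMod.pullback a.mor P) (OMod.pullback a.mor Q)) :
    ∃ m : Family (OMod.ihom P Q) a, m.toHom = s := by
  obtain ⟨m, hm, hm'⟩ := OMod.Hom.exists_family (G := a.mor) (hX.affProd _) hB
    (OMod.Hom.overLin s) (fun _ _ => OMod.Hom.overLin_naturality s)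
  exact ⟨⟨m, fun y z k => hm k⟩, OMod.Hom.ext' fun y p => hm' y p⟩

end Family

end

section

variable {S : Scheme.{u}} {X : BasedCategory.{v, w} (AffOver S)}

/-! ### Arrow bundles and families of sections -/

variable {z z' : ProdObj (MapBGL X) (MapBGL X)}

/-- The arrow of vector bundles defined by a family of sections. -/
def pairHom (m : Family (homBox X) ((Map.prodIdPair X (BGL S)).obj z)) :
    bundleAt z.fst z.fst_base ⟶ bundleAt z.snd z.snd_base :=
  (OMod.pullbackComp (prod.lift (Map.prodId z.fst z.fst_base) (Map.prodId z.snd z.snd_base))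
    (prod.pr₁ (BX X) (BX X)) (univE X)).hom ≫ m.toHom ≫
  (OMod.pullbackComp (prod.lift (Map.prodId z.fst z.fst_base) (Map.prodId z.snd z.snd_base))
    (prod.pr₂ (BX X) (BX X)) (univE X)).inv

lemma exists_pairHom (hX : IsCart X) (s : bundleAt z.fst z.fst_base ⟶ bundleAt z.snd z.snd_base) :
    ∃ m : Family (homBox X) ((Map.prodIdPair X (BGL S)).obj z), pairHom m = s := by
  obtain ⟨m, hm⟩ := Family.exists_toHom (a := (Map.prodIdPair X (BGL S)).obj z) hX
    ((BX.isCart hX).prod (BX.isCart hX))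
    ((OMod.pullbackComp (prod.lift (Map.prodId z.fst z.fst_base) (Map.prodId z.snd z.snd_base))
      (prod.pr₁ (BX X) (BX X)) (univE X)).inv ≫ s ≫
    (OMod.pullbackComp (prod.lift (Map.prodId z.fst z.fst_base) (Map.prodId z.snd z.snd_base))
      (prod.pr₂ (BX X) (BX X)) (univE X)).hom)
  refine ⟨m, OMod.Hom.ext' fun y p => ?_⟩
  exact congrArg (fun k => OMod.Hom.app k y p) hm

/-- The isomorphism of the first vector bundles defined by a morphism of pairs. -/
abbrev fstIso (hX : IsCart X) (k : z ⟶ z') :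
    PullIso (ProdHom.base k) (bundleAt z'.fst z'.fst_base) (bundleAt z.fst z.fst_base) :=
  cellIso hX (ProdHom.fst k) z.fst_base z'.fst_base
    (Map.base_comm z.fst_base z'.fst_base _ _ k.fst_lift)

/-- The isomorphism of the second vector bundles defined by a morphism of pairs. -/
abbrev sndIso (hX : IsCart X) (k : z ⟶ z') :
    PullIso (ProdHom.base k) (bundleAt z'.snd z'.snd_base) (bundleAt z.snd z.snd_base) :=
  cellIso hX (ProdHom.snd k) z.snd_base z'.snd_base
    (Map.base_comm z.snd_base z'.snd_base _ _ k.snd_lift)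

/-- Both conditions are the same equation on sections: the cell of `Map.prodIdPair` has the two
cells `Map.prodIdCell` as components, and `fstIso` and `sndIso` are restriction along these. -/
lemma pairHom_comm_iff (hX : IsCart X) (k : z ⟶ z')
    (m : Family (homBox X) ((Map.prodIdPair X (BGL S)).obj z))
    (m' : Family (homBox X) ((Map.prodIdPair X (BGL S)).obj z')) :
    m'.pull ((Map.prodIdPair X (BGL S)).map k) = m ↔
      OMod.pullbackMap (affProdMap (ProdHom.base k) X) (pairHom m') ≫ (sndIso hX k).hom =
        (fstIso hX k).hom ≫ pairHom m := by
  refine (Family.pull_eq_iff hX ((BX.isCart hX).prod (BX.isCart hX)) _ m' m).trans ?_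
  constructor
  · intro h
    refine OMod.Hom.ext' fun y p => ?_
    exact (h y p).symm
  · intro h y p
    exact (congrArg (fun k => OMod.Hom.app k y p) h).symm

end

section

variable {S : Scheme.{u}} {X : BasedCategory.{v, w} (AffOver S)}

/-! ### The equivalence of families of sections and arrow bundles -/

lemma ArrHom.mk_congr {x y : ArrObj X} {f : x.base ⟶ y.base} {a a' : PullIso f y.E x.E}
    {b b' : PullIso f y.F x.F} (ha : a = a') (hb : b = b')
    (h : OMod.pullbackMap (affProdMap f X) y.s ≫ b.hom = a.hom ≫ x.s)
    (h' : OMod.pullbackMap (affProdMap f X) y.s ≫ b'.hom = a'.hom ≫ x.s) :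
    ArrHom.mk f a b h = ArrHom.mk f a' b' h' := by
  subst ha hb
  rfl

lemma bundleAt_isVect (hX : IsCart X) (v : MapObj X (BGL S)) {U : AffOver S} (hv : v.base = U) :
    (bundleAt v hv).IsVect :=
  (univE.isVect hX).pullback (hX.affProd U) (BX.isCart hX) _

lemma fstIso_id (hX : IsCart X) (z : ProdObj (MapBGL X) (MapBGL X)) :
    fstIso hX (𝟙 z) = basePullbackId (bundleAt z.fst z.fst_base) :=
  cellIso_id hX _ _

lemma sndIso_id (hX : IsCart X) (z : ProdObj (MapBGL X) (MapBGL X)) :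
    sndIso hX (𝟙 z) = basePullbackId (bundleAt z.snd z.snd_base) :=
  cellIso_id hX _ _

lemma fstIso_comp (hX : IsCart X) {z₀ z₁ z₂ : ProdObj (MapBGL X) (MapBGL X)} (k : z₀ ⟶ z₁)
    (l : z₁ ⟶ z₂) : fstIso hX (k ≫ l) = (fstIso hX k).comp (fstIso hX l) :=
  cellIso_comp hX (ProdHom.fst k) (ProdHom.fst l) z₀.fst_base z₁.fst_base z₂.fst_base
    (Map.base_comm z₀.fst_base z₁.fst_base _ _ k.fst_lift)
    (Map.base_comm z₁.fst_base z₂.fst_base _ _ l.fst_lift)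
    (Map.base_comm z₀.fst_base z₂.fst_base _ _ (k ≫ l).fst_lift)

lemma sndIso_comp (hX : IsCart X) {z₀ z₁ z₂ : ProdObj (MapBGL X) (MapBGL X)} (k : z₀ ⟶ z₁)
    (l : z₁ ⟶ z₂) : sndIso hX (k ≫ l) = (sndIso hX k).comp (sndIso hX l) :=
  cellIso_comp hX (ProdHom.snd k) (ProdHom.snd l) z₀.snd_base z₁.snd_base z₂.snd_base
    (Map.base_comm z₀.snd_base z₁.snd_base _ _ k.snd_lift)
    (Map.base_comm z₁.snd_base z₂.snd_base _ _ l.snd_lift)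
    (Map.base_comm z₀.snd_base z₂.snd_base _ _ (k ≫ l).snd_lift)

/-- The arrow bundle of a pair of points of `M(X)` with a family of sections. -/
abbrev arrObjOf (hX : IsCart X) (a : FamObj (homBox X) (Map.prodIdPair X (BGL S))) : ArrObj X where
  base := a.pt.base
  E := bundleAt a.pt.fst a.pt.fst_base
  F := bundleAt a.pt.snd a.pt.snd_base
  isVect_E := bundleAt_isVect hX _ _
  isVect_F := bundleAt_isVect hX _ _
  s := pairHom a.fam

/-- The morphism of arrow bundles of a morphism of pairs with families of sections. -/
abbrev arrHomOf (hX : IsCart X) {a b : FamObj (homBox X) (Map.prodIdPair X (BGL S))} (k : a ⟶ b) :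
    ArrHom (arrObjOf hX a) (arrObjOf hX b) where
  base := ProdHom.base (FamHom.hom k)
  a := fstIso hX (FamHom.hom k)
  b := sndIso hX (FamHom.hom k)
  comm := (pairHom_comm_iff hX (FamHom.hom k) a.fam b.fam).1 (FamHom.pull k)

/-- The functor from pairs of points of `M(X)` with families of sections to arrow bundles. -/
def toArrBun (hX : IsCart X) :
    BasedFunctor (famCat (homBox X) (Map.prodIdPair X (BGL S))) (ArrBun X) where
  obj := arrObjOf hX
  map := arrHomOf hX
  map_id _ := ArrHom.mk_congr (fstIso_id hX _) (sndIso_id hX _) _ _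
  map_comp _ _ := ArrHom.mk_congr (fstIso_comp hX _ _) (sndIso_comp hX _ _) _ _
  w := rfl

lemma toArrBun_faithful (hX : IsCart X) {a b : FamObj (homBox X) (Map.prodIdPair X (BGL S))}
    {k l : a ⟶ b} (h : (toArrBun hX).map k = (toArrBun hX).map l) : k = l := by
  obtain ⟨⟨f, k₁, k₂, _, _⟩, _⟩ := k
  obtain ⟨⟨g, l₁, l₂, _, _⟩, _⟩ := l
  have hfg : f = g := congrArg ArrHom.base h
  subst hfg
  injection h with _ h₁ h₂
  have e₁ := cellIso_injective hX h₁
  have e₂ := cellIso_injective hX h₂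
  subst e₁ e₂
  rfl

/-- The two isomorphisms of bundles come from morphisms of points by `exists_cellIso`, and the
commuting square is exactly the compatibility of the families. -/
lemma toArrBun_full (hX : IsCart X) {a b : FamObj (homBox X) (Map.prodIdPair X (BGL S))}
    (h : (toArrBun hX).obj a ⟶ (toArrBun hX).obj b) : ∃ k, (toArrBun hX).map k = h := by
  obtain ⟨f, α, β, hc⟩ := h
  obtain ⟨k₁, e₁, rfl⟩ := exists_cellIso hX a.pt.fst_base b.pt.fst_base α
  obtain ⟨k₂, e₂, rfl⟩ := exists_cellIso hX a.pt.snd_base b.pt.snd_base β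
  let k : a.pt ⟶ b.pt :=
    { base := f
      fst := k₁
      snd := k₂
      fst_lift := IsHomLift.of_fac' _ _ _ a.pt.fst_base b.pt.fst_base (by
        change k₁.base = _
        rw [← e₁]
        simp)
      snd_lift := IsHomLift.of_fac' _ _ _ a.pt.snd_base b.pt.snd_base (by
        change k₂.base = _
        rw [← e₂]
        simp) }
  exact ⟨⟨k, (pairHom_comm_iff hX k a.fam b.fam).2 hc⟩, rfl⟩

end

/-! ### Essential surjectivity and the equivalence with arrow bundles -/

section

variable {S : Scheme.{u}} {X : BasedCategory.{v, w} (AffOver S)}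

/-- A morphism `v` classifying `E` exists by `exists_univPullback_iso`. The bundle attached to it is
computed by evaluation along `v × id`, and the `2`-morphism `α` compares this with `v`. -/
lemma exists_bundleAt_iso (hX : IsCart X) {U : AffOver S} {E : OMod.{u} (affProd U X)}
    (hE : E.IsVect) : ∃ v : BasedFunctor (affProd U X) (BGL S),
      Nonempty (bundleAt (⟨U, v⟩ : MapObj X (BGL S)) rfl ≅ E) := by
  obtain ⟨v, ⟨i⟩⟩ := exists_univPullback_iso (hX.affProd U) hE
  have e (y : AffProdObj U X) : y.str = Map.evalStr (v := ⟨U, v⟩) rfl y := by simp [Map.evalStr]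
  let α : v ⟶ Map.prodIdEval (⟨U, v⟩ : MapObj X (BGL S)) rfl :=
    { app := fun y => v.map (affProdEq (e y))
      naturality := fun y y' k => by
        refine Eq.trans ?_ (congrArg (v.map (affProdEq (e y)) ≫ ·)
          (Map.prodIdEval_map (⟨U, v⟩ : MapObj X (BGL S)) rfl k).symm)
        refine (v.map_comp _ _).symm.trans (Eq.trans ?_ (v.map_comp _ _))
        exact congrArg v.map (AffProdObj.hom_ext
          ((Category.comp_id _).trans (Category.id_comp _).symm))
      isHomLift' := fun y => isHomLift_id (X := BGL S) _ (v.w_obj y) (v.w_obj _)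
        (Map.map_affProdEq v (e y)) }
  have := (BGL.isCart S).isIso_nat α
  exact ⟨v, ⟨(bundleAtIso (⟨U, v⟩ : MapObj X (BGL S)) rfl).symm ≪≫
    OMod.pullbackNatIso (asIso α) (univBundle S) ≪≫ i⟩⟩

lemma basePullbackId_naturality (x : ArrObj X) :
    OMod.pullbackMap (affProdMap (𝟙 x.base) X) x.s ≫ (basePullbackId x.F).hom =
      (basePullbackId x.E).hom ≫ x.s :=
  ArrHom.comm (𝟙 x : x ⟶ x)

/-- For essential surjectivity, classify `E` and `F` by points `v` and `w` over the same base, and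
transport `s` along the isomorphisms `i` and `j` to an arrow, which comes from a family of sections.
-/
lemma isBasedEquiv_toArrBun (hX : IsCart X) : IsBasedEquiv (toArrBun hX) where
  faithful h := toArrBun_faithful hX h
  full h := toArrBun_full hX h
  ess x := by
    obtain ⟨v, ⟨i⟩⟩ := exists_bundleAt_iso hX x.isVect_E
    obtain ⟨w, ⟨j⟩⟩ := exists_bundleAt_iso hX x.isVect_F
    let z : ProdObj (MapBGL X) (MapBGL X) := ⟨x.base, ⟨x.base, v⟩, ⟨x.base, w⟩, rfl, rfl⟩
    obtain ⟨m, hm⟩ := exists_pairHom (z := z) hX (i.hom ≫ x.s ≫ j.inv)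
    let h : ArrHom (arrObjOf hX ⟨z, m⟩) x :=
      { base := 𝟙 x.base
        a := basePullbackId x.E ≪≫ i.symm
        b := basePullbackId x.F ≪≫ j.symm
        comm := by
          have h₁ : i.inv ≫ pairHom m = x.s ≫ j.inv := by rw [hm, Iso.inv_hom_id_assoc]
          refine (Category.assoc _ _ _).symm.trans ((congrArg (· ≫ j.inv)
            (basePullbackId_naturality x)).trans ?_)
          exact (Category.assoc _ _ _).trans ((congrArg ((basePullbackId x.E).hom ≫ ·) h₁).symm.trans
            (Category.assoc _ _ _).symm) }
    have hh : (ArrBun X).p.IsHomLift (𝟙 x.base) (show (toArrBun hX).obj ⟨z, m⟩ ⟶ x from h) :=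
      isHomLift_id (X := ArrBun X) _ rfl rfl rfl
    -- A morphism of arrow bundles over an identity is invertible because `ArrBun X` is a prestack,
    -- so no inverse has to be written down.
    have : IsIso (show (toArrBun hX).obj ⟨z, m⟩ ⟶ x from h) :=
      (ArrBun.isCart hX).isIso_of_lift (𝟙 x.base) _
    exact ⟨⟨z, m⟩, asIso (show (toArrBun hX).obj ⟨z, m⟩ ⟶ x from h), rfl, rfl⟩

lemma IsBasedEquiv.comp {X : BasedCategory.{v₁, w₁} (AffOver S)}
    {Y : BasedCategory.{v₂, w₂} (AffOver S)} {Z : BasedCategory.{v₃, w₃} (AffOver S)}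
    {F : BasedFunctor X Y} {G : BasedFunctor Y Z} (hF : IsBasedEquiv F) (hG : IsBasedEquiv G) :
    IsBasedEquiv (BasedFunctor.comp F G) where
  faithful h := hF.faithful (hG.faithful h)
  full h := by
    obtain ⟨k, rfl⟩ := hG.full h
    obtain ⟨l, rfl⟩ := hF.full k
    exact ⟨l, rfl⟩
  ess z := by
    obtain ⟨y, j, e, hj⟩ := hG.ess z
    obtain ⟨x, i, e', hi⟩ := hF.ess y
    refine ⟨x, G.mapIso i ≪≫ j, ((G.w_obj _).trans e').trans ((G.w_obj _).symm.trans e), ?_⟩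
    refine (Z.p.map_comp (G.map i.hom) j.hom).trans ?_
    rw [hj, based_map, hi]
    simp
    rfl

/-- The sheaf property and local dual bases pass to the internal Hom, and they are all that
reflexivity uses. -/
lemma homBox_isLocallyProjective (hX : IsCart X) : (homBox X).IsLocallyProjective :=
  have hB := (BX.isCart hX).prod (BX.isCart hX)
  .ihom hB ((univE.isVect hX).pullback hB (BX.isCart hX) _).isLocallyProjective
    ((univE.isVect hX).pullback hB (BX.isCart hX) _).isLocallyProjective

lemma exists_isBasedEquiv_arrBunMap (hX : IsCart X) :
    ∃ Ψ : BasedFunctor (ArrBunMap X) (ArrBun X), IsBasedEquiv Ψ :=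
  ⟨_, (famCat.isBasedEquiv_ofFibProd ((BX.isCart hX).prod (BX.isCart hX))
    (homBox_isLocallyProjective hX) (Map.prodIdPair X (BGL S))).comp (isBasedEquiv_toArrBun hX)⟩

end

end ArrowBundle

end

/-! ### The theorem -/

theorem mainTheorem8 (S : Scheme.{u}) (X : BasedCategory.{v, w} (ArrowBundle.AffOver S))
    (hX : ArrowBundle.IsPrestack X) :
    ArrowBundle.IsPrestack (ArrowBundle.ArrBunMap X) ∧
      ArrowBundle.IsPrestack (ArrowBundle.ArrBun X) ∧
      ∃ (Ψ : BasedFunctor (ArrowBundle.ArrBunMap X) (ArrowBundle.ArrBun X))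
        (Φ : BasedFunctor (ArrowBundle.ArrBun X) (ArrowBundle.ArrBunMap X)),
        Nonempty (BasedFunctor.comp Ψ Φ ≅ BasedFunctor.id (ArrowBundle.ArrBunMap X)) ∧
        Nonempty (BasedFunctor.comp Φ Ψ ≅ BasedFunctor.id (ArrowBundle.ArrBun X)) := by
  obtain ⟨Ψ, hΨ⟩ := ArrowBundle.exists_isBasedEquiv_arrBunMap hX.isCart
  have hA := ArrowBundle.ArrBun.isCart hX.isCart
  -- The fibration property of `M_1'(X)` is carried back along `Ψ` from the arrow bundles, where it
  -- was checked directly.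
  exact ⟨(hΨ.isCart hA).isPrestack, hA.isPrestack, Ψ, hΨ.exists_quasiInverse⟩
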